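/- **Theorem 3.1.** Let $H\in(1/2,1)$. Let $(\Omega,\mathcal F,P)$ be a probability space carrying, for every $n\in\mathbb N$, independent random variables $\xi^n_1,\dots,\xi^n_n$ with values in $\{-1,1\}$ and $P(\xi^n_i=1)=P(\xi^n_i=-1)=\tfrac12$. For $t\in[0,1]$ put $$B^{H,n}_t=\sum_{i=1}^{\lfloor nt\rfloor} n\int_{(i-1)/n}^{i/n} z_H\Big(\frac{\lfloor nt\rfloor}{n},s\Big)\,ds\;\frac1{\sqrt n}\,\xi^n_i ,$$ where $$z_H(t,s)=\mathbf 1_{\{t\ge s\}}\,c_H\big(H-\tfrac12\big)s^{1/2-H}\int_s^t u^{H-1/2}(u-s)^{H-3/2}\,du,\qquad c_H=\sqrt{\frac{2H\,\Gamma(3/2-H)}{\Gamma(H+1/2)\,\Gamma(2-2H)}} .$$ For $A\subseteq\{1,\dots,n\}$ let $\Xi^n_A=\prod_{i\in A}\xi^n_i$. The discrete Wick product $\diamond_n$ is the bilinear operation on $L^2(\Omega,\sigma(\xi^n_1,\dots,\xi^n_n),P)$ with $\Xi^n_A\diamond_n\Xi^n_B=\Xi^n_{A\cup B}$ if $A\cap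 B=\emptyset$ and $\Xi^n_A\diamond_n\Xi^n_B=0$ otherwise; the discrete Wick powers are $X^{\diamond_n 0}=1$ and $X^{\diamond_n(k+1)}=X^{\diamond_n k}\diamond_n X$. Let $B^H=(B^H_t)_{t\in[0,1]}$ be a fractional Brownian motion with Hurst parameter $H$ (on some probability space), that is, a continuous centered Gaussian process with $\mathbf E[B^H_tB^H_s]=\frac12(t^{2H}+s^{2H}-|t-s|^{2H})$. For a centered Gaussian random variable $\Phi$ let $\exp^{\diamond}(\Phi)=\exp(\Phi-\frac12\mathbf E[\Phi^2])$ be its Wick exponential and $\Phi^{\diamond k}=\frac{d^k}{dw^k}\exp^{\diamond}(w\Phi)\big|_{w=0}$, $k\ge 0$, its Wick powers. Let $(a_{n,k})_{n,k\ge0}$ be real numbers such that 1. $\lim_{n\to\infty}a_{n,k}=a_k$ exists in $\mathbb R$ for every $k\ge0$; 2. there is $C\ge0$ with $|a_{n,k}|\le C^k$ for all $n,k\ge1$. Then almost surely the series $\sum_{k=0}^\infty\frac{a_k}{k!}(B^H_t)^{\diamond k}$ converges for every $t\in[0,1]$, and the processes $$\sum_{k=0}^{n}\frac{a_{n,k}}{k!}\big(B^{H,n}\big)^{\diamond_n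 k}$$ converge weakly, as $n\to\infty$, to the Wick power series $\sum_{k=0}^{\infty}\frac{a_k}{k!}(B^H)^{\diamond k}$ in the Skorokhod space $D([0,1],\mathbb R)$ of right-continuous functions with left limits, equipped with the Skorokhod ($J_1$) topology. -/

import Mathlib

open MeasureTheory ProbabilityTheory Filter Topology
open scoped ENNReal Nat

noncomputable section

namespace WickApprox

/-! ### The Skorokhod space `D([0,1], ℝ)` -/

/-- Right-continuous functions on `[0,1]` with left limits. At the endpoint `0` the left limit,
and at the endpoint `1` the right-continuity, are void conditions. -/
def IsCadlag (x : unitInterval → ℝ) : Prop :=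
  ∀ t, ContinuousWithinAt x (Set.Ici t) t ∧ ∃ l : ℝ, Tendsto x (𝓝[<] t) (𝓝 l)

/-- The space `D([0,1], ℝ)`. -/
@[ext]
structure SkorokhodSpace where
  toFun : unitInterval → ℝ
  isCadlag : IsCadlag toFun

namespace SkorokhodSpace

instance : CoeFun SkorokhodSpace (fun _ => unitInterval → ℝ) := ⟨toFun⟩

/-- The cost of matching `x` with `y` through the time change `lam` (an increasing bijection of
`[0,1]`, hence a homeomorphism):
`max (sup_t |lam t - t|) (sup_t |x t - y (lam t)|)`. -/
def cost (x y : SkorokhodSpace) (lam : unitInterval ≃o unitInterval) : ℝ≥0∞ :=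
  max (⨆ t, edist (lam t) t) (⨆ t, edist (x t) (y (lam t)))

theorem cost_refl (x : SkorokhodSpace) : cost x x (OrderIso.refl _) = 0 := by
  simp [cost]

theorem cost_symm_le (x y : SkorokhodSpace) (lam : unitInterval ≃o unitInterval) :
    cost y x lam.symm ≤ cost x y lam := by
  refine max_le (iSup_le fun t => ?_) (iSup_le fun t => ?_)
  · refine le_trans ?_ (le_max_left _ _)
    refine le_trans ?_ (le_iSup (fun t => edist (lam t) t) (lam.symm t))
    simp [edist_comm]
  · refine le_trans ?_ (le_max_right _ _)
    refine le_trans ?_ (le_iSup (fun t => edist (x t) (y (lam t))) (lam.symm t))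
    simp [edist_comm]

theorem cost_trans_le (x y z : SkorokhodSpace) (lam mu : unitInterval ≃o unitInterval) :
    cost x z (lam.trans mu) ≤ cost x y lam + cost y z mu := by
  refine max_le (iSup_le fun t => ?_) (iSup_le fun t => ?_)
  · calc edist ((lam.trans mu) t) t
        ≤ edist (lam t) t + edist (mu (lam t)) (lam t) := by
          rw [add_comm]; exact edist_triangle _ _ _
      _ ≤ _ := add_le_add
          ((le_iSup (fun t => edist (lam t) t) t).trans (le_max_left _ _))
          ((le_iSup (fun t => edist (mu t) t) (lam t)).trans (le_max_left _ _))
  · calc edist (x t) (z ((lam.trans mu) t))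
        ≤ edist (x t) (y (lam t)) + edist (y (lam t)) (z (mu (lam t))) := edist_triangle _ _ _
      _ ≤ _ := add_le_add
          ((le_iSup (fun t => edist (x t) (y (lam t))) t).trans (le_max_right _ _))
          ((le_iSup (fun t => edist (y t) (z (mu t))) (lam t)).trans (le_max_right _ _))

/-- The Skorokhod distance (with values in `ℝ≥0∞`), the infimum of the cost over all time
changes; its topology is the Skorokhod `J₁` topology. -/
instance : PseudoEMetricSpace SkorokhodSpace where
  edist x y := ⨅ lam : unitInterval ≃o unitInterval, cost x y lam
  edist_self x := le_antisymm ((iInf_le _ (OrderIso.refl _)).trans (cost_refl x).le) bot_le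
  edist_comm x y := le_antisymm
    (le_iInf fun lam => (iInf_le _ lam.symm).trans (cost_symm_le y x lam))
    (le_iInf fun lam => (iInf_le _ lam.symm).trans (cost_symm_le x y lam))
  edist_triangle x y z := by
    refine ENNReal.le_iInf_add_iInf fun lam mu => ?_
    exact (iInf_le _ (lam.trans mu)).trans (cost_trans_le x y z lam mu)

instance : MeasurableSpace SkorokhodSpace := borel _

instance : BorelSpace SkorokhodSpace := ⟨rfl⟩

end SkorokhodSpace

/-! ### Fractional Brownian motion and its Wick powers -/

/-- `B` is a fractional Brownian motion on `[0,1]` with Hurst parameter `H` under `P`: a centered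
Gaussian process with (almost surely) continuous paths and the covariance function below (which
forces the increments to be stationary). -/
structure IsFractionalBrownianMotion {Ω : Type*} [MeasurableSpace Ω] (H : ℝ)
    (B : unitInterval → Ω → ℝ) (P : Measure Ω) : Prop where
  isGaussianProcess : IsGaussianProcess B P
  integral_eq_zero : ∀ t, ∫ ω, B t ω ∂P = 0
  covariance : ∀ s t : unitInterval, ∫ ω, B t ω * B s ω ∂P =
    (1 / 2) * (|(t : ℝ)| ^ (2 * H) + |(s : ℝ)| ^ (2 * H) - |(t : ℝ) - (s : ℝ)| ^ (2 * H))
  continuous_paths : ∀ᵐ ω ∂P, Continuous fun t => B t ω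

/-- The Wick exponential `exp^⋄(Φ) = exp (Φ - E[Φ²] / 2)` of a centered Gaussian variable `Φ`. -/
def wickExp {Ω : Type*} [MeasurableSpace Ω] (P : Measure Ω) (Φ : Ω → ℝ) (ω : Ω) : ℝ :=
  Real.exp (Φ ω - (1 / 2) * ∫ ω', |Φ ω'| ^ 2 ∂P)

/-- The Wick power `Φ^⋄k` of a centered Gaussian variable `Φ`: the `k`-th derivative of
`w ↦ exp^⋄(w Φ)` at `w = 0`. -/
def wickPower {Ω : Type*} [MeasurableSpace Ω] (P : Measure Ω) (Φ : Ω → ℝ) (k : ℕ) (ω : Ω) : ℝ :=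
  iteratedDeriv k (fun w : ℝ => wickExp P (fun ω' => w * Φ ω') ω) 0

/-! ### The disturbed binary random walk -/

/-- The constant `c_H`. -/
def kernelConst (H : ℝ) : ℝ :=
  Real.sqrt (2 * H * Real.Gamma (3 / 2 - H) / (Real.Gamma (H + 1 / 2) * Real.Gamma (2 - 2 * H)))

/-- The Molchan–Golosov kernel `z_H(t, s)` for `H > 1/2`. -/
def kernel (H t s : ℝ) : ℝ :=
  if s ≤ t then
    kernelConst H * (H - 1 / 2) * s ^ (1 / 2 - H) *
      ∫ u in s..t, u ^ (H - 1 / 2) * (u - s) ^ (H - 3 / 2)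
  else 0

/-- For every `n`, the row `ξ n 1, …, ξ n n` consists of independent symmetric `{-1, 1}`-valued
random variables (the entries `ξ n i` with `i = 0` or `i > n` are never used). -/
structure IsBernoulliArray {Ω : Type*} [MeasurableSpace Ω] (ξ : ℕ → ℕ → Ω → ℝ)
    (P : Measure Ω) : Prop where
  measurable : ∀ n, ∀ i ∈ Finset.Icc 1 n, Measurable (ξ n i)
  values : ∀ n, ∀ i ∈ Finset.Icc 1 n, ∀ ω, ξ n i ω = 1 ∨ ξ n i ω = -1
  symmetric : ∀ n, ∀ i ∈ Finset.Icc 1 n, P {ω | ξ n i ω = 1} = P {ω | ξ n i ω = -1}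
  independent : ∀ n, iIndepFun (fun i : Finset.Icc 1 n => ξ n i) P

/-- The disturbed binary random walk
`B^{H,n}_t = ∑_{i=1}^{⌊nt⌋} (n ∫_{(i-1)/n}^{i/n} z_H(⌊nt⌋/n, s) ds) (1/√n) ξ^n_i`. -/
def disturbedWalk {Ω : Type*} (H : ℝ) (ξ : ℕ → ℕ → Ω → ℝ) (n : ℕ) (t : unitInterval) (ω : Ω) : ℝ :=
  ∑ i ∈ Finset.Icc 1 ⌊(n : ℝ) * (t : ℝ)⌋₊,
    ((n : ℝ) * ∫ s in (((i : ℝ) - 1) / n)..((i : ℝ) / n),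
      kernel H ((⌊(n : ℝ) * (t : ℝ)⌋₊ : ℝ) / n) s) * (1 / Real.sqrt n) * ξ n i ω

/-! ### The discrete Wick product -/

/-- The Walsh function `Ξ_A = ∏_{i ∈ A} ξ_i` of a row `ξ`. -/
def walsh {Ω : Type*} (ξ : ℕ → Ω → ℝ) (A : Finset ℕ) (ω : Ω) : ℝ := ∏ i ∈ A, ξ i ω

/-- The coefficient `E[X Ξ_A]` of `Ξ_A` in the Walsh decomposition `X = ∑_A x_A Ξ_A`. -/
def walshCoeff {Ω : Type*} [MeasurableSpace Ω] (P : Measure Ω) (ξ : ℕ → Ω → ℝ) (X : Ω → ℝ)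
    (A : Finset ℕ) : ℝ :=
  ∫ ω, X ω * walsh ξ A ω ∂P

/-- The discrete Wick product of `X` and `Y` with respect to `ξ_1, …, ξ_n`: the bilinear extension
of `Ξ_A ⋄ Ξ_B = Ξ_{A ∪ B}` if `A ∩ B = ∅`, and `Ξ_A ⋄ Ξ_B = 0` otherwise
(`A, B ⊆ {1, …, n}`). -/
def discreteWick {Ω : Type*} [MeasurableSpace Ω] (P : Measure Ω) (n : ℕ) (ξ : ℕ → Ω → ℝ)
    (X Y : Ω → ℝ) (ω : Ω) : ℝ :=
  ∑ A ∈ (Finset.Icc 1 n).powerset, ∑ B ∈ (Finset.Icc 1 n).powerset,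
    if Disjoint A B then walshCoeff P ξ X A * walshCoeff P ξ Y B * walsh ξ (A ∪ B) ω else 0

/-- Discrete Wick powers: `X^⋄0 = 1` and `X^⋄(k+1) = X^⋄k ⋄ X`. -/
def discreteWickPower {Ω : Type*} [MeasurableSpace Ω] (P : Measure Ω) (n : ℕ) (ξ : ℕ → Ω → ℝ)
    (X : Ω → ℝ) : ℕ → Ω → ℝ
  | 0 => fun _ => 1
  | k + 1 => discreteWick P n ξ (discreteWickPower P n ξ X k) X

end WickApprox

end

open WickApprox

noncomputable section

namespace WickApprox

/-! ### Step functions in the Skorokhod space -/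

/-! At time `j / n` the walk is a linear functional `∑ b_i ξ_i`, where `b_i` is the inner product of
the normalized indicator of the `i`-th cell with the kernel `z_H(j/n, ·)` in `L²((0,1])`. Its
discrete Wick power is therefore `k!` times the elementary symmetric function `e_k(b_i ξ_i)`
(`IsBernoulliArray.discreteWickPower_linear`), and the process of the theorem is a Walsh polynomial
whose second moments are computed by orthonormality. Of the kernel only the isometry `⟨z_H(s,·),
z_H(t,·)⟩ = E[B^H_s B^H_t]` matters (`lintegral_kernel_mul_kernel`); it comes from a Beta integral
and the choice of `c_H`.

Limit at finitely many times: Newton's identities make `e_k` a polynomial in the power sums of `b_i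
ξ_i`. The first power sum is the walk itself, which converges in law to `B^H` by a central limit
theorem (`tendstoInDistribution_walk`). The second is `∑ b_i²`, since `ξ_i² = 1`, and tends to
`t^{2H}`; the higher ones tend to `0` because the `b_i` are uniformly small. Newton's recursion at
`(x, v, 0, 0, …)` is the three-term recursion of the Hermite polynomials, so `e_k` tends to the Wick
power of `B^H_t` divided by `k!`.

From finitely many times to paths: by the isometry and Bessel's inequality the increments of the
full Wick polynomials have second moment at most a constant times `|t - s|^{2H}`. As `2H > 1`,
dyadic chaining with second moments alone bounds the oscillation between neighbouring points of a
grid of mesh `1/m`, with total error of order `m · m^{-2H}`; cutting the degree at `m` costs a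
geometrically small error. Thus the process is uniformly close in mean, for all `n ≥ m`, to a step
function of `m + 1` samples (`wickSample_approx`). These samples converge in law for fixed `m`, and
their limits converge uniformly along continuous paths of `B^H` as `m → ∞`;
`tendstoInDistribution_of_approx` combines the three limits. -/

theorem eventually_floor_mul_eq (m : ℕ) (t : ℝ) (ht : 0 ≤ t) :
    ∀ᶠ s in 𝓝[≥] t, ⌊(m : ℝ) * s⌋₊ = ⌊(m : ℝ) * t⌋₊ := by
  have hc : Tendsto (fun s : ℝ => (m : ℝ) * s) (𝓝[≥] t) (𝓝 ((m : ℝ) * t)) :=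
    ((continuous_const.mul continuous_id).tendsto t).mono_left nhdsWithin_le_nhds
  filter_upwards [hc.eventually_lt_const (Nat.lt_floor_add_one ((m : ℝ) * t)),
    self_mem_nhdsWithin] with s h1 h2
  have h2 : t ≤ s := h2
  have h3 : (m : ℝ) * t ≤ m * s := by gcongr
  have h0 : 0 ≤ (m : ℝ) * t := by positivity
  rw [Nat.floor_eq_iff (h0.trans h3)]
  exact ⟨(Nat.floor_le h0).trans h3, h1⟩

theorem eventually_floor_mul_left (m : ℕ) (t : ℝ) :
    ∃ k : ℕ, ∀ᶠ s in 𝓝[<] t, 0 ≤ s → ⌊(m : ℝ) * s⌋₊ = k := by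
  -- At a jump, where `m t` is an integer, the left limit of the floor is `m t - 1`, hence ceiling
  -- minus one. For `t ≤ 0` the condition `0 ≤ s` is contradictory, so the truncated subtraction is
  -- harmless.
  refine ⟨⌈(m : ℝ) * t⌉₊ - 1, ?_⟩
  rcases Nat.eq_zero_or_pos m with rfl | hm
  · simp
  have hc : Tendsto (fun s : ℝ => (m : ℝ) * s) (𝓝[<] t) (𝓝 ((m : ℝ) * t)) :=
    ((continuous_const.mul continuous_id).tendsto t).mono_left nhdsWithin_le_nhds
  have hm' : (0 : ℝ) < m := by exact_mod_cast hm
  rcases le_or_gt t 0 with h | h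
  · filter_upwards [self_mem_nhdsWithin] with s hs h0
    exact absurd (lt_of_lt_of_le hs h) (not_lt.2 h0)
  have hp : 0 < ⌈(m : ℝ) * t⌉₊ := Nat.ceil_pos.2 (by positivity)
  have hlt : ((⌈(m : ℝ) * t⌉₊ - 1 : ℕ) : ℝ) < m * t := Nat.lt_ceil.1 (by omega)
  filter_upwards [hc.eventually_const_lt hlt, self_mem_nhdsWithin] with s h1 h2 h0
  have h2 : s < t := h2
  rw [Nat.floor_eq_iff (by positivity)]
  refine ⟨h1.le, ?_⟩
  have : (((⌈(m : ℝ) * t⌉₊ - 1 : ℕ) : ℝ)) + 1 = ⌈(m : ℝ) * t⌉₊ := by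
    exact_mod_cast Nat.sub_add_cancel hp
  rw [this]
  calc (m : ℝ) * s < m * t := by gcongr
    _ ≤ _ := Nat.le_ceil _

theorem isCadlag_comp_floor (m : ℕ) (g : ℕ → ℝ) :
    IsCadlag fun t : unitInterval => g ⌊(m : ℝ) * (t : ℝ)⌋₊ := by
  intro t
  constructor
  · have h := eventually_floor_mul_eq m t t.2.1
    have hc : Tendsto (fun s : unitInterval => (s : ℝ)) (𝓝[≥] t) (𝓝[≥] (t : ℝ)) :=
      tendsto_nhdsWithin_iff.2 ⟨(continuous_subtype_val.tendsto t).mono_left nhdsWithin_le_nhds,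
        eventually_mem_nhdsWithin.mono fun s hs => hs⟩
    refine tendsto_const_nhds.congr' ?_
    filter_upwards [hc.eventually h] with s hs
    rw [hs]
  · obtain ⟨k, hk⟩ := eventually_floor_mul_left m t
    have hc : Tendsto (fun s : unitInterval => (s : ℝ)) (𝓝[<] t) (𝓝[<] (t : ℝ)) :=
      tendsto_nhdsWithin_iff.2 ⟨(continuous_subtype_val.tendsto t).mono_left nhdsWithin_le_nhds,
        eventually_mem_nhdsWithin.mono fun s hs => hs⟩
    refine ⟨g k, tendsto_const_nhds.congr' ?_⟩
    filter_upwards [hc.eventually hk] with s hs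
    rw [hs s.2.1]

theorem floor_mul_le (m : ℕ) (t : unitInterval) : ⌊(m : ℝ) * (t : ℝ)⌋₊ ≤ m := by
  rw [← Nat.cast_le (α := ℝ)]
  refine (Nat.floor_le (mul_nonneg m.cast_nonneg t.2.1)).trans ?_
  exact mul_le_of_le_one_right m.cast_nonneg t.2.2

theorem floor_mul_lt (m : ℕ) (t : unitInterval) : ⌊(m : ℝ) * (t : ℝ)⌋₊ < m + 1 :=
  Nat.lt_succ_of_le (floor_mul_le m t)

theorem isCadlag_of_continuous {x : unitInterval → ℝ} (hx : Continuous x) : IsCadlag x :=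
  fun t => ⟨hx.continuousWithinAt, x t, (hx.tendsto t).mono_left nhdsWithin_le_nhds⟩

namespace SkorokhodSpace

/-- The step function with value `v j` on `[j / m, (j + 1) / m)`. -/
def step (m : ℕ) (v : Fin (m + 1) → ℝ) : SkorokhodSpace where
  toFun t := v ⟨⌊(m : ℝ) * (t : ℝ)⌋₊, floor_mul_lt m t⟩
  isCadlag := by
    have h := isCadlag_comp_floor m fun j => if h : j < m + 1 then v ⟨j, h⟩ else 0
    convert h using 2 with t
    simp [floor_mul_lt m t]

theorem step_apply (m : ℕ) (v : Fin (m + 1) → ℝ) (t : unitInterval) :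
    step m v t = v ⟨⌊(m : ℝ) * (t : ℝ)⌋₊, floor_mul_lt m t⟩ := rfl

/-- The identity is an admissible time change. All closeness estimates below are uniform in `t`, so
no other time change is needed. -/
theorem edist_le_of_forall_edist_le {x y : SkorokhodSpace} {c : ℝ≥0∞}
    (h : ∀ t, edist (x t) (y t) ≤ c) : edist x y ≤ c := by
  refine (iInf_le _ (OrderIso.refl _)).trans ?_
  simpa [cost] using h

theorem edist_le_ofReal {x y : SkorokhodSpace} {c : ℝ} (h : ∀ t, |x t - y t| ≤ c) :
    edist x y ≤ ENNReal.ofReal c :=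
  edist_le_of_forall_edist_le fun t => by
    rw [edist_dist, Real.dist_eq]
    exact ENNReal.ofReal_le_ofReal (h t)

theorem lipschitzWith_step (m : ℕ) : LipschitzWith 1 (step m) := fun v w => by
  rw [ENNReal.coe_one, one_mul]
  exact edist_le_of_forall_edist_le fun t => edist_le_pi_edist v w _

/-- Reduces measurability and convergence in law of step processes to vectors in `ℝ^(m+1)`. -/
theorem continuous_step (m : ℕ) : Continuous (step m) := (lipschitzWith_step m).continuous

end SkorokhodSpace

/-! ### Approximation of sequences converging in distribution -/

theorem abs_integral_sub_le_of_edist_le {Ω D : Type*} [MeasurableSpace Ω] (P : Measure Ω)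
    [IsProbabilityMeasure P] [PseudoEMetricSpace D] [MeasurableSpace D] [OpensMeasurableSpace D]
    {Y Z : Ω → D} (hY : AEMeasurable Y P) (hZ : AEMeasurable Z P) {f : D → ℝ} {M : ℝ}
    (hM : ∀ x y, dist (f x) (f y) ≤ M) {L : NNReal} (hL : LipschitzWith L f) {g : Ω → ℝ}
    (hg : Integrable g P) (hg0 : ∀ ω, 0 ≤ g ω)
    (h : ∀ ω, edist (Y ω) (Z ω) ≤ ENNReal.ofReal (g ω)) :
    |∫ x, f x ∂(P.map Y) - ∫ x, f x ∂(P.map Z)| ≤ L * ∫ ω, g ω ∂P := by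
  have hfm : Measurable f := hL.continuous.measurable
  have : Nonempty Ω := P.nonempty_of_neZero
  have key : ∀ {W : Ω → D}, AEMeasurable W P → Integrable (fun ω => f (W ω)) P := by
    intro W hW
    refine Integrable.of_bound (hfm.comp_aemeasurable hW).aestronglyMeasurable
      (‖f (Y (Classical.arbitrary Ω))‖ + M)
      (ae_of_all _ fun ω => ?_)
    have := hM (W ω) (Y (Classical.arbitrary Ω))
    rw [dist_eq_norm] at this
    linarith [norm_sub_norm_le (f (W ω)) (f (Y (Classical.arbitrary Ω)))]
  rw [integral_map hY hfm.aestronglyMeasurable, integral_map hZ hfm.aestronglyMeasurable,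
    ← integral_sub (key hY) (key hZ), ← integral_const_mul]
  refine (abs_integral_le_integral_abs).trans ?_
  refine integral_mono ((key hY).sub (key hZ)).abs (hg.const_mul _) fun ω => ?_
  have h1 := (hL (Y ω) (Z ω)).trans (mul_le_mul_right (h ω) _)
  rw [edist_dist, Real.dist_eq, ← ENNReal.ofReal_coe_nnreal,
    ← ENNReal.ofReal_mul L.coe_nonneg, ENNReal.ofReal_le_ofReal_iff
      (mul_nonneg L.coe_nonneg (hg0 ω))] at h1
  exact h1

/-- If `Z m n → Z' m` in distribution as `n → ∞` for every `m`, `Z' m → X` almost surely, and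
`Y n` is close to `Z m n` in mean, then `Y n → X` in distribution. -/
theorem tendstoInDistribution_of_approx {Ω Ω' D : Type*} [MeasurableSpace Ω] [MeasurableSpace Ω']
    (P : Measure Ω) [IsProbabilityMeasure P] (P' : Measure Ω') [IsProbabilityMeasure P']
    [PseudoEMetricSpace D] [MeasurableSpace D] [BorelSpace D]
    {Y : ℕ → Ω → D} {Z : ℕ → ℕ → Ω → D} {Z' : ℕ → Ω' → D} {X : Ω' → D}
    (hY : ∀ n, AEMeasurable (Y n) P)
    (hZ : ∀ m, TendstoInDistribution (Z m) atTop (Z' m) (fun _ => P) P')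
    (hX : ∀ᵐ ω ∂P', Tendsto (fun m => Z' m ω) atTop (𝓝 (X ω)))
    (happ : ∀ δ : ℝ, 0 < δ → ∀ᶠ m in atTop, ∀ᶠ n in atTop, ∃ g : Ω → ℝ, Integrable g P ∧
      (∀ ω, 0 ≤ g ω) ∧ (∀ ω, edist (Y n ω) (Z m n ω) ≤ ENNReal.ofReal (g ω)) ∧
      ∫ ω, g ω ∂P ≤ δ) :
    TendstoInDistribution Y atTop X (fun _ => P) P' := by
  -- Measurability of the limit is not assumed: it is inherited from the almost sure convergence.
  have hXm : AEMeasurable X P' :=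
    aemeasurable_of_tendsto_metrizable_ae atTop (fun m => (hZ m).aemeasurable_limit) hX
  have hZX : TendstoInDistribution Z' atTop X (fun _ => P') P' :=
    tendstoInDistribution_of_ae_tendsto (fun m => (hZ m).aemeasurable_limit) hXm hX
  refine ⟨hY, hXm, tendsto_iff_forall_lipschitz_integral_tendsto.2 ?_⟩
  rintro f ⟨M, hM⟩ ⟨L, hL⟩
  rw [Metric.tendsto_nhds]
  intro ε hε
  have hZX' := (tendsto_iff_forall_lipschitz_integral_tendsto.1 hZX.tendsto) f ⟨M, hM⟩ ⟨L, hL⟩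
  rw [Metric.tendsto_nhds] at hZX'
  -- `L + 1` replaces `L`, which may be zero.
  have hδ : 0 < ε / (3 * (L + 1)) := by positivity
  obtain ⟨m, h1, h2⟩ := ((happ _ hδ).and (hZX' (ε / 3) (by positivity))).exists
  have hZm := (tendsto_iff_forall_lipschitz_integral_tendsto.1 (hZ m).tendsto) f ⟨M, hM⟩ ⟨L, hL⟩
  rw [Metric.tendsto_nhds] at hZm
  filter_upwards [h1, hZm (ε / 3) (by positivity)] with n ⟨g, hg, hg0, hgd, hgi⟩ h3
  have h4 := abs_integral_sub_le_of_edist_le P (hY n)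
    ((hZ m).forall_aemeasurable n) hM hL hg hg0 hgd
  have h5 : L * ∫ ω, g ω ∂P < ε / 3 := by
    calc L * ∫ ω, g ω ∂P ≤ L * (ε / (3 * (L + 1))) := by gcongr
      _ < (L + 1) * (ε / (3 * (L + 1))) := by gcongr; linarith
      _ = ε / 3 := by field_simp
  simp only [Real.dist_eq, ProbabilityMeasure.coe_mk] at h2 h3 h4 ⊢
  rw [abs_lt] at h2 h3 ⊢
  rw [abs_le] at h4
  constructor <;> linarith [h4.1, h4.2, h2.1, h2.2, h3.1, h3.2]

/-! ### Walsh functions of a Rademacher row -/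

section Walsh

set_option linter.unusedSectionVars false

variable {Ω : Type*} [MeasurableSpace Ω] {P : Measure Ω} [IsProbabilityMeasure P]
  {ξ : ℕ → ℕ → Ω → ℝ}

theorem IsBernoulliArray.integral_comp (hξ : IsBernoulliArray ξ P) {𝕜 : Type*} [RCLike 𝕜]
    (n : ℕ) {i : ℕ} (hi : i ∈ Finset.Icc 1 n) (g : ℝ → 𝕜) :
    ∫ ω, g (ξ n i ω) ∂P = (g 1 + g (-1)) / 2 := by
  have hm := hξ.measurable n i hi
  have h1 : MeasurableSet {ω | ξ n i ω = 1} := hm (measurableSet_singleton 1)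
  have h2 : MeasurableSet {ω | ξ n i ω = -1} := hm (measurableSet_singleton (-1))
  have hc : {ω | ξ n i ω = 1}ᶜ = {ω | ξ n i ω = -1} := by
    ext ω
    rcases hξ.values n i hi ω with h | h <;> simp [h] <;> norm_num
  have hs : P.real {ω | ξ n i ω = 1} = P.real {ω | ξ n i ω = -1} := by
    simp [Measure.real, hξ.symmetric n i hi]
  have ht : P.real {ω | ξ n i ω = 1} + P.real {ω | ξ n i ω = -1} = 1 := by
    rw [← hc, probReal_add_probReal_compl h1]
  have hh : P.real {ω | ξ n i ω = 1} = 1 / 2 := by linarith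
  have hh' : P.real {ω | ξ n i ω = -1} = 1 / 2 := by linarith
  have he : (fun ω => g (ξ n i ω)) = fun ω =>
      {ω | ξ n i ω = 1}.indicator (fun _ => g 1) ω +
        {ω | ξ n i ω = -1}.indicator (fun _ => g (-1)) ω := by
    funext ω
    rcases hξ.values n i hi ω with h | h
    · have : ξ n i ω ≠ -1 := by rw [h]; norm_num
      simp [Set.indicator, h]
      norm_num
    · have : ξ n i ω ≠ 1 := by rw [h]; norm_num
      simp [Set.indicator, h]
      norm_num
  rw [he, integral_add ((integrable_const _).indicator h1) ((integrable_const _).indicator h2),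
    integral_indicator_const _ h1, integral_indicator_const _ h2, hh, hh',
    RCLike.real_smul_eq_coe_mul, RCLike.real_smul_eq_coe_mul]
  push_cast
  ring

/-- The real case gives orthonormality of the Walsh functions, the complex case the characteristic
function of a linear combination. -/
theorem IsBernoulliArray.integral_prod (hξ : IsBernoulliArray ξ P) {𝕜 : Type*} [RCLike 𝕜]
    (n : ℕ) (g : ℕ → ℝ → 𝕜) (hg : ∀ i, Measurable (g i)) :
    ∫ ω, ∏ i ∈ Finset.Icc 1 n, g i (ξ n i ω) ∂P
      = ∏ i ∈ Finset.Icc 1 n, (g i 1 + g i (-1)) / 2 := by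
  have h := (hξ.independent n).integral_fun_prod_comp
    (f := fun (i : Finset.Icc 1 n) => g i)
    (fun i => (hξ.measurable n i i.2).aemeasurable)
    (fun i => (hg i).aestronglyMeasurable)
  have e : ∀ ω, ∏ i ∈ Finset.Icc 1 n, g i (ξ n i ω)
      = ∏ i : Finset.Icc 1 n, g i (ξ n i ω) := fun ω =>
    (Finset.prod_coe_sort (Finset.Icc 1 n) fun i => g i (ξ n i ω)).symm
  simp only [e, h]
  rw [← Finset.prod_coe_sort (Finset.Icc 1 n) fun i => (g i 1 + g i (-1)) / 2]
  exact Finset.prod_congr rfl fun i _ => hξ.integral_comp n i.2 (g i)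

theorem IsBernoulliArray.sq_eq_one (hξ : IsBernoulliArray ξ P) (n : ℕ) {i : ℕ}
    (hi : i ∈ Finset.Icc 1 n) (ω : Ω) : ξ n i ω ^ 2 = 1 := by
  rcases hξ.values n i hi ω with h | h <;> simp [h]

theorem IsBernoulliArray.measurable_walsh (hξ : IsBernoulliArray ξ P) (n : ℕ) {A : Finset ℕ}
    (hA : A ⊆ Finset.Icc 1 n) : Measurable (walsh (ξ n) A) := by
  unfold walsh
  exact Finset.measurable_prod _ fun i hi => hξ.measurable n i (hA hi)

theorem IsBernoulliArray.abs_walsh (hξ : IsBernoulliArray ξ P) (n : ℕ) {A : Finset ℕ}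
    (hA : A ⊆ Finset.Icc 1 n) (ω : Ω) : |walsh (ξ n) A ω| = 1 := by
  rw [walsh, Finset.abs_prod]
  exact Finset.prod_eq_one fun i hi => by
    rcases hξ.values n i (hA hi) ω with h | h <;> simp [h]

theorem IsBernoulliArray.integrable_walsh_mul (hξ : IsBernoulliArray ξ P) (n : ℕ)
    {A B : Finset ℕ} (hA : A ⊆ Finset.Icc 1 n) (hB : B ⊆ Finset.Icc 1 n) :
    Integrable (fun ω => walsh (ξ n) A ω * walsh (ξ n) B ω) P := by
  refine Integrable.of_bound (((hξ.measurable_walsh n hA).mul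
    (hξ.measurable_walsh n hB)).aestronglyMeasurable) 1 (ae_of_all _ fun ω => ?_)
  rw [norm_mul, Real.norm_eq_abs, Real.norm_eq_abs, hξ.abs_walsh n hA, hξ.abs_walsh n hB, one_mul]

theorem IsBernoulliArray.integral_walsh_mul (hξ : IsBernoulliArray ξ P) (n : ℕ)
    {A B : Finset ℕ} (hA : A ⊆ Finset.Icc 1 n) (hB : B ⊆ Finset.Icc 1 n) :
    ∫ ω, walsh (ξ n) A ω * walsh (ξ n) B ω ∂P = if A = B then 1 else 0 := by
  have key : ∀ {A : Finset ℕ}, A ⊆ Finset.Icc 1 n → ∀ ω, walsh (ξ n) A ω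
      = ∏ i ∈ Finset.Icc 1 n, if i ∈ A then ξ n i ω else 1 := by
    intro A hA ω
    rw [Finset.prod_ite_mem, Finset.inter_eq_right.2 hA, walsh]
  simp only [key hA, key hB, ← Finset.prod_mul_distrib]
  rw [hξ.integral_prod n (fun i x => (if i ∈ A then x else 1) * if i ∈ B then x else 1)
    (fun i => by split_ifs <;> fun_prop)]
  split_ifs with h
  · subst h
    refine Finset.prod_eq_one fun i _ => ?_
    split_ifs <;> norm_num
  · obtain ⟨i, hi⟩ : ∃ i, ¬ (i ∈ A ↔ i ∈ B) := by
      by_contra hc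
      push Not at hc
      exact h (Finset.ext hc)
    have hiI : i ∈ Finset.Icc 1 n := by
      by_cases hiA : i ∈ A
      · exact hA hiA
      · exact hB (by tauto)
    refine Finset.prod_eq_zero hiI ?_
    by_cases h1 : i ∈ A <;> by_cases h2 : i ∈ B <;> simp_all

/-- Orthonormality reads off coefficients; this turns the discrete Wick product, defined through
expectations, into algebra on coefficients. -/
theorem IsBernoulliArray.walshCoeff_sum (hξ : IsBernoulliArray ξ P) (n : ℕ)
    {S : Finset (Finset ℕ)} (hS : S ⊆ (Finset.Icc 1 n).powerset) (c : Finset ℕ → ℝ)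
    {B : Finset ℕ} (hB : B ⊆ Finset.Icc 1 n) :
    walshCoeff P (ξ n) (fun ω => ∑ A ∈ S, c A * walsh (ξ n) A ω) B
      = if B ∈ S then c B else 0 := by
  have hS' : ∀ A ∈ S, A ⊆ Finset.Icc 1 n := fun A hA => Finset.mem_powerset.1 (hS hA)
  simp only [walshCoeff, Finset.sum_mul, mul_assoc]
  rw [integral_finsetSum _ fun A hA => (hξ.integrable_walsh_mul n (hS' A hA) hB).const_mul _]
  rw [Finset.sum_congr rfl fun A hA => by
    rw [integral_const_mul, hξ.integral_walsh_mul n (hS' A hA) hB]]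
  simp

theorem IsBernoulliArray.integrable_sum_sq (hξ : IsBernoulliArray ξ P) (n : ℕ)
    {S : Finset (Finset ℕ)} (hS : S ⊆ (Finset.Icc 1 n).powerset) (c : Finset ℕ → ℝ) :
    Integrable (fun ω => (∑ A ∈ S, c A * walsh (ξ n) A ω) ^ 2) P := by
  have hS' : ∀ A ∈ S, A ⊆ Finset.Icc 1 n := fun A hA => Finset.mem_powerset.1 (hS hA)
  simp only [sq, Finset.sum_mul_sum]
  refine integrable_finsetSum _ fun A hA => integrable_finsetSum _ fun B hB => ?_
  refine ((hξ.integrable_walsh_mul n (hS' A hA) (hS' B hB)).const_mul (c A * c B)).congr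
    (ae_of_all _ fun ω => ?_)
  dsimp only
  ring

/-- Parseval's identity, through which every second moment below becomes a sum over subsets. -/
theorem IsBernoulliArray.integral_sum_sq (hξ : IsBernoulliArray ξ P) (n : ℕ)
    {S : Finset (Finset ℕ)} (hS : S ⊆ (Finset.Icc 1 n).powerset) (c : Finset ℕ → ℝ) :
    ∫ ω, (∑ A ∈ S, c A * walsh (ξ n) A ω) ^ 2 ∂P = ∑ A ∈ S, c A ^ 2 := by
  have hS' : ∀ A ∈ S, A ⊆ Finset.Icc 1 n := fun A hA => Finset.mem_powerset.1 (hS hA)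
  have e : ∀ ω, (∑ A ∈ S, c A * walsh (ξ n) A ω) ^ 2
      = ∑ A ∈ S, ∑ B ∈ S, c A * c B * (walsh (ξ n) A ω * walsh (ξ n) B ω) := by
    intro ω
    rw [sq, Finset.sum_mul_sum]
    exact Finset.sum_congr rfl fun A _ => Finset.sum_congr rfl fun B _ => by ring
  simp only [e]
  have hi : ∀ A ∈ S, ∀ B ∈ S,
      Integrable (fun ω => c A * c B * (walsh (ξ n) A ω * walsh (ξ n) B ω)) P := fun A hA B hB =>
    (hξ.integrable_walsh_mul n (hS' A hA) (hS' B hB)).const_mul _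
  rw [integral_finsetSum _ fun A hA => integrable_finsetSum _ (hi A hA)]
  refine Finset.sum_congr rfl fun A hA => ?_
  rw [integral_finsetSum _ (hi A hA), Finset.sum_congr rfl fun B hB => by
    rw [integral_const_mul, hξ.integral_walsh_mul n (hS' A hA) (hS' B hB)]]
  simp [hA, sq]

/-! ### Discrete Wick powers of linear functionals -/

/-- Double counting of pairs: a `(k+1)`-set `D` arises as `insert i A` once for each of its `k + 1`
elements `i`. -/
theorem sum_powersetCard_sum_insert {I : Finset ℕ} (k : ℕ) (G : Finset ℕ → ℝ) :
    ∑ A ∈ I.powersetCard k, ∑ i ∈ I \ A, G (insert i A)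
      = (k + 1) * ∑ D ∈ I.powersetCard (k + 1), G D := by
  have h : ∑ D ∈ I.powersetCard (k + 1), ∑ _i ∈ D, G D
      = (k + 1) * ∑ D ∈ I.powersetCard (k + 1), G D := by
    rw [Finset.mul_sum]
    refine Finset.sum_congr rfl fun D hD => ?_
    rw [Finset.sum_const, (Finset.mem_powersetCard.1 hD).2]
    simp
  rw [← h, Finset.sum_sigma', Finset.sum_sigma']
  refine Finset.sum_bij' (fun x _ => ⟨insert x.2 x.1, x.2⟩) (fun x _ => ⟨x.1.erase x.2, x.2⟩)
    ?_ ?_ ?_ ?_ ?_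
  · rintro ⟨A, i⟩ hx
    simp only [Finset.mem_sigma, Finset.mem_powersetCard, Finset.mem_sdiff] at hx ⊢
    obtain ⟨⟨h1, h2⟩, h3, h4⟩ := hx
    exact ⟨⟨Finset.insert_subset h3 h1, by rw [Finset.card_insert_of_notMem h4, h2]⟩,
      Finset.mem_insert_self _ _⟩
  · rintro ⟨D, i⟩ hx
    simp only [Finset.mem_sigma, Finset.mem_powersetCard, Finset.mem_sdiff] at hx ⊢
    obtain ⟨⟨h1, h2⟩, h3⟩ := hx
    exact ⟨⟨(Finset.erase_subset _ _).trans h1, by rw [Finset.card_erase_of_mem h3, h2]; simp⟩,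
      h1 h3, Finset.notMem_erase _ _⟩
  · rintro ⟨A, i⟩ hx
    simp only [Finset.mem_sigma, Finset.mem_sdiff] at hx
    simp [Finset.erase_insert hx.2.2]
  · rintro ⟨D, i⟩ hx
    simp only [Finset.mem_sigma] at hx
    simp [Finset.insert_erase hx.2]
  · rintro ⟨A, i⟩ _
    rfl

/-- The `k`-th elementary symmetric function of the variables `b i * ξ i`, `i ∈ {1, …, n}`. -/
def esymmWalsh (ξ : ℕ → Ω → ℝ) (n : ℕ) (b : ℕ → ℝ) (k : ℕ) (ω : Ω) : ℝ :=
  ∑ A ∈ (Finset.Icc 1 n).powersetCard k, (∏ i ∈ A, b i) * walsh ξ A ω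

theorem esymmWalsh_one (ξ : ℕ → Ω → ℝ) (n : ℕ) (b : ℕ → ℝ) (ω : Ω) :
    esymmWalsh ξ n b 1 ω = ∑ i ∈ Finset.Icc 1 n, b i * ξ i ω := by
  simp [esymmWalsh, Finset.powersetCard_one, walsh]

theorem powersetCard_subset_powerset (I : Finset ℕ) (k : ℕ) : I.powersetCard k ⊆ I.powerset :=
  fun _ hA => Finset.mem_powerset.2 (Finset.mem_powersetCard.1 hA).1

theorem sum_ite_card_eq (I : Finset ℕ) (k : ℕ) (F : Finset ℕ → ℝ) :
    ∑ A ∈ I.powerset, (if A ∈ I.powersetCard k then F A else 0)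
      = ∑ A ∈ I.powersetCard k, F A := by
  rw [← Finset.sum_filter]
  congr 1
  ext A
  simp [Finset.mem_powersetCard]

/-- In a product with a linear functional only the terms `B = {i}` with `i ∉ A` survive, and each
`(k+1)`-set is reached `k + 1` times. These factors accumulate to `k!`; the scalar `r` carries the
factorial already collected. -/
theorem IsBernoulliArray.discreteWick_esymmWalsh (hξ : IsBernoulliArray ξ P) (n : ℕ)
    (b : ℕ → ℝ) (r : ℝ) (k : ℕ) (ω : Ω) :
    discreteWick P n (ξ n) (fun ω => r * esymmWalsh (ξ n) n b k ω) (esymmWalsh (ξ n) n b 1) ω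
      = r * (k + 1) * esymmWalsh (ξ n) n b (k + 1) ω := by
  set I := Finset.Icc 1 n with hI
  have h1 : ∀ A ∈ I.powerset, walshCoeff P (ξ n) (fun ω => r * esymmWalsh (ξ n) n b k ω) A
      = if A ∈ I.powersetCard k then r * ∏ i ∈ A, b i else 0 := by
    intro A hA
    rw [← hξ.walshCoeff_sum n (powersetCard_subset_powerset I k) (fun A => r * ∏ i ∈ A, b i)
      (Finset.mem_powerset.1 hA)]
    congr 1
    funext ω
    rw [esymmWalsh, Finset.mul_sum]
    exact Finset.sum_congr rfl fun A _ => by ring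
  have h2 : ∀ A ∈ I.powerset, walshCoeff P (ξ n) (esymmWalsh (ξ n) n b 1) A
      = if A ∈ I.powersetCard 1 then ∏ i ∈ A, b i else 0 := by
    intro A hA
    exact hξ.walshCoeff_sum n (powersetCard_subset_powerset I 1) (fun A => ∏ i ∈ A, b i)
      (Finset.mem_powerset.1 hA)
  have step : discreteWick P n (ξ n) (fun ω => r * esymmWalsh (ξ n) n b k ω)
      (esymmWalsh (ξ n) n b 1) ω = ∑ A ∈ I.powersetCard k, ∑ i ∈ I \ A,
        r * ((∏ j ∈ insert i A, b j) * walsh (ξ n) (insert i A) ω) := by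
    rw [discreteWick, ← sum_ite_card_eq I k]
    refine Finset.sum_congr rfl fun A hA => ?_
    rw [Finset.sum_congr rfl fun B hB => by rw [h1 A hA, h2 B hB]]
    split_ifs with hAk
    · have e : ∀ B ∈ I.powerset, (if Disjoint A B then
          (r * ∏ i ∈ A, b i) * (if B ∈ I.powersetCard 1 then ∏ i ∈ B, b i else 0)
            * walsh (ξ n) (A ∪ B) ω else 0)
          = if B ∈ I.powersetCard 1 then (if Disjoint A B then
          (r * ∏ i ∈ A, b i) * (∏ i ∈ B, b i) * walsh (ξ n) (A ∪ B) ω else 0) else 0 := by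
        intro B _
        split_ifs <;> simp
      rw [Finset.sum_congr rfl e, sum_ite_card_eq I 1, Finset.powersetCard_one, Finset.sum_map,
        Finset.sdiff_eq_filter, Finset.sum_filter]
      refine Finset.sum_congr rfl fun i _ => ?_
      simp only [Function.Embedding.coeFn_mk, Finset.disjoint_singleton_right,
        Finset.prod_singleton]
      by_cases hiA : i ∈ A
      · simp [hiA]
      · rw [if_pos hiA, if_pos hiA, Finset.prod_insert hiA, Finset.union_comm, ← Finset.insert_eq]
        ring
    · simp
  rw [step, sum_powersetCard_sum_insert k
    (fun D => r * ((∏ j ∈ D, b j) * walsh (ξ n) D ω)), ← Finset.mul_sum, esymmWalsh]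
  ring

theorem IsBernoulliArray.discreteWickPower_linear (hξ : IsBernoulliArray ξ P) (n : ℕ)
    (b : ℕ → ℝ) (k : ℕ) :
    discreteWickPower P n (ξ n) (fun ω => ∑ i ∈ Finset.Icc 1 n, b i * ξ n i ω) k
      = fun ω => (k ! : ℝ) * esymmWalsh (ξ n) n b k ω := by
  have hX : (fun ω => ∑ i ∈ Finset.Icc 1 n, b i * ξ n i ω) = esymmWalsh (ξ n) n b 1 :=
    funext fun ω => (esymmWalsh_one _ _ _ _).symm
  induction k with
  | zero => funext ω; simp [discreteWickPower, esymmWalsh, walsh]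
  | succ k ih =>
    funext ω
    rw [discreteWickPower, ih, hX, hξ.discreteWick_esymmWalsh, Nat.factorial_succ]
    push_cast
    ring

end Walsh

/-! ### Bounds on multilinear sums -/

theorem prod_one_add_le_exp {I : Finset ℕ} {f : ℕ → ℝ} (hf : ∀ i, 0 ≤ f i) :
    ∏ i ∈ I, (1 + f i) ≤ Real.exp (∑ i ∈ I, f i) := by
  rw [Real.exp_sum]
  exact Finset.prod_le_prod (fun i _ => by linarith [hf i]) fun i _ => by
    rw [add_comm]; exact Real.add_one_le_exp _

theorem one_le_prod_one_add {I : Finset ℕ} {f : ℕ → ℝ} (hf : ∀ i, 0 ≤ f i) :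
    1 ≤ ∏ i ∈ I, (1 + f i) := by
  calc (1 : ℝ) = ∏ _i ∈ I, 1 := Finset.prod_const_one.symm
    _ ≤ _ := Finset.prod_le_prod (fun _ _ => zero_le_one) fun i _ => by linarith [hf i]

theorem sum_powerset_pow_card_mul_prod (I : Finset ℕ) (w : ℝ) (f : ℕ → ℝ) :
    ∑ A ∈ I.powerset, w ^ A.card * ∏ i ∈ A, f i = ∏ i ∈ I, (1 + w * f i) := by
  rw [Finset.prod_one_add]
  exact Finset.sum_congr rfl fun A _ => by rw [Finset.prod_mul_distrib, Finset.prod_const]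

/-- Induction on `I`: for sets containing the new index `a`, write `x_a u - y_a v = x_a (u - v) +
(x_a - y_a) v` and use `(p + q)² ≤ 2p² + 2q²`. The lost factor 2 goes into the product over `x`, so
the bound stays linear in `∑ (x_i - y_i)²`. -/
theorem sum_powerset_sq_prod_sub_le (I : Finset ℕ) {w : ℝ} (hw : 0 ≤ w) (x y : ℕ → ℝ) :
    ∑ A ∈ I.powerset, w ^ A.card * (∏ i ∈ A, x i - ∏ i ∈ A, y i) ^ 2
      ≤ (∏ i ∈ I, (1 + 2 * w * x i ^ 2)) * (∏ i ∈ I, (1 + w * y i ^ 2)) *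
        (2 * w * ∑ i ∈ I, (x i - y i) ^ 2) := by
  induction I using Finset.induction_on with
  | empty => simp
  | insert a I ha ih =>
    rw [Finset.sum_powerset_insert ha, Finset.prod_insert ha, Finset.prod_insert ha,
      Finset.sum_insert ha]
    set X := ∏ i ∈ I, (1 + 2 * w * x i ^ 2) with hX
    set Y := ∏ i ∈ I, (1 + w * y i ^ 2) with hY
    set D := ∑ i ∈ I, (x i - y i) ^ 2 with hD
    set S := ∑ A ∈ I.powerset, w ^ A.card * (∏ i ∈ A, x i - ∏ i ∈ A, y i) ^ 2 with hS
    have hX1 : 1 ≤ X := one_le_prod_one_add fun i => by positivity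
    have hY1 : 1 ≤ Y := one_le_prod_one_add fun i => by positivity
    have hD0 : 0 ≤ D := Finset.sum_nonneg fun i _ => sq_nonneg _
    have h2 : ∑ A ∈ I.powerset, w ^ (insert a A).card *
        (∏ i ∈ insert a A, x i - ∏ i ∈ insert a A, y i) ^ 2
        ≤ 2 * w * x a ^ 2 * S + 2 * w * (x a - y a) ^ 2 * Y := by
      rw [hS, hY, ← sum_powerset_pow_card_mul_prod, Finset.mul_sum, Finset.mul_sum,
        ← Finset.sum_add_distrib]
      refine Finset.sum_le_sum fun A hA => ?_
      have haA : a ∉ A := fun h => ha (Finset.mem_powerset.1 hA h)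
      rw [Finset.card_insert_of_notMem haA, Finset.prod_insert haA, Finset.prod_insert haA,
        Finset.prod_pow]
      set u := ∏ i ∈ A, x i
      set v := ∏ i ∈ A, y i
      have h3 : (x a * u - y a * v) ^ 2 ≤ 2 * x a ^ 2 * (u - v) ^ 2 + 2 * (x a - y a) ^ 2 * v ^ 2 := by
        nlinarith [sq_nonneg (x a * (u - v) - (x a - y a) * v)]
      calc w ^ (A.card + 1) * (x a * u - y a * v) ^ 2
          ≤ w ^ (A.card + 1) * (2 * x a ^ 2 * (u - v) ^ 2 + 2 * (x a - y a) ^ 2 * v ^ 2) := by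
            gcongr
        _ = _ := by ring
    have hp : 0 ≤ 2 * w * x a ^ 2 := by positivity
    have hq : 0 ≤ w * y a ^ 2 := by positivity
    have hr : 0 ≤ 2 * w * (x a - y a) ^ 2 := by positivity
    have hXY : 0 ≤ X * Y := by positivity
    calc _ ≤ S + (2 * w * x a ^ 2 * S + 2 * w * (x a - y a) ^ 2 * Y) := by gcongr
      _ = (1 + 2 * w * x a ^ 2) * S + 2 * w * (x a - y a) ^ 2 * Y := by ring
      _ ≤ (1 + 2 * w * x a ^ 2) * (X * Y * (2 * w * D))
          + 2 * w * (x a - y a) ^ 2 * ((1 + 2 * w * x a ^ 2) * X * Y) := by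
        gcongr
        have : 1 ≤ (1 + 2 * w * x a ^ 2) * X := one_le_mul_of_one_le_of_one_le (by linarith) hX1
        nlinarith
      _ = (1 + 2 * w * x a ^ 2) * X * Y * (2 * w * ((x a - y a) ^ 2 + D)) := by ring
      _ ≤ (1 + 2 * w * x a ^ 2) * X * (((1 + w * y a ^ 2)) * Y)
          * (2 * w * ((x a - y a) ^ 2 + D)) := by
        gcongr
        nlinarith

theorem sum_powerset_sq_prod_sub_le_exp (I : Finset ℕ) {w M : ℝ} (hw : 0 ≤ w) {x y : ℕ → ℝ}
    (hx : ∑ i ∈ I, x i ^ 2 ≤ M) (hy : ∑ i ∈ I, y i ^ 2 ≤ M) :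
    ∑ A ∈ I.powerset, w ^ A.card * (∏ i ∈ A, x i - ∏ i ∈ A, y i) ^ 2
      ≤ Real.exp (3 * w * M) * (2 * w) * ∑ i ∈ I, (x i - y i) ^ 2 := by
  refine (sum_powerset_sq_prod_sub_le I hw x y).trans ?_
  have h1 : ∏ i ∈ I, (1 + 2 * w * x i ^ 2) ≤ Real.exp (2 * w * M) := by
    refine (prod_one_add_le_exp fun i => by positivity).trans (Real.exp_le_exp.2 ?_)
    rw [← Finset.mul_sum]
    gcongr
  have h2 : ∏ i ∈ I, (1 + w * y i ^ 2) ≤ Real.exp (w * M) := by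
    refine (prod_one_add_le_exp fun i => by positivity).trans (Real.exp_le_exp.2 ?_)
    rw [← Finset.mul_sum]
    gcongr
  have h3 : Real.exp (3 * w * M) = Real.exp (2 * w * M) * Real.exp (w * M) := by
    rw [← Real.exp_add]; ring_nf
  have h0 : 0 ≤ ∑ i ∈ I, (x i - y i) ^ 2 := Finset.sum_nonneg fun i _ => sq_nonneg _
  have h4 : 0 ≤ ∏ i ∈ I, (1 + w * y i ^ 2) := Finset.prod_nonneg fun i _ => by positivity
  rw [h3, mul_assoc _ (2 * w)]
  gcongr

/-- Exponential weighting: when `|A| > N` one has `1 ≤ 4^{|A|} / 4^N`, after which the restriction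
on `|A|` can be dropped and the full sum factorizes. -/
theorem sum_powerset_card_gt_le (I : Finset ℕ) {w M : ℝ} (hw : 0 ≤ w) {x : ℕ → ℝ}
    (hx : ∑ i ∈ I, x i ^ 2 ≤ M) (N : ℕ) :
    ∑ A ∈ I.powerset with N < A.card, w ^ A.card * (∏ i ∈ A, x i) ^ 2
      ≤ (1 / 4) ^ N * Real.exp (4 * w * M) := by
  calc ∑ A ∈ I.powerset with N < A.card, w ^ A.card * (∏ i ∈ A, x i) ^ 2
      ≤ ∑ A ∈ I.powerset with N < A.card,
          (1 / 4) ^ N * ((4 * w) ^ A.card * ∏ i ∈ A, x i ^ 2) := by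
        refine Finset.sum_le_sum fun A hA => ?_
        rw [Finset.mem_filter] at hA
        rw [Finset.prod_pow, mul_pow, ← mul_assoc, ← mul_assoc]
        gcongr
        have h1 : (1 : ℝ) ≤ (1 / 4) ^ N * 4 ^ A.card := by
          calc (1 : ℝ) = (1 / 4) ^ N * 4 ^ N := by rw [← mul_pow]; norm_num
            _ ≤ _ := by gcongr; norm_num; exact hA.2.le
        exact le_mul_of_one_le_left (by positivity) h1
    _ ≤ ∑ A ∈ I.powerset, (1 / 4) ^ N * ((4 * w) ^ A.card * ∏ i ∈ A, x i ^ 2) :=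
        Finset.sum_le_sum_of_subset_of_nonneg (Finset.filter_subset _ _) fun A _ _ => by
          have : 0 ≤ ∏ i ∈ A, x i ^ 2 := Finset.prod_nonneg fun i _ => sq_nonneg _
          positivity
    _ = (1 / 4) ^ N * ∏ i ∈ I, (1 + 4 * w * x i ^ 2) := by
        rw [← Finset.mul_sum, sum_powerset_pow_card_mul_prod]
    _ ≤ (1 / 4) ^ N * Real.exp (4 * w * M) := by
        gcongr
        refine (prod_one_add_le_exp fun i => by positivity).trans (Real.exp_le_exp.2 ?_)
        rw [← Finset.mul_sum]
        gcongr

/-! ### Elementary symmetric functions in terms of power sums -/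

/-- The elementary symmetric functions as polynomials in the power sums `p 1, p 2, …`, through
Newton's identities. -/
def newtonEsymm (p : ℕ → ℝ) : ℕ → ℝ
  | 0 => 1
  | k + 1 => (∑ i : Fin (k + 1), (-1) ^ (k + (i : ℕ)) * newtonEsymm p i * p (k + 1 - i)) / (k + 1)
termination_by k => k
decreasing_by exact i.2

theorem newtonEsymm_zero (p : ℕ → ℝ) : newtonEsymm p 0 = 1 := by rw [newtonEsymm]

theorem newtonEsymm_succ (p : ℕ → ℝ) (k : ℕ) : newtonEsymm p (k + 1)
    = (∑ i ∈ Finset.range (k + 1), (-1) ^ (k + i) * newtonEsymm p i * p (k + 1 - i)) / (k + 1) := by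
  rw [newtonEsymm, Finset.sum_range]

/-- Neither `p 0`, which for actual power sums is the number of variables, nor orders above `k`
enter, so these may be replaced at will. -/
theorem newtonEsymm_congr {p q : ℕ → ℝ} (k : ℕ) (h : ∀ j, 1 ≤ j → j ≤ k → p j = q j) :
    newtonEsymm p k = newtonEsymm q k := by
  induction k using Nat.strong_induction_on with
  | _ k ih =>
    cases k with
    | zero => rw [newtonEsymm_zero, newtonEsymm_zero]
    | succ k =>
      rw [newtonEsymm_succ, newtonEsymm_succ]
      congr 1
      refine Finset.sum_congr rfl fun i hi => ?_
      rw [Finset.mem_range] at hi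
      rw [ih i hi fun j h1 h2 => h j h1 (by omega), h (k + 1 - i) (by omega) (by omega)]

theorem continuous_newtonEsymm (k : ℕ) : Continuous fun p : ℕ → ℝ => newtonEsymm p k := by
  induction k using Nat.strong_induction_on with
  | _ k ih =>
    cases k with
    | zero => simp only [newtonEsymm_zero]; exact continuous_const
    | succ k =>
      simp only [newtonEsymm_succ]
      refine Continuous.div_const (continuous_finsetSum _ fun i hi => ?_) _
      exact (continuous_const.mul (ih i (Finset.mem_range.1 hi))).mul (continuous_apply _)

/-- Newton's identities for the universal polynomials in variables indexed by `I`, evaluated at `y`.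
-/
theorem sum_powersetCard_prod_eq_newtonEsymm (I : Finset ℕ) (y : ℕ → ℝ) (k : ℕ) :
    ∑ A ∈ I.powersetCard k, ∏ i ∈ A, y i = newtonEsymm (fun j => ∑ i ∈ I, y i ^ j) k := by
  have hE : ∀ k, MvPolynomial.aeval (fun i : I => y i) (MvPolynomial.esymm I ℝ k)
      = ∑ A ∈ I.powersetCard k, ∏ i ∈ A, y i := by
    intro k
    rw [MvPolynomial.aeval_esymm_eq_multiset_esymm, ← Finset.esymm_map_val]
    congr 1
    exact Multiset.attach_map_val' I.val y
  have hP : ∀ j, MvPolynomial.aeval (fun i : I => y i) (MvPolynomial.psum I ℝ j)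
      = ∑ i ∈ I, y i ^ j := by
    intro j
    rw [← Finset.sum_coe_sort I fun i => y i ^ j]
    simp [MvPolynomial.psum]
  induction k using Nat.strong_induction_on with
  | _ k ih =>
    cases k with
    | zero => simp [newtonEsymm_zero]
    | succ k =>
      have h := congrArg (MvPolynomial.aeval (fun i : I => y i))
        (MvPolynomial.mul_esymm_eq_sum I ℝ (k + 1))
      simp only [map_mul, map_sum, map_pow, map_neg, map_one, map_natCast, hE, hP] at h
      rw [newtonEsymm_succ, eq_div_iff (by positivity), mul_comm]
      push_cast at h
      rw [h, Finset.sum_filter, Finset.Nat.sum_antidiagonal_eq_sum_range_succ_mk,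
        Finset.sum_range_succ]
      simp only [lt_irrefl, if_false, add_zero]
      rw [Finset.mul_sum]
      refine Finset.sum_congr rfl fun i hi => ?_
      rw [Finset.mem_range] at hi
      rw [if_pos hi, ih i hi]
      ring

theorem esymmWalsh_eq_newtonEsymm {Ω : Type*} (ξ : ℕ → Ω → ℝ) (n : ℕ) (b : ℕ → ℝ) (k : ℕ)
    (ω : Ω) : esymmWalsh ξ n b k ω
      = newtonEsymm (fun j => ∑ i ∈ Finset.Icc 1 n, (b i * ξ i ω) ^ j) k := by
  rw [← sum_powersetCard_prod_eq_newtonEsymm, esymmWalsh]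
  exact Finset.sum_congr rfl fun A _ => by rw [Finset.prod_mul_distrib, walsh]

/-! ### A maximal inequality for increments -/

/-- If the increments of `S` satisfy `E (S_j - S_i)² ≤ κ (j - i)^β` with `β > 1`, then the maximal
increment over `2^l` steps is bounded in the same way. -/
theorem exists_maximal_bound {β : ℝ} (hβ : 1 < β) :
    ∃ K : ℝ, 0 ≤ K ∧ ∀ {Ω : Type*} [MeasurableSpace Ω] (P : Measure Ω) (S : ℕ → Ω → ℝ) (κ : ℝ),
      0 ≤ κ → (∀ i j, i ≤ j → Integrable (fun ω => (S j ω - S i ω) ^ 2) P) →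
      (∀ i j, i ≤ j → ∫ ω, (S j ω - S i ω) ^ 2 ∂P ≤ κ * ((j : ℝ) - i) ^ β) →
      ∀ l i : ℕ, ∃ G : Ω → ℝ, Integrable G P ∧
        (∀ ω, ∀ j ≤ 2 ^ l, (S (i + j) ω - S i ω) ^ 2 ≤ G ω) ∧
        ∫ ω, G ω ∂P ≤ K * κ * ((2 : ℝ) ^ l) ^ β := by
  have h2β : (2 : ℝ) < 2 ^ β := by
    calc (2 : ℝ) = 2 ^ (1 : ℝ) := (Real.rpow_one 2).symm
      _ < 2 ^ β := Real.rpow_lt_rpow_of_exponent_lt (by norm_num) hβ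
  -- A block is cut at its midpoint, and `(x + y)² ≤ (1 + 1/d) x² + (1 + d) y²` is applied with `x`
  -- the increment to the midpoint. The two halves then contribute a factor `2(1 + d)`, which must
  -- stay below `2^β`; such a `d > 0` exists because `β > 1`, and this one leaves a gap of `2d`.
  set d : ℝ := ((2 : ℝ) ^ β - 2) / 4 with hd
  have hd0 : 0 < d := by rw [hd]; linarith
  have hgap : (2 : ℝ) ^ β - 2 * (1 + d) = 2 * d := by rw [hd]; ring
  -- The summand `1` serves the single-step case; the other makes `K · 2d` absorb the midpoint term.
  set K : ℝ := 1 + (1 + 1 / d) / (2 * d) with hK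
  have hK1 : 1 ≤ K := by rw [hK]; linarith [show 0 ≤ (1 + 1 / d) / (2 * d) by positivity]
  have hrec : (1 + 1 / d) + 2 * (1 + d) * K ≤ K * 2 ^ β := by
    have : (1 + 1 / d) ≤ K * (2 * d) := by
      rw [hK, add_mul, div_mul_cancel₀ _ (by positivity)]
      linarith
    rw [← hgap] at this
    linarith
  refine ⟨K, by linarith, ?_⟩
  intro Ω _ P S κ hκ hint hS l
  induction l with
  | zero =>
    intro i
    refine ⟨fun ω => (S (i + 1) ω - S i ω) ^ 2, hint _ _ (by omega), fun ω j hj => ?_, ?_⟩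
    · have hj : j = 0 ∨ j = 1 := by rw [pow_zero] at hj; omega
      rcases hj with rfl | rfl
      · simpa using sq_nonneg _
      · exact le_rfl
    · refine (hS i (i + 1) (by omega)).trans ?_
      push_cast
      rw [add_sub_cancel_left, pow_zero, Real.one_rpow, mul_one, mul_one]
      nlinarith
  | succ l ih =>
    intro i
    obtain ⟨G₁, hi₁, hb₁, hG₁⟩ := ih i
    obtain ⟨G₂, hi₂, hb₂, hG₂⟩ := ih (i + 2 ^ l)
    have hmid := hint i (i + 2 ^ l) (Nat.le_add_right _ _)
    -- The sum `G₁ + G₂` dominates the maximum over the two halves and keeps the bound integrable.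
    refine ⟨fun ω => (1 + 1 / d) * (S (i + 2 ^ l) ω - S i ω) ^ 2 + (1 + d) * (G₁ ω + G₂ ω),
      (hmid.const_mul _).add ((hi₁.add hi₂).const_mul _), fun ω j hj => ?_, ?_⟩
    · have hG₁0 : 0 ≤ G₁ ω := (sq_nonneg _).trans (hb₁ ω 0 (Nat.zero_le _))
      have hG₂0 : 0 ≤ G₂ ω := (sq_nonneg _).trans (hb₂ ω 0 (Nat.zero_le _))
      have hq : 0 ≤ (1 + 1 / d) * (S (i + 2 ^ l) ω - S i ω) ^ 2 := by positivity
      rcases le_total j (2 ^ l) with h | h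
      · have := hb₁ ω j h
        nlinarith [mul_nonneg hd0.le hG₁0, mul_nonneg hd0.le hG₂0]
      · obtain ⟨r, rfl⟩ := Nat.exists_eq_add_of_le h
        have hr := hb₂ ω r (by rw [pow_succ] at hj; omega)
        rw [← add_assoc]
        set x := S (i + 2 ^ l) ω - S i ω
        set y := S (i + 2 ^ l + r) ω - S (i + 2 ^ l) ω
        have e : S (i + 2 ^ l + r) ω - S i ω = x + y := by simp only [x, y]; ring
        have hxy : (x + y) ^ 2 ≤ (1 + 1 / d) * x ^ 2 + (1 + d) * y ^ 2 := by
          have : (1 + 1 / d) * x ^ 2 + (1 + d) * y ^ 2 - (x + y) ^ 2 = (x - d * y) ^ 2 / d := by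
            field_simp
            ring
          have h3 : 0 ≤ (x - d * y) ^ 2 / d := by positivity
          linarith
        rw [e]
        nlinarith [mul_nonneg hd0.le hG₁0]
    · have e0 := integral_add (hmid.const_mul (1 + 1 / d)) ((hi₁.add hi₂).const_mul (1 + d))
      simp only [Pi.add_apply] at e0
      rw [e0, integral_const_mul, integral_const_mul, integral_add hi₁ hi₂]
      have hm := hS i (i + 2 ^ l) (Nat.le_add_right _ _)
      push_cast at hm
      rw [add_sub_cancel_left] at hm
      set q : ℝ := ((2 : ℝ) ^ l) ^ β with hq
      have hq0 : 0 ≤ q := by positivity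
      have e : ((2 : ℝ) ^ (l + 1)) ^ β = q * 2 ^ β := by
        rw [pow_succ, Real.mul_rpow (by positivity) (by norm_num)]
      rw [e]
      calc _ ≤ (1 + 1 / d) * (κ * q) + (1 + d) * (K * κ * q + K * κ * q) := by gcongr
        _ = ((1 + 1 / d) + 2 * (1 + d) * K) * (κ * q) := by ring
        _ ≤ (K * 2 ^ β) * (κ * q) := by gcongr
        _ = _ := by ring

/-! ### Beta-type integrals -/

/-- Restates that the Beta density has total mass one. -/
theorem lintegral_rpow_mul_one_sub_rpow {a b : ℝ} (ha : 0 < a) (hb : 0 < b) :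
    ∫⁻ x in Set.Ioo (0 : ℝ) 1, ENNReal.ofReal (x ^ (a - 1) * (1 - x) ^ (b - 1))
      = ENNReal.ofReal (beta a b) := by
  have hB := beta_pos ha hb
  have h := lintegral_betaPDF_eq_one ha hb
  rw [lintegral_betaPDF] at h
  have e : ∀ x : ℝ, ENNReal.ofReal (1 / beta a b * x ^ (a - 1) * (1 - x) ^ (b - 1))
      = ENNReal.ofReal (1 / beta a b) * ENNReal.ofReal (x ^ (a - 1) * (1 - x) ^ (b - 1)) := by
    intro x
    rw [← ENNReal.ofReal_mul (by positivity), mul_assoc]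
  simp only [e] at h
  rw [lintegral_const_mul' _ _ ENNReal.ofReal_ne_top] at h
  have h2 := congrArg (fun y => ENNReal.ofReal (beta a b) * y) h
  rw [← mul_assoc, ← ENNReal.ofReal_mul hB.le, mul_one_div_cancel hB.ne', ENNReal.ofReal_one,
    one_mul, mul_one] at h2
  exact h2

/-- The Möbius substitution `x = s(v - u) / (u(v - s))` maps `(0, u)` onto `(0, 1)` with `1 - x =
v(u - s) / (u(v - s))`, and turns the integrand into that of a Beta integral with parameters `1 -
2h` and `h`. -/
theorem lintegral_Ioo_rpow_mul_rpow_mul_rpow {h u v : ℝ} (h0 : 0 < h) (h1 : h < 1 / 2)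
    (hu : 0 < u) (huv : u < v) :
    ∫⁻ s in Set.Ioo (0 : ℝ) u,
        ENNReal.ofReal (s ^ (-(2 * h)) * ((u - s) ^ (h - 1) * (v - s) ^ (h - 1)))
      = ENNReal.ofReal (beta (1 - 2 * h) h * ((u * v) ^ (-h) * (v - u) ^ (2 * h - 1))) := by
  have hv : 0 < v := hu.trans huv
  have hd : 0 < v - u := sub_pos.2 huv
  set f : ℝ → ℝ := fun s => s * (v - u) / (u * (v - s)) with hf
  set f' : ℝ → ℝ := fun s => (v - u) * v / (u * (v - s) ^ 2) with hf'
  have hderiv : ∀ s ∈ Set.Ioo (0 : ℝ) u, HasDerivWithinAt f (f' s) (Set.Ioo 0 u) s := by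
    intro s hs
    have hvs : v - s ≠ 0 := by linarith [hs.2]
    have hd1 : HasDerivAt (fun s : ℝ => s * (v - u)) (v - u) s := by
      simpa using (hasDerivAt_id s).mul_const (v - u)
    have hd2 : HasDerivAt (fun s : ℝ => u * (v - s)) (-u) s := by
      simpa using ((hasDerivAt_id s).const_sub v).const_mul u
    refine ((hd1.div hd2 (mul_ne_zero hu.ne' hvs)).congr_deriv ?_).hasDerivWithinAt
    rw [hf']
    field_simp
    ring
  have hmono : ∀ s ∈ Set.Ioo (0 : ℝ) u, 1 - f s = v * (u - s) / (u * (v - s)) := by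
    intro s hs
    have hvs : v - s ≠ 0 := by linarith [hs.2]
    rw [hf]
    field_simp
    ring
  have hinj : Set.InjOn f (Set.Ioo 0 u) := by
    intro s hs r hr hsr
    have hvs : v - s ≠ 0 := by linarith [hs.2]
    have hvr : v - r ≠ 0 := by linarith [hr.2]
    simp only [hf] at hsr
    rw [div_eq_div_iff (mul_ne_zero hu.ne' hvs) (mul_ne_zero hu.ne' hvr)] at hsr
    have : (s - r) * ((v - u) * u * v) = 0 := by linear_combination hsr
    rcases mul_eq_zero.1 this with h | h
    · linarith
    · exact absurd h (by positivity)
  have himage : f '' Set.Ioo 0 u = Set.Ioo 0 1 := by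
    ext x
    constructor
    · rintro ⟨s, hs, rfl⟩
      have hvs : 0 < v - s := by linarith [hs.2]
      have hus : 0 < u - s := by linarith [hs.2]
      refine ⟨by have := hs.1; simp only [hf]; positivity, ?_⟩
      have h3 := hmono s hs
      have : 0 < 1 - f s := by rw [h3]; positivity
      linarith
    · rintro ⟨hx0, hx1⟩
      have hden : 0 < v - u + u * x := by positivity
      -- The inverse Möbius map.
      refine ⟨u * v * x / (v - u + u * x), ⟨by positivity, ?_⟩, ?_⟩
      · rw [div_lt_iff₀ hden]
        nlinarith [mul_pos hu hd]
      · have h3 : v - u * v * x / (v - u + u * x) = v * (v - u) / (v - u + u * x) := by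
          field_simp
          ring
        simp only [hf]
        rw [h3]
        field_simp
  have key := lintegral_image_eq_lintegral_abs_deriv_mul measurableSet_Ioo hderiv hinj
    fun x => ENNReal.ofReal (x ^ ((1 - 2 * h) - 1) * (1 - x) ^ (h - 1))
  rw [himage, lintegral_rpow_mul_one_sub_rpow (by linarith) h0] at key
  have e : ∀ s ∈ Set.Ioo (0 : ℝ) u,
      ENNReal.ofReal (s ^ (-(2 * h)) * ((u - s) ^ (h - 1) * (v - s) ^ (h - 1)))
        = ENNReal.ofReal ((u * v) ^ (-h) * (v - u) ^ (2 * h - 1)) *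
          (ENNReal.ofReal |f' s| *
            ENNReal.ofReal (f s ^ ((1 - 2 * h) - 1) * (1 - f s) ^ (h - 1))) := by
    intro s hs
    have hs0 : 0 < s := hs.1
    have hvs : 0 < v - s := by linarith [hs.2]
    have hus : 0 < u - s := by linarith [hs.2]
    have hf'0 : 0 < f' s := by simp only [hf']; positivity
    rw [abs_of_pos hf'0, ← ENNReal.ofReal_mul hf'0.le, ← ENNReal.ofReal_mul (by positivity)]
    congr 1
    rw [hmono s hs]
    simp only [hf, hf']
    have e1 : (1 - 2 * h) - 1 = -(2 * h) := by ring
    rw [e1]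
    -- Both sides are positive products of real powers; taking logarithms makes the identity linear
    -- in the logarithms of the factors.
    rw [← Real.exp_log (show 0 < s ^ (-(2 * h)) * ((u - s) ^ (h - 1) * (v - s) ^ (h - 1)) by
      positivity)]
    rw [← Real.exp_log (show 0 < (u * v) ^ (-h) * (v - u) ^ (2 * h - 1) *
      ((v - u) * v / (u * (v - s) ^ 2) * ((s * (v - u) / (u * (v - s))) ^ (-(2 * h)) *
        (v * (u - s) / (u * (v - s))) ^ (h - 1))) by positivity)]
    congr 1
    have l1 : ∀ {x y : ℝ}, 0 < x → 0 < y → Real.log (x * y) = Real.log x + Real.log y :=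
      fun hx hy => Real.log_mul hx.ne' hy.ne'
    have l2 : ∀ {x y : ℝ}, 0 < x → 0 < y → Real.log (x / y) = Real.log x - Real.log y :=
      fun hx hy => Real.log_div hx.ne' hy.ne'
    rw [l1 (by positivity) (by positivity), l1 (by positivity) (by positivity),
      l1 (by positivity) (by positivity), l1 (by positivity) (by positivity),
      l1 (by positivity) (by positivity), l1 (by positivity) (by positivity),
      Real.log_rpow hs0, Real.log_rpow hus, Real.log_rpow hvs, Real.log_rpow (by positivity),
      Real.log_rpow hd, Real.log_rpow (by positivity), Real.log_rpow (by positivity),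
      l2 (by positivity) (by positivity), l2 (by positivity) (by positivity),
      l2 (by positivity) (by positivity), l1 hu hv, l1 hd hv, l1 hu (by positivity), Real.log_pow,
      l1 hs0 hd, l1 hu hvs, l1 hv hus]
    push_cast
    ring
  rw [setLIntegral_congr_fun measurableSet_Ioo e,
    lintegral_const_mul' _ _ ENNReal.ofReal_ne_top, ← key,
    ← ENNReal.ofReal_mul (by positivity), mul_comm]

theorem setLIntegral_ofReal_eq_intervalIntegral {a b : ℝ} (hab : a ≤ b) {g : ℝ → ℝ}
    (hg : IntervalIntegrable g volume a b) (h0 : ∀ x ∈ Set.Ioc a b, 0 ≤ g x) :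
    ∫⁻ x in Set.Ioc a b, ENNReal.ofReal (g x) = ENNReal.ofReal (∫ x in a..b, g x) := by
  rw [intervalIntegral.integral_of_le hab, ofReal_integral_eq_lintegral_ofReal]
  · exact (intervalIntegrable_iff_integrableOn_Ioc_of_le hab).1 hg
  · exact (ae_restrict_iff' measurableSet_Ioc).2 (ae_of_all _ h0)

theorem setLIntegral_abs_sub_rpow {q u t : ℝ} (hq : 0 < q) (hu : 0 ≤ u) (hut : u ≤ t) :
    ∫⁻ v in Set.Ioc 0 t, ENNReal.ofReal (|u - v| ^ (q - 1))
      = ENNReal.ofReal ((u ^ q + (t - u) ^ q) / q) := by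
  have hq1 : (-1 : ℝ) < q - 1 := by linarith
  have hI : ∀ a b : ℝ, IntervalIntegrable (fun x : ℝ => x ^ (q - 1)) volume a b := fun a b =>
    intervalIntegral.intervalIntegrable_rpow' hq1
  have e1 : ∫⁻ v in Set.Ioc 0 u, ENNReal.ofReal (|u - v| ^ (q - 1))
      = ENNReal.ofReal (u ^ q / q) := by
    rw [setLIntegral_congr_fun (g := fun v => ENNReal.ofReal ((u - v) ^ (q - 1)))
      measurableSet_Ioc fun v hv => by
        dsimp only; rw [abs_of_nonneg (by linarith [hv.2])]]
    rw [setLIntegral_ofReal_eq_intervalIntegral hu]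
    · rw [intervalIntegral.integral_comp_sub_left (fun x => x ^ (q - 1)), sub_self, sub_zero,
        integral_rpow (Or.inl hq1), sub_add_cancel, Real.zero_rpow hq.ne', sub_zero]
    · simpa using (hI u 0).comp_sub_left u
    · exact fun v hv => Real.rpow_nonneg (by linarith [hv.2]) _
  have e2 : ∫⁻ v in Set.Ioc u t, ENNReal.ofReal (|u - v| ^ (q - 1))
      = ENNReal.ofReal ((t - u) ^ q / q) := by
    rw [setLIntegral_congr_fun (g := fun v => ENNReal.ofReal ((v - u) ^ (q - 1)))
      measurableSet_Ioc fun v hv => by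
        dsimp only; rw [abs_sub_comm, abs_of_nonneg (by linarith [hv.1])]]
    rw [setLIntegral_ofReal_eq_intervalIntegral hut]
    · rw [intervalIntegral.integral_comp_sub_right (fun x => x ^ (q - 1)), sub_self,
        integral_rpow (Or.inl hq1), sub_add_cancel, Real.zero_rpow hq.ne', sub_zero]
    · simpa using (hI 0 (t - u)).comp_sub_right u
    · exact fun v hv => Real.rpow_nonneg (by linarith [hv.1]) _
  rw [← Set.Ioc_union_Ioc_eq_Ioc hu hut, lintegral_union measurableSet_Ioc
    (Set.Ioc_disjoint_Ioc_of_le le_rfl), e1, e2, ← ENNReal.ofReal_add, add_div]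
  · positivity
  · have : 0 ≤ t - u := by linarith
    positivity

/-- For `q = 2H - 1` this is the covariance of fractional Brownian motion up to the constant `H(2H -
1)`. -/
theorem setLIntegral_setLIntegral_abs_sub_rpow {q s t : ℝ} (hq : 0 < q) (hs : 0 ≤ s)
    (hst : s ≤ t) :
    ∫⁻ u in Set.Ioc 0 s, ∫⁻ v in Set.Ioc 0 t, ENNReal.ofReal (|u - v| ^ (q - 1))
      = ENNReal.ofReal ((s ^ (q + 1) + t ^ (q + 1) - (t - s) ^ (q + 1)) / (q * (q + 1))) := by
  have hc1 : Continuous fun u : ℝ => u ^ q := Real.continuous_rpow_const hq.le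
  have hc2 : Continuous fun u : ℝ => (t - u) ^ q := hc1.comp (continuous_const.sub continuous_id)
  rw [setLIntegral_congr_fun measurableSet_Ioc fun u hu =>
    setLIntegral_abs_sub_rpow hq hu.1.le (hu.2.trans hst)]
  rw [setLIntegral_ofReal_eq_intervalIntegral hs]
  · congr 1
    rw [intervalIntegral.integral_div, intervalIntegral.integral_add (hc1.intervalIntegrable _ _)
      (hc2.intervalIntegrable _ _), integral_rpow (Or.inl (by linarith)),
      intervalIntegral.integral_comp_sub_left (fun x => x ^ q), integral_rpow (Or.inl (by linarith)),
      Real.zero_rpow (by linarith), sub_zero, sub_zero]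
    field_simp
    ring
  · exact ((hc1.add hc2).div_const q).intervalIntegrable _ _
  · intro u hu
    have h1 : 0 ≤ u := hu.1.le
    have h2 : 0 ≤ t - u := by linarith [hu.2]
    positivity

/-! ### The covariance of the Molchan–Golosov kernel -/

/-- The inner integrand of the kernel, `u ^ (H - 1/2) * (u - s) ^ (H - 3/2)`, cut off at `s < u`. -/
def kernelDensity (H s u : ℝ) : ℝ≥0∞ :=
  if s < u then ENNReal.ofReal (u ^ (H - 1 / 2) * (u - s) ^ (H - 3 / 2)) else 0

theorem measurable_kernelDensity (H : ℝ) :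
    Measurable fun x : ℝ × ℝ => kernelDensity H x.1 x.2 := by
  unfold kernelDensity
  refine Measurable.ite (measurableSet_lt measurable_fst measurable_snd) ?_ measurable_const
  exact ENNReal.measurable_ofReal.comp (by fun_prop)

/-- The factor `(uv)^{H - 1/2}` of the two densities cancels the one produced by the Beta integral.
The diagonal is excluded because there the integral diverges, whereas the real power of `0` on the
right is `0`. -/
theorem lintegral_kernelDensity_mul {H u v : ℝ} (hH : 1 / 2 < H) (hH1 : H < 1) (hu : 0 < u)
    (hv : 0 < v) (hu1 : u ≤ 1) (hv1 : v ≤ 1) (huv : u ≠ v) :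
    ∫⁻ s in Set.Ioc (0 : ℝ) 1,
        ENNReal.ofReal (s ^ (1 - 2 * H)) * (kernelDensity H s u * kernelDensity H s v)
      = ENNReal.ofReal (beta (2 - 2 * H) (H - 1 / 2)) *
        ENNReal.ofReal (|u - v| ^ ((2 * H - 1) - 1)) := by
  wlog h : u < v generalizing u v
  · have := this hv hu hv1 hu1 huv.symm (lt_of_le_of_ne (not_lt.1 h) huv.symm)
    rw [abs_sub_comm] at this
    rw [← this]
    simp only [mul_comm]
  set r := H - 1 / 2 with hr
  have hk := lintegral_Ioo_rpow_mul_rpow_mul_rpow (h := r) (by linarith) (by linarith) hu h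
  have hsub : Set.Ioo (0 : ℝ) u ⊆ Set.Ioc 0 1 := fun s hs => ⟨hs.1, hs.2.le.trans hu1⟩
  have e : ∀ s ∈ Set.Ioc (0 : ℝ) 1,
      ENNReal.ofReal (s ^ (1 - 2 * H)) * (kernelDensity H s u * kernelDensity H s v)
      = (Set.Ioo 0 u).indicator (fun s => ENNReal.ofReal ((u * v) ^ r) *
        ENNReal.ofReal (s ^ (-(2 * r)) * ((u - s) ^ (r - 1) * (v - s) ^ (r - 1)))) s := by
    intro s hs
    by_cases hsu : s < u
    · rw [Set.indicator_of_mem (show s ∈ Set.Ioo 0 u from ⟨hs.1, hsu⟩), kernelDensity, kernelDensity,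
        if_pos hsu, if_pos (hsu.trans h)]
      have h1 : 0 < u - s := by linarith
      have h2 : 0 < v - s := by linarith
      have h3 := hs.1
      rw [← ENNReal.ofReal_mul (by positivity), ← ENNReal.ofReal_mul (by positivity),
        ← ENNReal.ofReal_mul (by positivity), Real.mul_rpow hu.le hv.le,
        show 1 - 2 * H = -(2 * r) by rw [hr]; ring, show H - 3 / 2 = r - 1 by rw [hr]; ring]
      congr 1
      ring
    · rw [Set.indicator_of_notMem (fun hm : s ∈ Set.Ioo 0 u => hsu hm.2), kernelDensity, if_neg hsu]
      simp
  rw [setLIntegral_congr_fun measurableSet_Ioc e, lintegral_indicator measurableSet_Ioo,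
    Measure.restrict_restrict measurableSet_Ioo, Set.inter_eq_left.2 hsub,
    lintegral_const_mul' _ _ ENNReal.ofReal_ne_top, hk]
  have hvu : 0 < v - u := sub_pos.2 h
  rw [← ENNReal.ofReal_mul (by positivity), ← ENNReal.ofReal_mul
    (beta_pos (by linarith) (by linarith)).le, abs_sub_comm, abs_of_pos hvu]
  congr 1
  have h4 : (u * v) ^ r * (u * v) ^ (-r) = 1 := by
    rw [← Real.rpow_add (by positivity)]; simp
  rw [show 1 - 2 * r = 2 - 2 * H by rw [hr]; ring, show 2 * r - 1 = 2 * H - 1 - 1 by rw [hr]; ring]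
  linear_combination (beta (2 - 2 * H) r * (v - u) ^ (2 * H - 1 - 1)) * h4

/-- The form suited to Tonelli's theorem: a nonnegative integral over a domain independent of `s`,
valid also for `s > t`, where both sides vanish. -/
theorem kernel_eq {H t s : ℝ} (hs : 0 < s) :
    kernel H t s = kernelConst H * (H - 1 / 2) * s ^ (1 / 2 - H) *
      (∫⁻ u in Set.Ioc 0 t, kernelDensity H s u).toReal := by
  unfold kernel
  split_ifs with hst
  · congr 1
    rw [intervalIntegral.integral_of_le hst, integral_eq_lintegral_of_nonneg_ae]
    · congr 1
      have e : ∀ u, kernelDensity H s u = (Set.Ioi s).indicator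
          (fun u => ENNReal.ofReal (u ^ (H - 1 / 2) * (u - s) ^ (H - 3 / 2))) u := fun u => by
        simp [kernelDensity, Set.indicator]
      simp only [e]
      rw [lintegral_indicator measurableSet_Ioi, Measure.restrict_restrict measurableSet_Ioi]
      congr 2
      ext u
      simp only [Set.mem_Ioc, Set.mem_inter_iff, Set.mem_Ioi]
      constructor
      · exact fun h => ⟨h.1, hs.trans h.1, h.2⟩
      · exact fun h => ⟨h.1, h.2.2⟩
    · exact (ae_restrict_iff' measurableSet_Ioc).2 (ae_of_all _ fun u hu => by
        have h1 : 0 ≤ u - s := by linarith [hu.1]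
        have h2 : 0 ≤ u := by linarith
        positivity)
    · exact Measurable.aestronglyMeasurable (by fun_prop)
  · have : ∫⁻ u in Set.Ioc 0 t, kernelDensity H s u = 0 := by
      rw [setLIntegral_congr_fun (g := fun _ => 0) measurableSet_Ioc fun u hu => by
        rw [kernelDensity, if_neg (by linarith [hu.2])]]
      simp
    rw [this]
    simp

theorem measurable_lintegral_kernelDensity (H t : ℝ) :
    Measurable fun s => ∫⁻ u in Set.Ioc 0 t, kernelDensity H s u :=
  (measurable_kernelDensity H).lintegral_prod_right'

theorem aestronglyMeasurable_kernel (H t : ℝ) :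
    AEStronglyMeasurable (kernel H t) (volume.restrict (Set.Ioc 0 1)) := by
  have hm : Measurable fun s : ℝ => kernelConst H * (H - 1 / 2) * s ^ (1 / 2 - H) *
      (∫⁻ u in Set.Ioc 0 t, kernelDensity H s u).toReal :=
    (by fun_prop : Measurable fun s : ℝ => kernelConst H * (H - 1 / 2) * s ^ (1 / 2 - H)).mul
      (measurable_lintegral_kernelDensity H t).ennreal_toReal
  refine hm.aestronglyMeasurable.congr ?_
  exact (ae_restrict_iff' measurableSet_Ioc).2 (ae_of_all _ fun s hs => (kernel_eq hs.1).symm)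

theorem kernelConst_nonneg (H : ℝ) : 0 ≤ kernelConst H := Real.sqrt_nonneg _

theorem kernel_nonneg {H : ℝ} (hH : 1 / 2 < H) {s : ℝ} (hs : 0 < s) (t : ℝ) :
    0 ≤ kernel H t s := by
  rw [kernel_eq hs]
  have := kernelConst_nonneg H
  have : 0 ≤ H - 1 / 2 := by linarith
  positivity

theorem lintegral_kernelDensity_lt_top {H : ℝ} (hH : 1 / 2 < H) {s : ℝ} (hs : 0 < s) (t : ℝ) :
    ∫⁻ u in Set.Ioc 0 t, kernelDensity H s u < ∞ := by
  rcases le_or_gt t s with hts | hst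
  · rw [setLIntegral_congr_fun (g := fun _ => 0) measurableSet_Ioc fun u hu => by
      rw [kernelDensity, if_neg (by linarith [hu.2])]]
    simp
  have hI : IntervalIntegrable (fun u : ℝ => u ^ (H - 1 / 2) * (u - s) ^ (H - 3 / 2)) volume s t := by
    refine IntervalIntegrable.continuousOn_mul ?_
      (Real.continuous_rpow_const (by linarith)).continuousOn
    have := (intervalIntegral.intervalIntegrable_rpow' (a := 0) (b := t - s)
      (show (-1 : ℝ) < H - 3 / 2 by linarith)).comp_sub_right s
    simpa using this
  have h2 := setLIntegral_ofReal_eq_intervalIntegral hst.le hI fun u hu => by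
    have h1 : 0 ≤ u - s := by linarith [hu.1]
    have h2 : 0 ≤ u := by linarith
    positivity
  have h3 : ∫⁻ u in Set.Ioc 0 t, kernelDensity H s u
      ≤ ∫⁻ u in Set.Ioc s t, ENNReal.ofReal (u ^ (H - 1 / 2) * (u - s) ^ (H - 3 / 2)) := by
    rw [← lintegral_indicator measurableSet_Ioc, ← lintegral_indicator measurableSet_Ioc]
    refine lintegral_mono fun u => ?_
    by_cases h : s < u ∧ u ≤ t
    · rw [Set.indicator_of_mem (show u ∈ Set.Ioc 0 t from ⟨hs.trans h.1, h.2⟩),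
        Set.indicator_of_mem (show u ∈ Set.Ioc s t from h), kernelDensity, if_pos h.1]
    · by_cases hu : u ∈ Set.Ioc 0 t
      · rw [Set.indicator_of_mem hu, kernelDensity, if_neg fun h' => h ⟨h', hu.2⟩]
        exact zero_le
      · rw [Set.indicator_of_notMem hu]
        exact zero_le
  exact h3.trans_lt (h2 ▸ ENNReal.ofReal_lt_top)

/-- The normalization that dictates `c_H`; it follows from `Γ(H + 1/2) = (H - 1/2) Γ(H - 1/2)`. -/
theorem kernelConst_sq_mul_beta {H : ℝ} (hH : 1 / 2 < H) (hH1 : H < 1) :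
    (kernelConst H * (H - 1 / 2)) ^ 2 * beta (2 - 2 * H) (H - 1 / 2) = H * (2 * H - 1) := by
  have g1 : 0 < Real.Gamma (3 / 2 - H) := Real.Gamma_pos_of_pos (by linarith)
  have g2 : 0 < Real.Gamma (H + 1 / 2) := Real.Gamma_pos_of_pos (by linarith)
  have g3 : 0 < Real.Gamma (2 - 2 * H) := Real.Gamma_pos_of_pos (by linarith)
  have g4 : 0 < Real.Gamma (H - 1 / 2) := Real.Gamma_pos_of_pos (by linarith)
  have hrec : Real.Gamma (H + 1 / 2) = (H - 1 / 2) * Real.Gamma (H - 1 / 2) := by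
    rw [← Real.Gamma_add_one (by linarith)]; ring_nf
  have hH0 : 0 < H := by linarith
  rw [mul_pow, kernelConst, Real.sq_sqrt (by positivity), beta,
    show 2 - 2 * H + (H - 1 / 2) = 3 / 2 - H by ring, hrec]
  have h5 : H - 1 / 2 ≠ 0 := by linarith
  generalize Real.Gamma (3 / 2 - H) = x at *
  generalize Real.Gamma (2 - 2 * H) = y at *
  generalize Real.Gamma (H - 1 / 2) = z at *
  field_simp

/-- The product of kernels is a double integral in `u, v`. Tonelli lets `s` be integrated first, and
the Beta integral leaves `H(2H - 1) ∫∫ |u - v|^{2H-2}`. -/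
theorem lintegral_kernel_mul_kernel {H : ℝ} (hH : 1 / 2 < H) (hH1 : H < 1) {t₁ t₂ : ℝ}
    (h₁ : 0 ≤ t₁) (h₁₂ : t₁ ≤ t₂) (h₂ : t₂ ≤ 1) :
    ∫⁻ s in Set.Ioc (0 : ℝ) 1, ENNReal.ofReal (kernel H t₁ s * kernel H t₂ s)
      = ENNReal.ofReal ((1 / 2) * (t₁ ^ (2 * H) + t₂ ^ (2 * H) - (t₂ - t₁) ^ (2 * H))) := by
  set c := kernelConst H * (H - 1 / 2) with hc
  have hc0 : 0 ≤ c := mul_nonneg (kernelConst_nonneg H) (by linarith)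
  have hB := beta_pos (show (0 : ℝ) < 2 - 2 * H by linarith) (show (0 : ℝ) < H - 1 / 2 by linarith)
  have hm := measurable_kernelDensity H
  have e1 : ∀ s ∈ Set.Ioc (0 : ℝ) 1, ENNReal.ofReal (kernel H t₁ s * kernel H t₂ s)
      = ENNReal.ofReal (c ^ 2) * ∫⁻ u in Set.Ioc 0 t₁, ∫⁻ v in Set.Ioc 0 t₂,
        ENNReal.ofReal (s ^ (1 - 2 * H)) * (kernelDensity H s u * kernelDensity H s v) := by
    intro s hs
    have hs0 : 0 < s := hs.1
    have f1 := (lintegral_kernelDensity_lt_top hH hs0 t₁).ne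
    have f2 := (lintegral_kernelDensity_lt_top hH hs0 t₂).ne
    have m2 : Measurable fun v => kernelDensity H s v := hm.comp measurable_prodMk_left
    have e2 : kernel H t₁ s * kernel H t₂ s = c ^ 2 * (s ^ (1 - 2 * H) *
        ((∫⁻ u in Set.Ioc 0 t₁, kernelDensity H s u).toReal *
          (∫⁻ u in Set.Ioc 0 t₂, kernelDensity H s u).toReal)) := by
      have e3 : s ^ (1 - 2 * H) = s ^ (1 / 2 - H) * s ^ (1 / 2 - H) := by
        rw [← Real.rpow_add hs0]; ring_nf
      rw [kernel_eq hs0, kernel_eq hs0, e3, hc]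
      ring
    rw [e2, ENNReal.ofReal_mul (by positivity), ENNReal.ofReal_mul (by positivity),
      ENNReal.ofReal_mul (by positivity), ENNReal.ofReal_toReal f1, ENNReal.ofReal_toReal f2]
    congr 1
    simp_rw [lintegral_const_mul' _ _ ENNReal.ofReal_ne_top]
    congr 1
    rw [← lintegral_mul_const _ m2]
    exact lintegral_congr fun u => by rw [lintegral_const_mul _ m2]
  rw [setLIntegral_congr_fun measurableSet_Ioc e1,
    lintegral_const_mul' _ _ ENNReal.ofReal_ne_top]
  have hF : Measurable fun x : ℝ × ℝ × ℝ => ENNReal.ofReal (x.1 ^ (1 - 2 * H)) *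
      (kernelDensity H x.1 x.2.1 * kernelDensity H x.1 x.2.2) := by
    refine Measurable.mul (by fun_prop) (Measurable.mul ?_ ?_)
    · exact hm.comp (measurable_fst.prodMk (measurable_fst.comp measurable_snd))
    · exact hm.comp (measurable_fst.prodMk (measurable_snd.comp measurable_snd))
  rw [lintegral_lintegral_swap]
  swap
  · refine Measurable.aemeasurable ?_
    have : Measurable fun y : (ℝ × ℝ) × ℝ => ENNReal.ofReal (y.1.1 ^ (1 - 2 * H)) *
        (kernelDensity H y.1.1 y.1.2 * kernelDensity H y.1.1 y.2) :=
      hF.comp (by fun_prop : Measurable fun y : (ℝ × ℝ) × ℝ => (y.1.1, y.1.2, y.2))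
    exact this.lintegral_prod_right'
  have e4 : ∀ u ∈ Set.Ioc 0 t₁, (∫⁻ s in Set.Ioc (0 : ℝ) 1, ∫⁻ v in Set.Ioc 0 t₂,
      ENNReal.ofReal (s ^ (1 - 2 * H)) * (kernelDensity H s u * kernelDensity H s v))
      = ∫⁻ v in Set.Ioc 0 t₂, ENNReal.ofReal (beta (2 - 2 * H) (H - 1 / 2)) *
        ENNReal.ofReal (|u - v| ^ ((2 * H - 1) - 1)) := by
    intro u hu
    rw [lintegral_lintegral_swap]
    swap
    · exact (hF.comp (by fun_prop : Measurable fun y : ℝ × ℝ => (y.1, u, y.2))).aemeasurable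
    refine lintegral_congr_ae ((ae_restrict_iff' measurableSet_Ioc).2 ?_)
    -- The diagonal, where the inner formula fails, is a null set.
    have hne : ∀ᵐ v : ℝ, v ≠ u := by
      rw [ae_iff]
      simp
    filter_upwards [hne] with v hvu hv
    exact lintegral_kernelDensity_mul hH hH1 hu.1 hv.1 (hu.2.trans (h₁₂.trans h₂))
      (hv.2.trans h₂) hvu.symm
  rw [setLIntegral_congr_fun measurableSet_Ioc e4]
  simp_rw [lintegral_const_mul' _ _ ENNReal.ofReal_ne_top]
  rw [setLIntegral_setLIntegral_abs_sub_rpow (by linarith) h₁ h₁₂, ← ENNReal.ofReal_mul hB.le,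
    ← ENNReal.ofReal_mul (by positivity)]
  congr 1
  rw [← mul_assoc, hc, kernelConst_sq_mul_beta hH hH1, show 2 * H - 1 + 1 = 2 * H by ring]
  have : H ≠ 0 := by linarith
  have : H * 2 - 1 ≠ 0 := by linarith
  rw [mul_comm 2 H]
  field_simp

theorem memLp_kernel {H : ℝ} (hH : 1 / 2 < H) (hH1 : H < 1) {t : ℝ} (h0 : 0 ≤ t) (h1 : t ≤ 1) :
    MemLp (kernel H t) 2 (volume.restrict (Set.Ioc 0 1)) := by
  rw [memLp_two_iff_integrable_sq (aestronglyMeasurable_kernel H t)]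
  refine ⟨(aestronglyMeasurable_kernel H t).pow 2, ?_⟩
  have h := lintegral_kernel_mul_kernel hH hH1 h0 le_rfl h1
  rw [hasFiniteIntegral_iff_ofReal (ae_of_all _ fun s => sq_nonneg _)]
  simp only [sq]
  rw [h]
  exact ENNReal.ofReal_lt_top

theorem integral_kernel_mul_kernel {H : ℝ} (hH : 1 / 2 < H) (hH1 : H < 1) {t₁ t₂ : ℝ}
    (h₁ : 0 ≤ t₁) (h₂ : 0 ≤ t₂) (h₁' : t₁ ≤ 1) (h₂' : t₂ ≤ 1) :
    ∫ s in Set.Ioc (0 : ℝ) 1, kernel H t₁ s * kernel H t₂ s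
      = (1 / 2) * (t₁ ^ (2 * H) + t₂ ^ (2 * H) - |t₁ - t₂| ^ (2 * H)) := by
  wlog h : t₁ ≤ t₂ generalizing t₁ t₂
  · have := this h₂ h₁ h₂' h₁' (not_le.1 h).le
    simp only [mul_comm (kernel H t₁ _)]
    rw [this, abs_sub_comm]
    ring
  rw [integral_eq_lintegral_of_nonneg_ae, lintegral_kernel_mul_kernel hH hH1 h₁ h h₂',
    ENNReal.toReal_ofReal, abs_sub_comm, abs_of_nonneg (sub_nonneg.2 h)]
  · have h3 : (t₂ - t₁) ^ (2 * H) ≤ t₂ ^ (2 * H) :=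
      Real.rpow_le_rpow (by linarith) (by linarith) (by linarith)
    have h4 : 0 ≤ t₁ ^ (2 * H) := by positivity
    linarith
  · exact (ae_restrict_iff' measurableSet_Ioc).2 (ae_of_all _ fun s hs =>
      mul_nonneg (kernel_nonneg hH hs.1 _) (kernel_nonneg hH hs.1 _))
  · exact (aestronglyMeasurable_kernel H t₁).mul (aestronglyMeasurable_kernel H t₂)

/-! ### Bessel's inequality and best approximation -/

section Bessel

variable {E : Type*} [NormedAddCommGroup E] [InnerProductSpace ℝ E]

/-- Pythagoras; choosing `c` as the coefficients gives Bessel's inequality, discarding the last sum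
gives best approximation. -/
theorem norm_sub_sum_smul_sq {I : Finset ℕ} {e : ℕ → E}
    (he : ∀ i ∈ I, ∀ j ∈ I, inner ℝ (e i) (e j) = if i = j then (1 : ℝ) else 0) (f : E)
    (c : ℕ → ℝ) :
    ‖f - ∑ i ∈ I, c i • e i‖ ^ 2
      = ‖f‖ ^ 2 - ∑ i ∈ I, inner ℝ (e i) f ^ 2 + ∑ i ∈ I, (c i - inner ℝ (e i) f) ^ 2 := by
  have h1 : inner ℝ f (∑ i ∈ I, c i • e i) = ∑ i ∈ I, c i * inner ℝ (e i) f := by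
    rw [inner_sum]
    exact Finset.sum_congr rfl fun i _ => by rw [real_inner_smul_right, real_inner_comm]
  have h2 : ‖∑ i ∈ I, c i • e i‖ ^ 2 = ∑ i ∈ I, c i ^ 2 := by
    rw [← real_inner_self_eq_norm_sq, sum_inner]
    refine Finset.sum_congr rfl fun i hi => ?_
    rw [inner_sum, Finset.sum_congr rfl fun j hj => by
      rw [real_inner_smul_left, real_inner_smul_right, he i hi j hj]]
    simp [hi, sq]
  rw [norm_sub_sq_real, h1, h2, Finset.sum_congr rfl fun i _ => sub_sq (c i) (inner ℝ (e i) f),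
    Finset.sum_add_distrib, Finset.sum_sub_distrib]
  simp only [mul_assoc, ← Finset.mul_sum]
  ring

theorem sum_inner_sq_le {I : Finset ℕ} {e : ℕ → E}
    (he : ∀ i ∈ I, ∀ j ∈ I, inner ℝ (e i) (e j) = if i = j then (1 : ℝ) else 0) (f : E) :
    ∑ i ∈ I, inner ℝ (e i) f ^ 2 ≤ ‖f‖ ^ 2 := by
  have h := norm_sub_sum_smul_sq he f fun i => inner ℝ (e i) f
  simp only [sub_self, ne_eq, OfNat.ofNat_ne_zero, not_false_eq_true, zero_pow,
    Finset.sum_const_zero, add_zero] at h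
  nlinarith [sq_nonneg ‖f - ∑ i ∈ I, (inner ℝ (e i) f : ℝ) • e i‖]

theorem norm_sq_sub_sum_inner_sq_le {I : Finset ℕ} {e : ℕ → E}
    (he : ∀ i ∈ I, ∀ j ∈ I, inner ℝ (e i) (e j) = if i = j then (1 : ℝ) else 0) (f : E)
    (c : ℕ → ℝ) :
    ‖f‖ ^ 2 - ∑ i ∈ I, inner ℝ (e i) f ^ 2 ≤ ‖f - ∑ i ∈ I, c i • e i‖ ^ 2 := by
  rw [norm_sub_sum_smul_sq he]
  linarith [Finset.sum_nonneg fun i (_ : i ∈ I) => sq_nonneg (c i - inner ℝ (e i) f)]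

end Bessel

/-! ### Averaging over the cells of an equidistant partition -/

/-- The Hilbert space `L²((0, 1])`. -/
abbrev L2Unit := Lp ℝ 2 (volume.restrict (Set.Ioc (0 : ℝ) 1))

/-- The normalized indicator `√n 1_((i - 1) / n, i / n]`. -/
def cellVec (n i : ℕ) : L2Unit :=
  indicatorConstLp 2 (measurableSet_Ioc (a := ((i : ℝ) - 1) / n) (b := (i : ℝ) / n))
    (measure_ne_top _ _) (Real.sqrt n)

theorem cell_subset {n i : ℕ} (hi : i ∈ Finset.Icc 1 n) :
    Set.Ioc (((i : ℝ) - 1) / n) ((i : ℝ) / n) ⊆ Set.Ioc 0 1 := by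
  rw [Finset.mem_Icc] at hi
  have hn : (0 : ℝ) < n := by exact_mod_cast (by omega : 0 < n)
  have h1 : (1 : ℝ) ≤ i := by exact_mod_cast hi.1
  have h2 : (i : ℝ) ≤ n := by exact_mod_cast hi.2
  intro x hx
  refine ⟨lt_of_le_of_lt (div_nonneg (by linarith) hn.le) hx.1, hx.2.trans ?_⟩
  rw [div_le_one hn]
  exact h2

theorem mem_cell_iff {n i : ℕ} (hi : i ∈ Finset.Icc 1 n) (x : ℝ) :
    x ∈ Set.Ioc (((i : ℝ) - 1) / n) ((i : ℝ) / n) ↔ ⌈(n : ℝ) * x⌉₊ = i := by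
  rw [Finset.mem_Icc] at hi
  have hn : (0 : ℝ) < n := by exact_mod_cast (by omega : 0 < n)
  rw [Nat.ceil_eq_iff (by omega), Set.mem_Ioc, div_lt_iff₀ hn, le_div_iff₀ hn,
    Nat.cast_sub hi.1, Nat.cast_one, mul_comm x]

theorem inner_cellVec {n i : ℕ} (hi : i ∈ Finset.Icc 1 n) (f : L2Unit) :
    inner ℝ (cellVec n i) f
      = Real.sqrt n * ∫ x in Set.Ioc (((i : ℝ) - 1) / n) ((i : ℝ) / n), f x := by
  rw [cellVec, L2.inner_indicatorConstLp_eq_inner_setIntegral,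
    Measure.restrict_restrict measurableSet_Ioc, Set.inter_eq_left.2 (cell_subset hi)]
  simp [mul_comm]

theorem inner_cellVec_cellVec {n : ℕ} {i : ℕ} (hi : i ∈ Finset.Icc 1 n) {j : ℕ}
    (hj : j ∈ Finset.Icc 1 n) :
    inner ℝ (cellVec n i) (cellVec n j) = if i = j then (1 : ℝ) else 0 := by
  have hn : (0 : ℝ) < n := by
    rw [Finset.mem_Icc] at hi
    exact_mod_cast (by omega : 0 < n)
  rw [cellVec, cellVec, L2.inner_indicatorConstLp_indicatorConstLp, measureReal_restrict_apply
    (measurableSet_Ioc.inter measurableSet_Ioc)]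
  split_ifs with h
  · subst h
    rw [Set.inter_self, Set.inter_eq_left.2 (cell_subset hi), Real.volume_real_Ioc_of_le
      (by gcongr; linarith)]
    simp only [smul_eq_mul, real_inner_self_eq_norm_sq, Real.norm_eq_abs, sq_abs,
      Real.sq_sqrt hn.le]
    field_simp
    ring
  · have : Set.Ioc (((i : ℝ) - 1) / n) ((i : ℝ) / n) ∩ Set.Ioc (((j : ℝ) - 1) / n) ((j : ℝ) / n)
        = ∅ := by
      ext x
      simp only [Set.mem_inter_iff, mem_cell_iff hi, mem_cell_iff hj, Set.mem_empty_iff_false,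
        iff_false, not_and]
      exact fun h1 h2 => h (h1.symm.trans h2)
    rw [this]
    simp

theorem norm_le_of_ae_abs_le {f : L2Unit} {C : ℝ} (hC : 0 ≤ C)
    (h : ∀ᵐ x ∂(volume.restrict (Set.Ioc (0 : ℝ) 1)), |f x| ≤ C) : ‖f‖ ≤ C := by
  have := Lp.norm_le_of_ae_bound (f := f) hC (by simpa only [Real.norm_eq_abs] using h)
  simpa [measureUnivNNReal] using this

theorem tendsto_norm_sub_sum_cellVec (g : BoundedContinuousFunction ℝ ℝ) {ε : ℝ} (hε : 0 < ε) :
    ∀ᶠ n : ℕ in atTop, ∃ c : ℕ → ℝ,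
      ‖BoundedContinuousFunction.toLp 2 (volume.restrict (Set.Ioc (0 : ℝ) 1)) ℝ g
        - ∑ i ∈ Finset.Icc 1 n, c i • cellVec n i‖ ≤ ε := by
  have huc := isCompact_Icc.uniformContinuousOn_of_continuous
    (g.continuous.continuousOn (s := Set.Icc (0 : ℝ) 1))
  rw [Metric.uniformContinuousOn_iff] at huc
  obtain ⟨δ, hδ, hg⟩ := huc ε hε
  filter_upwards [tendsto_one_div_atTop_nhds_zero_nat.eventually_lt_const hδ,
    eventually_ge_atTop 1] with n hnδ hn
  have hn0 : (0 : ℝ) < n := by exact_mod_cast hn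
  have hs0 : Real.sqrt n ≠ 0 := (Real.sqrt_pos.2 hn0).ne'
  -- Sampling `g` at the right endpoints of the cells; division by `√n` undoes the normalization of
  -- `cellVec`.
  refine ⟨fun i => g ((i : ℝ) / n) / Real.sqrt n, norm_le_of_ae_abs_le hε.le ?_⟩
  have hcell : ∀ᵐ x ∂(volume.restrict (Set.Ioc (0 : ℝ) 1)), ∀ i : ℕ, cellVec n i x
      = (Set.Ioc (((i : ℝ) - 1) / n) ((i : ℝ) / n)).indicator (fun _ => Real.sqrt n) x :=
    ae_all_iff.2 fun i => indicatorConstLp_coeFn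
  have hsmul : ∀ᵐ x ∂(volume.restrict (Set.Ioc (0 : ℝ) 1)), ∀ i : ℕ,
      ((g ((i : ℝ) / n) / Real.sqrt n) • cellVec n i : L2Unit) x
        = (g ((i : ℝ) / n) / Real.sqrt n) * cellVec n i x :=
    ae_all_iff.2 fun i => by
      filter_upwards [Lp.coeFn_smul (g ((i : ℝ) / n) / Real.sqrt n) (cellVec n i)] with x hx
      rw [hx, Pi.smul_apply, smul_eq_mul]
  filter_upwards [hcell, hsmul, Lp.coeFn_sub (BoundedContinuousFunction.toLp 2
      (volume.restrict (Set.Ioc (0 : ℝ) 1)) ℝ g)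
      (∑ i ∈ Finset.Icc 1 n, (g ((i : ℝ) / n) / Real.sqrt n) • cellVec n i),
    Lp.coeFn_finsetSum (Finset.Icc 1 n) fun i => (g ((i : ℝ) / n) / Real.sqrt n) • cellVec n i,
    BoundedContinuousFunction.coeFn_toLp (p := 2) (𝕜 := ℝ)
      (μ := volume.restrict (Set.Ioc (0 : ℝ) 1)) g,
    ae_restrict_mem measurableSet_Ioc] with x h1 h2 h3 h4 h5 hx
  have hk : ⌈(n : ℝ) * x⌉₊ ∈ Finset.Icc 1 n := by
    rw [Finset.mem_Icc]
    refine ⟨Nat.ceil_pos.2 (mul_pos hn0 hx.1), Nat.ceil_le.2 ?_⟩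
    exact mul_le_of_le_one_right hn0.le hx.2
  set k := ⌈(n : ℝ) * x⌉₊ with hkdef
  have hxk := (mem_cell_iff hk x).2 rfl
  rw [h3, Pi.sub_apply, h4, h5, Finset.sum_apply, Finset.sum_eq_single_of_mem k hk, h2, h1,
    Set.indicator_of_mem hxk, div_mul_cancel₀ _ hs0, ← Real.dist_eq]
  · refine (hg x ⟨hx.1.le, hx.2⟩ (k / n) ?_ ?_).le
    · refine ⟨by positivity, ?_⟩
      rw [div_le_one hn0]
      exact_mod_cast (Finset.mem_Icc.1 hk).2
    · rw [Real.dist_eq, abs_lt]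
      have e : ((k : ℝ) - 1) / n = k / n - 1 / n := sub_div _ _ _
      have := hxk.1
      have := hxk.2
      constructor <;> linarith
  · intro i hi hik
    rw [h2, h1, Set.indicator_of_notMem, mul_zero]
    rw [mem_cell_iff hi]
    exact fun h => hik h.symm

theorem abs_inner_cellVec_toLp_le (g : BoundedContinuousFunction ℝ ℝ) {n i : ℕ}
    (hi : i ∈ Finset.Icc 1 n) :
    |inner ℝ (cellVec n i)
      (BoundedContinuousFunction.toLp 2 (volume.restrict (Set.Ioc (0 : ℝ) 1)) ℝ g)|
      ≤ ‖g‖ / Real.sqrt n := by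
  have hn : (0 : ℝ) < n := by
    rw [Finset.mem_Icc] at hi
    exact_mod_cast (by omega : 0 < n)
  rw [inner_cellVec hi, abs_mul, abs_of_nonneg (Real.sqrt_nonneg _)]
  have h : ‖∫ x in Set.Ioc (((i : ℝ) - 1) / n) ((i : ℝ) / n),
      BoundedContinuousFunction.toLp 2 (volume.restrict (Set.Ioc (0 : ℝ) 1)) ℝ g x‖
      ≤ ‖g‖ * (volume.restrict (Set.Ioc (((i : ℝ) - 1) / n) ((i : ℝ) / n))).real Set.univ := by
    refine norm_integral_le_of_norm_le_const ?_
    have h5 := BoundedContinuousFunction.coeFn_toLp (p := 2) (𝕜 := ℝ)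
      (μ := volume.restrict (Set.Ioc (0 : ℝ) 1)) g
    have h6 : volume.restrict (Set.Ioc (((i : ℝ) - 1) / n) ((i : ℝ) / n))
        ≤ volume.restrict (Set.Ioc (0 : ℝ) 1) := Measure.restrict_mono (cell_subset hi) le_rfl
    filter_upwards [h5.filter_mono (ae_mono h6)] with x hx
    rw [hx]
    exact g.norm_coe_le_norm x
  rw [measureReal_restrict_apply_univ, Real.volume_real_Ioc_of_le (by gcongr; linarith),
    Real.norm_eq_abs] at h
  calc _ ≤ Real.sqrt n * (‖g‖ * ((i : ℝ) / n - ((i : ℝ) - 1) / n)) := by gcongr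
    _ = ‖g‖ * (Real.sqrt n / n) := by ring
    _ = ‖g‖ / Real.sqrt n := by rw [Real.sqrt_div_self, div_eq_mul_inv]

theorem exists_boundedContinuous_norm_sub_lt (f : L2Unit) {ε : ℝ} (hε : 0 < ε) :
    ∃ g : BoundedContinuousFunction ℝ ℝ,
      ‖f - BoundedContinuousFunction.toLp 2 (volume.restrict (Set.Ioc (0 : ℝ) 1)) ℝ g‖ < ε := by
  obtain ⟨g, hg⟩ := (BoundedContinuousFunction.toLp_denseRange ℝ
    (volume.restrict (Set.Ioc (0 : ℝ) 1)) ℝ (p := 2) (by norm_num)).exists_dist_lt f hε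
  exact ⟨g, by rwa [dist_eq_norm] at hg⟩

/-- The sum is the squared norm of the projection of `F n` onto step functions. The defect is at
most the squared distance to any step function, which is small since `f` is approximated by a
continuous function and that by its samples. -/
theorem tendsto_sum_inner_cellVec_sq {F : ℕ → L2Unit} {f : L2Unit} (hF : Tendsto F atTop (𝓝 f)) :
    Tendsto (fun n => ∑ i ∈ Finset.Icc 1 n, inner ℝ (cellVec n i) (F n) ^ 2) atTop
      (𝓝 (‖f‖ ^ 2)) := by
  have hnorm : Tendsto (fun n => ‖F n‖ ^ 2) atTop (𝓝 (‖f‖ ^ 2)) := hF.norm.pow 2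
  suffices h : Tendsto (fun n => ‖F n‖ ^ 2
      - ∑ i ∈ Finset.Icc 1 n, inner ℝ (cellVec n i) (F n) ^ 2) atTop (𝓝 0) by
    have := hnorm.sub h
    simpa using this
  rw [Metric.tendsto_nhds]
  intro ε hε
  have hs : 0 < Real.sqrt ε := Real.sqrt_pos.2 hε
  obtain ⟨g, hg⟩ := exists_boundedContinuous_norm_sub_lt f (show 0 < Real.sqrt ε / 4 by positivity)
  rw [Metric.tendsto_nhds] at hF
  filter_upwards [hF (Real.sqrt ε / 4) (by positivity),
    tendsto_norm_sub_sum_cellVec g (show 0 < Real.sqrt ε / 4 by positivity)] with n h1 ⟨c, h2⟩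
  rw [dist_eq_norm] at h1
  have horth : ∀ i ∈ Finset.Icc 1 n, ∀ j ∈ Finset.Icc 1 n,
      inner ℝ (cellVec n i) (cellVec n j) = if i = j then (1 : ℝ) else 0 :=
    fun i hi j hj => inner_cellVec_cellVec hi hj
  have h3 := norm_sq_sub_sum_inner_sq_le horth (F n) c
  have h4 := sum_inner_sq_le horth (F n)
  have h5 : ‖F n - ∑ i ∈ Finset.Icc 1 n, c i • cellVec n i‖ < Real.sqrt ε := by
    set G := BoundedContinuousFunction.toLp 2 (volume.restrict (Set.Ioc (0 : ℝ) 1)) ℝ g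
    calc _ = ‖(F n - f) + (f - G) + (G - ∑ i ∈ Finset.Icc 1 n, c i • cellVec n i)‖ := by
          congr 1; abel
      _ ≤ ‖F n - f‖ + ‖f - G‖ + ‖G - ∑ i ∈ Finset.Icc 1 n, c i • cellVec n i‖ := norm_add₃_le
      _ < Real.sqrt ε := by linarith
  rw [Real.dist_eq, sub_zero, abs_of_nonneg (by linarith)]
  calc _ ≤ ‖F n - ∑ i ∈ Finset.Icc 1 n, c i • cellVec n i‖ ^ 2 := h3
    _ < Real.sqrt ε ^ 2 := by gcongr
    _ = ε := Real.sq_sqrt hε.le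

/-- For bounded `g` the coefficients are `O(n^{-1/2})`, and Cauchy–Schwarz controls the rest by `‖F
n - g‖`. This negligibility drives both the central limit theorem and the vanishing of the power
sums of order at least 3. -/
theorem eventually_abs_inner_cellVec_le {F : ℕ → L2Unit} {f : L2Unit}
    (hF : Tendsto F atTop (𝓝 f)) {ε : ℝ} (hε : 0 < ε) :
    ∀ᶠ n in atTop, ∀ i ∈ Finset.Icc 1 n, |inner ℝ (cellVec n i) (F n)| ≤ ε := by
  obtain ⟨g, hg⟩ := exists_boundedContinuous_norm_sub_lt f (show 0 < ε / 4 by positivity)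
  rw [Metric.tendsto_nhds] at hF
  have hlim : Tendsto (fun n : ℕ => ‖g‖ / Real.sqrt n) atTop (𝓝 0) :=
    (Real.tendsto_sqrt_atTop.comp tendsto_natCast_atTop_atTop).const_div_atTop _
  filter_upwards [hF (ε / 4) (by positivity),
    hlim.eventually_lt_const (show 0 < ε / 4 by positivity)] with n h1 h2 i hi
  rw [dist_eq_norm] at h1
  have h3 := abs_inner_cellVec_toLp_le g hi
  set G := BoundedContinuousFunction.toLp 2 (volume.restrict (Set.Ioc (0 : ℝ) 1)) ℝ g
  have hnorm : ‖cellVec n i‖ = 1 := by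
    have : ‖cellVec n i‖ ^ 2 = 1 := by
      rw [← real_inner_self_eq_norm_sq, inner_cellVec_cellVec hi hi, if_pos rfl]
    nlinarith [norm_nonneg (cellVec n i)]
  have h4 : |inner ℝ (cellVec n i) (F n - G)| ≤ ‖F n - G‖ := by
    simpa [hnorm] using abs_real_inner_le_norm (cellVec n i) (F n - G)
  have h5 : ‖F n - G‖ ≤ ‖F n - f‖ + ‖f - G‖ := norm_sub_le_norm_sub_add_norm_sub _ _ _
  have h6 : inner ℝ (cellVec n i) (F n)
      = inner ℝ (cellVec n i) (F n - G) + inner ℝ (cellVec n i) G := by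
    rw [← inner_add_right, sub_add_cancel]
  rw [h6]
  refine (abs_add_le _ _).trans ?_
  linarith

/-! ### The kernel in the Hilbert space and the coefficients of the walk -/

section KernelVec

variable {H : ℝ} (hH : 1 / 2 < H) (hH1 : H < 1)

/-- The kernel `z_H(t, ·)` as an element of `L²((0, 1])`. -/
def kernelVec (t : unitInterval) : L2Unit := (memLp_kernel hH hH1 t.2.1 t.2.2).toLp _

theorem inner_kernelVec (s t : unitInterval) :
    inner ℝ (kernelVec hH hH1 s) (kernelVec hH hH1 t)
      = (1 / 2) * ((s : ℝ) ^ (2 * H) + (t : ℝ) ^ (2 * H) - |(s : ℝ) - t| ^ (2 * H)) := by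
  rw [← integral_kernel_mul_kernel hH hH1 s.2.1 t.2.1 s.2.2 t.2.2, L2.inner_def]
  refine integral_congr_ae ?_
  filter_upwards [(memLp_kernel hH hH1 s.2.1 s.2.2).coeFn_toLp,
    (memLp_kernel hH hH1 t.2.1 t.2.2).coeFn_toLp] with x h1 h2
  rw [kernelVec, kernelVec, h1, h2]
  simp [mul_comm]

theorem norm_kernelVec_sq (t : unitInterval) :
    ‖kernelVec hH hH1 t‖ ^ 2 = (t : ℝ) ^ (2 * H) := by
  rw [← real_inner_self_eq_norm_sq, inner_kernelVec, sub_self, abs_zero,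
    Real.zero_rpow (by linarith)]
  ring

/-- The source of the exponent `2H > 1` in all increment bounds. -/
theorem norm_kernelVec_sub_sq (s t : unitInterval) :
    ‖kernelVec hH hH1 s - kernelVec hH hH1 t‖ ^ 2 = |(s : ℝ) - t| ^ (2 * H) := by
  rw [norm_sub_sq_real, norm_kernelVec_sq, norm_kernelVec_sq, inner_kernelVec]
  ring

theorem norm_kernelVec_sq_le_one (t : unitInterval) : ‖kernelVec hH hH1 t‖ ^ 2 ≤ 1 := by
  rw [norm_kernelVec_sq]
  exact Real.rpow_le_one t.2.1 t.2.2 (by linarith)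

theorem continuous_kernelVec : Continuous (kernelVec hH hH1) := by
  rw [continuous_iff_continuousAt]
  intro t
  rw [ContinuousAt, tendsto_iff_norm_sub_tendsto_zero]
  have h : Continuous fun s : unitInterval => |(s : ℝ) - t| ^ (2 * H) :=
    (Real.continuous_rpow_const (by linarith)).comp
      ((continuous_subtype_val.sub continuous_const).abs)
  have h1 : Tendsto (fun s => ‖kernelVec hH hH1 s - kernelVec hH hH1 t‖ ^ 2) (𝓝 t) (𝓝 0) := by
    have := h.tendsto t
    simp only [sub_self, abs_zero, Real.zero_rpow (show 2 * H ≠ 0 by linarith)] at this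
    simpa only [norm_kernelVec_sub_sq] using this
  have h2 := h1.sqrt
  simpa [Real.sqrt_sq (norm_nonneg _)] using h2

/-- The point `j / n` of the grid, truncated at `1`. -/
def gridPoint (n j : ℕ) : unitInterval :=
  ⟨((min j n : ℕ) : ℝ) / n, div_nonneg (Nat.cast_nonneg _) (Nat.cast_nonneg _),
    div_le_one_of_le₀ (by exact_mod_cast min_le_right j n) (Nat.cast_nonneg _)⟩

theorem coe_gridPoint {n j : ℕ} (hj : j ≤ n) : (gridPoint n j : ℝ) = (j : ℝ) / n := by
  have h : (gridPoint n j : ℝ) = ((min j n : ℕ) : ℝ) / n := rfl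
  rw [h, min_eq_left hj]

/-- Truncation at `1` is a contraction, so `j ≤ n` is not needed; the dyadic blocks of the maximal
inequality may run past `n`. -/
theorem abs_gridPoint_sub_le {n i j : ℕ} (hij : i ≤ j) :
    |(gridPoint n j : ℝ) - gridPoint n i| ≤ ((j : ℝ) - i) / n := by
  have h1 : (i : ℝ) ≤ j := by exact_mod_cast hij
  have h2 : ((min i n : ℕ) : ℝ) ≤ (min j n : ℕ) := by exact_mod_cast min_le_min_right n hij
  have h3 : ((min j n : ℕ) : ℝ) - (min i n : ℕ) ≤ j - i := by
    push_cast
    rcases le_total (j : ℝ) n with h | h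
    · rw [min_eq_left h, min_eq_left (h1.trans h)]
    · rw [min_eq_right h]
      rcases le_total (i : ℝ) n with h' | h'
      · rw [min_eq_left h']; linarith
      · rw [min_eq_right h']; linarith
  simp only [gridPoint]
  rw [← sub_div, abs_of_nonneg (div_nonneg (by linarith) (Nat.cast_nonneg _))]
  gcongr

/-- The coefficient of `ξ_i` in the disturbed walk at time `j / n`. -/
def walkCoeff (n j i : ℕ) : ℝ := inner ℝ (cellVec n i) (kernelVec hH hH1 (gridPoint n j))

theorem walkCoeff_eq {n j i : ℕ} (hj : j ≤ n) (hi : i ∈ Finset.Icc 1 n) :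
    walkCoeff hH hH1 n j i = Real.sqrt n *
      ∫ s in (((i : ℝ) - 1) / n)..((i : ℝ) / n), kernel H ((j : ℝ) / n) s := by
  have hn : (0 : ℝ) < n := by
    rw [Finset.mem_Icc] at hi
    exact_mod_cast (by omega : 0 < n)
  rw [walkCoeff, inner_cellVec hi, intervalIntegral.integral_of_le (by gcongr; linarith)]
  congr 1
  refine integral_congr_ae ?_
  have h := (memLp_kernel hH hH1 (gridPoint n j).2.1 (gridPoint n j).2.2).coeFn_toLp
  have h6 : volume.restrict (Set.Ioc (((i : ℝ) - 1) / n) ((i : ℝ) / n))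
      ≤ volume.restrict (Set.Ioc (0 : ℝ) 1) := Measure.restrict_mono (cell_subset hi) le_rfl
  filter_upwards [h.filter_mono (ae_mono h6)] with x hx
  rw [kernelVec, hx, coe_gridPoint hj]

theorem walkCoeff_eq_zero {n j i : ℕ} (hj : j ≤ n) (hi : i ∈ Finset.Icc 1 n) (hij : j < i) :
    walkCoeff hH hH1 n j i = 0 := by
  have hn : (0 : ℝ) < n := by
    rw [Finset.mem_Icc] at hi
    exact_mod_cast (by omega : 0 < n)
  rw [walkCoeff_eq hH hH1 hj hi, intervalIntegral.integral_of_le (by gcongr; linarith),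
    setIntegral_congr_fun (g := fun _ => 0) measurableSet_Ioc fun s hs => ?_]
  · simp
  · have h1 : (j : ℝ) ≤ (i : ℝ) - 1 := by
      have : (j : ℝ) + 1 ≤ i := by exact_mod_cast hij
      linarith
    have h2 : (j : ℝ) / n < s := lt_of_le_of_lt (by gcongr) hs.1
    rw [kernel, if_neg (not_le.2 h2)]

/-- Since `z_H(t, s)` vanishes for `s > t`, the sum extends to all `i ≤ n`. The index set no longer
depends on time, and `n · (1/√n) = √n` is the normalization of the cell vectors. -/
theorem disturbedWalk_eq_sum {Ω : Type*} (ξ : ℕ → ℕ → Ω → ℝ) (n : ℕ) (t : unitInterval) (ω : Ω) :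
    disturbedWalk H ξ n t ω
      = ∑ i ∈ Finset.Icc 1 n, walkCoeff hH hH1 n ⌊(n : ℝ) * (t : ℝ)⌋₊ i * ξ n i ω := by
  set j := ⌊(n : ℝ) * (t : ℝ)⌋₊ with hjdef
  have hj : j ≤ n := floor_mul_le n t
  rw [← Finset.sum_subset (Finset.Icc_subset_Icc_right hj) fun i hi hij => ?_]
  · rw [disturbedWalk]
    refine Finset.sum_congr rfl fun i hi => ?_
    rw [walkCoeff_eq hH hH1 hj (Finset.Icc_subset_Icc_right hj hi), ← hjdef]
    have e : (n : ℝ) * (1 / Real.sqrt n) = Real.sqrt n := by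
      rw [mul_one_div, Real.div_sqrt]
    rw [mul_right_comm (n : ℝ) _ (1 / Real.sqrt n), e]
  · rw [walkCoeff_eq_zero hH hH1 hj hi (by
      simp only [Finset.mem_Icc] at hi hij; omega), zero_mul]

theorem sum_walkCoeff_sq_le_one (n j : ℕ) :
    ∑ i ∈ Finset.Icc 1 n, walkCoeff hH hH1 n j i ^ 2 ≤ 1 :=
  (sum_inner_sq_le (fun _ hi _ hj => inner_cellVec_cellVec hi hj) _).trans
    (norm_kernelVec_sq_le_one hH hH1 _)

theorem sum_walkCoeff_sub_sq_le (n : ℕ) {i j : ℕ} (hij : i ≤ j) :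
    ∑ l ∈ Finset.Icc 1 n, (walkCoeff hH hH1 n j l - walkCoeff hH hH1 n i l) ^ 2
      ≤ (((j : ℝ) - i) / n) ^ (2 * H) := by
  simp only [walkCoeff, ← inner_sub_right]
  refine (sum_inner_sq_le (fun _ hi _ hj => inner_cellVec_cellVec hi hj) _).trans ?_
  rw [norm_kernelVec_sub_sq]
  exact Real.rpow_le_rpow (abs_nonneg _) (abs_gridPoint_sub_le hij) (by linarith)

end KernelVec

/-! ### A central limit theorem for weighted Rademacher sums -/

theorem abs_cos_sub_exp_le {d : ℝ} (hd : |d| ≤ 1) :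
    |Real.cos d - Real.exp (-(d ^ 2 / 2))| ≤ d ^ 4 := by
  have h1 := Real.cos_bound hd
  have hd2 : d ^ 2 ≤ 1 := by rw [← sq_abs]; exact pow_le_one₀ (abs_nonneg d) hd
  have h2 := Real.abs_exp_sub_one_sub_id_le (x := -(d ^ 2 / 2)) (by
    rw [abs_neg, abs_of_nonneg (by positivity)]; linarith)
  have h3 : |d| ^ 4 = d ^ 4 := Even.pow_abs (by decide) d
  rw [h3] at h1
  rw [abs_le] at h1 h2 ⊢
  have h4 : 0 ≤ d ^ 4 := by positivity
  constructor <;> nlinarith [h1.1, h1.2, h2.1, h2.2]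

theorem abs_prod_sub_prod_le {I : Finset ℕ} {x y : ℕ → ℝ} (hx : ∀ i, |x i| ≤ 1)
    (hy : ∀ i, |y i| ≤ 1) : |∏ i ∈ I, x i - ∏ i ∈ I, y i| ≤ ∑ i ∈ I, |x i - y i| := by
  induction I using Finset.induction_on with
  | empty => simp
  | insert a I ha ih =>
    rw [Finset.prod_insert ha, Finset.prod_insert ha, Finset.sum_insert ha]
    have hp : |∏ i ∈ I, y i| ≤ 1 := by
      rw [Finset.abs_prod]
      exact Finset.prod_le_one (fun i _ => abs_nonneg _) fun i _ => hy i
    calc |x a * ∏ i ∈ I, x i - y a * ∏ i ∈ I, y i|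
        = |(x a - y a) * ∏ i ∈ I, y i + x a * (∏ i ∈ I, x i - ∏ i ∈ I, y i)| := by
          congr 1; ring
      _ ≤ |x a - y a| * |∏ i ∈ I, y i| + |x a| * |∏ i ∈ I, x i - ∏ i ∈ I, y i| := by
          rw [← abs_mul, ← abs_mul]; exact abs_add_le _ _
      _ ≤ |x a - y a| * 1 + 1 * ∑ i ∈ I, |x i - y i| := by
          gcongr
          exact hx a
      _ = _ := by ring

/-- Factor by factor, `cos d` differs from `exp(-d²/2)` by at most `d⁴`, and `∑ d⁴ ≤ max d² · ∑ d²`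
tends to zero. -/
theorem tendsto_prod_cos {d : ℕ → ℕ → ℝ} {v : ℝ}
    (hv : Tendsto (fun n => ∑ i ∈ Finset.Icc 1 n, d n i ^ 2) atTop (𝓝 v))
    (hmax : ∀ ε : ℝ, 0 < ε → ∀ᶠ n in atTop, ∀ i ∈ Finset.Icc 1 n, |d n i| ≤ ε) :
    Tendsto (fun n => ∏ i ∈ Finset.Icc 1 n, Real.cos (d n i)) atTop (𝓝 (Real.exp (-(v / 2)))) := by
  have h1 : Tendsto (fun n => Real.exp (-((∑ i ∈ Finset.Icc 1 n, d n i ^ 2) / 2))) atTop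
      (𝓝 (Real.exp (-(v / 2)))) :=
    (Real.continuous_exp.tendsto _).comp (hv.div_const 2).neg
  suffices h : Tendsto (fun n => ∏ i ∈ Finset.Icc 1 n, Real.cos (d n i)
      - Real.exp (-((∑ i ∈ Finset.Icc 1 n, d n i ^ 2) / 2))) atTop (𝓝 0) by
    simpa using h.add h1
  rw [Metric.tendsto_nhds]
  intro ε hε
  have hv1 : 0 < |v| + 1 := by positivity
  set δ := min 1 (ε / (2 * (|v| + 1))) with hδ
  have hδ0 : 0 < δ := lt_min one_pos (by positivity)
  filter_upwards [hmax δ hδ0, hv.eventually_lt_const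
    (show v < |v| + 1 by linarith [le_abs_self v])] with n hn hvn
  have hexp : Real.exp (-((∑ i ∈ Finset.Icc 1 n, d n i ^ 2) / 2))
      = ∏ i ∈ Finset.Icc 1 n, Real.exp (-(d n i ^ 2 / 2)) := by
    rw [← Real.exp_sum, Finset.sum_neg_distrib, Finset.sum_div]
  rw [Real.dist_eq, sub_zero, hexp]
  have hs0 : 0 ≤ ∑ i ∈ Finset.Icc 1 n, d n i ^ 2 := Finset.sum_nonneg fun i _ => sq_nonneg _
  calc _ ≤ ∑ i ∈ Finset.Icc 1 n, |Real.cos (d n i) - Real.exp (-(d n i ^ 2 / 2))| :=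
        abs_prod_sub_prod_le (fun i => Real.abs_cos_le_one _) fun i => by
          rw [abs_of_pos (Real.exp_pos _), Real.exp_le_one_iff]
          linarith [sq_nonneg (d n i)]
    _ ≤ ∑ i ∈ Finset.Icc 1 n, δ * d n i ^ 2 := by
        refine Finset.sum_le_sum fun i hi => ?_
        have h2 := hn i hi
        have h3 : |d n i| ≤ 1 := h2.trans (min_le_left _ _)
        refine (abs_cos_sub_exp_le h3).trans ?_
        have h4 : d n i ^ 2 ≤ δ := by
          rw [← sq_abs]
          calc |d n i| ^ 2 = |d n i| * |d n i| := sq _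
            _ ≤ 1 * δ := by gcongr
            _ = δ := one_mul _
        calc d n i ^ 4 = d n i ^ 2 * d n i ^ 2 := by ring
          _ ≤ δ * d n i ^ 2 := by gcongr
    _ = δ * ∑ i ∈ Finset.Icc 1 n, d n i ^ 2 := by rw [Finset.mul_sum]
    _ ≤ ε / (2 * (|v| + 1)) * (|v| + 1) := by
        gcongr
        exact min_le_right _ _
    _ = ε / 2 := by field_simp
    _ < ε := half_lt_self hε

theorem IsBernoulliArray.integral_cexp_sum {Ω : Type*} [MeasurableSpace Ω] {P : Measure Ω}
    [IsProbabilityMeasure P] {ξ : ℕ → ℕ → Ω → ℝ} (hξ : IsBernoulliArray ξ P) (n : ℕ)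
    (d : ℕ → ℝ) :
    ∫ ω, Complex.exp (((∑ i ∈ Finset.Icc 1 n, d i * ξ n i ω : ℝ) : ℂ) * Complex.I) ∂P
      = ((∏ i ∈ Finset.Icc 1 n, Real.cos (d i) : ℝ) : ℂ) := by
  have e : ∀ ω, Complex.exp (((∑ i ∈ Finset.Icc 1 n, d i * ξ n i ω : ℝ) : ℂ) * Complex.I)
      = ∏ i ∈ Finset.Icc 1 n, Complex.exp (((d i * ξ n i ω : ℝ) : ℂ) * Complex.I) := by
    intro ω
    rw [← Complex.exp_sum, Complex.ofReal_sum, Finset.sum_mul]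
  simp only [e]
  rw [hξ.integral_prod n (fun i x => Complex.exp (((d i * x : ℝ) : ℂ) * Complex.I))
    fun i => by fun_prop]
  push_cast
  refine Finset.prod_congr rfl fun i _ => ?_
  rw [Complex.cos]
  ring_nf

section CLT

variable {Ω Ω' : Type*} [MeasurableSpace Ω] [MeasurableSpace Ω']
  {P : Measure Ω} [IsProbabilityMeasure P] {P' : Measure Ω'} [IsProbabilityMeasure P']
  {H : ℝ} (hH : 1 / 2 < H) (hH1 : H < 1) {ξ : ℕ → ℕ → Ω → ℝ} {BH : unitInterval → Ω' → ℝ}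

theorem IsFractionalBrownianMotion.integral_cexp_sum (hBH : IsFractionalBrownianMotion H BH P')
    {r : ℕ} (τ : Fin r → unitInterval) (θ : Fin r → ℝ) :
    ∫ ω, Complex.exp (((∑ l, θ l * BH (τ l) ω : ℝ) : ℂ) * Complex.I) ∂P'
      = ((Real.exp (-(‖∑ l, θ l • kernelVec hH hH1 (τ l)‖ ^ 2 / 2)) : ℝ) : ℂ) := by
  have hG := ((hBH.isGaussianProcess.comp_right τ).smul θ).hasGaussianLaw_fun_sum
    (I := Finset.univ)
  simp only [Function.comp_apply, smul_eq_mul] at hG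
  have hL2 : ∀ t, MemLp (BH t) 2 P' := fun t =>
    (hBH.isGaussianProcess.hasGaussianLaw_eval t).memLp_two
  have hmean : ∫ ω, ∑ l, θ l * BH (τ l) ω ∂P' = 0 := by
    rw [integral_finsetSum _ fun l _ => ((hL2 (τ l)).integrable one_le_two).const_mul _]
    exact Finset.sum_eq_zero fun l _ => by
      rw [integral_const_mul, hBH.integral_eq_zero, mul_zero]
  have hsq : ∫ ω, (∑ l, θ l * BH (τ l) ω) ^ 2 ∂P'
      = ‖∑ l, θ l • kernelVec hH hH1 (τ l)‖ ^ 2 := by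
    have hint : ∀ l m, Integrable (fun ω => θ l * BH (τ l) ω * (θ m * BH (τ m) ω)) P' :=
      fun l m => ((hL2 (τ l)).const_mul (θ l)).integrable_mul ((hL2 (τ m)).const_mul (θ m))
    have e : ∀ ω, (∑ l, θ l * BH (τ l) ω) ^ 2
        = ∑ l, ∑ m, θ l * BH (τ l) ω * (θ m * BH (τ m) ω) := fun ω => by
      rw [sq, Finset.sum_mul_sum]
    simp only [e]
    rw [integral_finsetSum _ fun l _ => integrable_finsetSum _ fun m _ => hint l m,
      ← real_inner_self_eq_norm_sq, sum_inner]
    refine Finset.sum_congr rfl fun l _ => ?_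
    rw [integral_finsetSum _ fun m _ => hint l m, inner_sum]
    refine Finset.sum_congr rfl fun m _ => ?_
    have e2 : ∀ ω, θ l * BH (τ l) ω * (θ m * BH (τ m) ω)
        = θ l * θ m * (BH (τ l) ω * BH (τ m) ω) := fun ω => by ring
    simp only [e2]
    rw [integral_const_mul, hBH.covariance, real_inner_smul_left, real_inner_smul_right,
      inner_kernelVec, abs_of_nonneg (τ l).2.1, abs_of_nonneg (τ m).2.1, abs_sub_comm]
    ring
  have hchar := hG.charFun_map_eq 1
  rw [charFun_apply, integral_map hG.aemeasurable (by fun_prop)] at hchar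
  simp only [RCLike.inner_apply, conj_trivial, mul_one, one_mul] at hchar
  rw [variance_of_integral_eq_zero hG.aemeasurable hmean, hsq, hmean] at hchar
  rw [hchar]
  push_cast
  ring_nf

/-- The characteristic function is a product of cosines of the cell coefficients of `∑ θ_l z_H(t_l,
·)`, whose squared norm is the variance of `∑ θ_l B^H_{t_l}`. The Euclidean norm is imposed on the
target only to speak of characteristic functions and is forgotten at the end. -/
theorem tendstoInDistribution_walk (hξ : IsBernoulliArray ξ P)
    (hBH : IsFractionalBrownianMotion H BH P') {r : ℕ} (τ : Fin r → unitInterval)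
    (k : ℕ → Fin r → ℕ) (hk : ∀ l, Tendsto (fun n => gridPoint n (k n l)) atTop (𝓝 (τ l))) :
    TendstoInDistribution
      (fun n ω l => ∑ i ∈ Finset.Icc 1 n, walkCoeff hH hH1 n (k n l) i * ξ n i ω) atTop
      (fun ω l => BH (τ l) ω) (fun _ => P) P' := by
  have hm : ∀ n, Measurable fun ω => WithLp.toLp 2 fun l : Fin r =>
      ∑ i ∈ Finset.Icc 1 n, walkCoeff hH hH1 n (k n l) i * ξ n i ω := fun n => by
    refine (WithLp.measurable_toLp 2 _).comp (measurable_pi_lambda _ fun l => ?_)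
    exact Finset.measurable_sum _ fun i hi => (hξ.measurable n i hi).const_mul _
  have hm' : AEMeasurable (fun ω => WithLp.toLp 2 fun l : Fin r => BH (τ l) ω) P' :=
    (WithLp.measurable_toLp 2 _).comp_aemeasurable
      (aemeasurable_pi_lambda _ fun l => hBH.isGaussianProcess.aemeasurable (τ l))
  have key : TendstoInDistribution
      (fun n ω => WithLp.toLp 2 fun l : Fin r =>
        ∑ i ∈ Finset.Icc 1 n, walkCoeff hH hH1 n (k n l) i * ξ n i ω) atTop
      (fun ω => WithLp.toLp 2 fun l : Fin r => BH (τ l) ω) (fun _ => P) P' := by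
    refine ⟨fun n => (hm n).aemeasurable, hm', ?_⟩
    refine ProbabilityMeasure.tendsto_of_tendsto_charFun fun θ => ?_
    simp only [ProbabilityMeasure.coe_mk]
    have e1 : ∀ n, charFun (P.map fun ω => WithLp.toLp 2 fun l : Fin r =>
        ∑ i ∈ Finset.Icc 1 n, walkCoeff hH hH1 n (k n l) i * ξ n i ω) θ
        = ((∏ i ∈ Finset.Icc 1 n, Real.cos (inner ℝ (cellVec n i)
          (∑ l, θ l • kernelVec hH hH1 (gridPoint n (k n l)))) : ℝ) : ℂ) := by
      intro n
      rw [charFun_apply, integral_map (hm n).aemeasurable (by fun_prop),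
        ← hξ.integral_cexp_sum n]
      congr 1
      funext ω
      congr 3
      simp only [PiLp.inner_apply, RCLike.inner_apply, conj_trivial, inner_sum,
        real_inner_smul_right, Finset.sum_mul, Finset.mul_sum]
      rw [Finset.sum_comm]
      exact Finset.sum_congr rfl fun i _ => Finset.sum_congr rfl fun l _ => by
        rw [walkCoeff]; ring
    have e2 : charFun (P'.map fun ω => WithLp.toLp 2 fun l : Fin r => BH (τ l) ω) θ
        = ((Real.exp (-(‖∑ l, θ l • kernelVec hH hH1 (τ l)‖ ^ 2 / 2)) : ℝ) : ℂ) := by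
      rw [charFun_apply, integral_map hm' (by fun_prop), ← hBH.integral_cexp_sum hH hH1 τ θ]
      congr 1
    rw [e2]
    simp only [e1]
    have hF : Tendsto (fun n => ∑ l, θ l • kernelVec hH hH1 (gridPoint n (k n l))) atTop
        (𝓝 (∑ l, θ l • kernelVec hH hH1 (τ l))) :=
      tendsto_finsetSum _ fun l _ =>
        (((continuous_kernelVec hH hH1).tendsto _).comp (hk l)).const_smul _
    exact (Complex.continuous_ofReal.tendsto _).comp
      (tendsto_prod_cos (tendsto_sum_inner_cellVec_sq hF)
        fun ε hε => eventually_abs_inner_cellVec_le hF hε)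
  exact key.continuous_comp (PiLp.continuous_ofLp 2 fun _ : Fin r => ℝ)

end CLT

/-! ### Hermite polynomials and Wick powers of Gaussian variables -/

/-- The power sums `(x, v, 0, 0, …)`. -/
def hermiteSums (x v : ℝ) (j : ℕ) : ℝ := if j = 1 then x else if j = 2 then v else 0

/-- The Hermite polynomials `h_k(x, v)` with variance parameter `v`, normalized such that
`∑ h_k(x, v) w ^ k = exp (w x - w² v / 2)`. -/
def hermiteNorm (x v : ℝ) (k : ℕ) : ℝ := newtonEsymm (hermiteSums x v) k

theorem hermiteNorm_zero (x v : ℝ) : hermiteNorm x v 0 = 1 := newtonEsymm_zero _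

theorem hermiteNorm_one (x v : ℝ) : hermiteNorm x v 1 = x := by
  rw [hermiteNorm, newtonEsymm_succ]
  simp [newtonEsymm_zero, hermiteSums]

/-- Only the last two terms of Newton's recursion meet a nonzero power sum. -/
theorem hermiteNorm_add_two (x v : ℝ) (k : ℕ) :
    ((k : ℝ) + 2) * hermiteNorm x v (k + 2)
      = x * hermiteNorm x v (k + 1) - v * hermiteNorm x v k := by
  have h : ∀ i ∈ Finset.range k, (-1 : ℝ) ^ (k + 1 + i) * newtonEsymm (hermiteSums x v) i *
      hermiteSums x v (k + 1 + 1 - i) = 0 := by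
    intro i hi
    rw [Finset.mem_range] at hi
    rw [hermiteSums, if_neg (by omega), if_neg (by omega), mul_zero]
  simp only [hermiteNorm]
  rw [newtonEsymm_succ, Finset.sum_range_succ, Finset.sum_range_succ, Finset.sum_eq_zero h]
  have e1 : k + 1 + 1 - (k + 1) = 1 := by omega
  have e2 : k + 1 + 1 - k = 2 := by omega
  have e3 : (-1 : ℝ) ^ (k + 1 + (k + 1)) = 1 := Even.neg_one_pow ⟨k + 1, rfl⟩
  have e4 : (-1 : ℝ) ^ (k + 1 + k) = -1 := Odd.neg_one_pow ⟨k, by ring⟩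
  rw [e1, e2, e3, e4]
  simp only [hermiteSums]
  push_cast
  have : (k : ℝ) + 1 + 1 ≠ 0 := by positivity
  field_simp
  ring

theorem hasDerivAt_hermiteNorm (v : ℝ) (k : ℕ) (y : ℝ) :
    HasDerivAt (fun y => hermiteNorm y v (k + 1)) (hermiteNorm y v k) y := by
  induction k using Nat.strong_induction_on generalizing y with
  | _ k ih =>
    match k with
    | 0 =>
      simp only [zero_add, hermiteNorm_one, hermiteNorm_zero]
      exact hasDerivAt_id y
    | 1 =>
      have h : (fun y => hermiteNorm y v (1 + 1)) = fun y => (y * y - v) / 2 := by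
        funext y
        have := hermiteNorm_add_two y v 0
        simp only [zero_add, hermiteNorm_one, hermiteNorm_zero, Nat.cast_zero] at this
        rw [eq_div_iff two_ne_zero]
        linarith
      rw [h, hermiteNorm_one]
      have := (((hasDerivAt_id y).mul (hasDerivAt_id y)).sub_const v).div_const 2
      refine this.congr_deriv ?_
      simp only [id]
      ring
    | k + 2 =>
      have h : (fun y => hermiteNorm y v (k + 2 + 1)) = fun y =>
          (y * hermiteNorm y v (k + 2) - v * hermiteNorm y v (k + 1)) / ((k : ℝ) + 3) := by
        funext y
        have := hermiteNorm_add_two y v (k + 1)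
        push_cast at this
        rw [eq_div_iff (by positivity)]
        linarith
      rw [h]
      have h1 := ih (k + 1) (by omega) y
      have h2 := ih k (by omega) y
      refine ((((hasDerivAt_id y).mul h1).sub (h2.const_mul v)).div_const _).congr_deriv ?_
      have h3 := hermiteNorm_add_two y v k
      rw [div_eq_iff (by positivity)]
      simp only [id]
      linarith

/-- Differentiating the Hermite factor gives `-v h_{k-1}`, the exponential gives `(x - wv) h_k`; the
recursion merges them into `(k + 1) h_{k+1}`. -/
theorem iteratedDeriv_exp_mul_sub (x v : ℝ) (k : ℕ) :
    iteratedDeriv k (fun w : ℝ => Real.exp (w * x - (1 / 2) * (w ^ 2 * v)))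
      = fun w => (k ! : ℝ) * hermiteNorm (x - w * v) v k *
        Real.exp (w * x - (1 / 2) * (w ^ 2 * v)) := by
  induction k with
  | zero => funext w; simp [hermiteNorm_zero]
  | succ k ih =>
    rw [iteratedDeriv_succ, ih]
    funext w
    have h1 : HasDerivAt (fun w : ℝ => x - w * v) (-v) w := by
      simpa using ((hasDerivAt_id w).mul_const v).const_sub x
    have h2 : HasDerivAt (fun w : ℝ => w * x - (1 / 2) * (w ^ 2 * v)) (x - w * v) w := by
      refine (((hasDerivAt_id w).mul_const x).sub
        (((hasDerivAt_pow 2 w).mul_const v).const_mul (1 / 2))).congr_deriv ?_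
      norm_num
      ring
    have h3 := h2.exp
    rw [Nat.factorial_succ]
    push_cast
    match k with
    | 0 =>
      simp only [hermiteNorm_zero, Nat.factorial_zero, Nat.cast_one, mul_one, one_mul, zero_add,
        hermiteNorm_one]
      rw [h3.deriv]
      simp [mul_comm]
    | k + 1 =>
      have h4 := (hasDerivAt_hermiteNorm v k (x - w * v)).comp w h1
      have h5 := (h4.const_mul ((k + 1)! : ℝ)).mul h3
      have h6 := hermiteNorm_add_two (x - w * v) v k
      refine h5.deriv.trans ?_
      simp only [Function.comp_apply]
      push_cast
      linear_combination (-((k + 1)! : ℝ) * Real.exp (w * x - (1 / 2) * (w ^ 2 * v))) * h6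

theorem wickPower_eq {Ω : Type*} [MeasurableSpace Ω] (P : Measure Ω) (Φ : Ω → ℝ) (k : ℕ) (ω : Ω) :
    wickPower P Φ k ω = (k ! : ℝ) * hermiteNorm (Φ ω) (∫ ω', Φ ω' ^ 2 ∂P) k := by
  have e : (fun w : ℝ => wickExp P (fun ω' => w * Φ ω') ω)
      = fun w => Real.exp (w * Φ ω - (1 / 2) * (w ^ 2 * ∫ ω', Φ ω' ^ 2 ∂P)) := by
    funext w
    simp only [wickExp, sq_abs, mul_pow]
    rw [integral_const_mul]
  rw [wickPower, e, iteratedDeriv_exp_mul_sub]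
  simp

theorem continuous_hermiteNorm (k : ℕ) : Continuous fun p : ℝ × ℝ => hermiteNorm p.1 p.2 k := by
  refine (continuous_newtonEsymm k).comp (continuous_pi fun j => ?_)
  unfold hermiteSums
  split_ifs
  · exact continuous_fst
  · exact continuous_snd
  · exact continuous_const

theorem abs_hermiteNorm_add_two_le {R x v : ℝ} (hx : |x| ≤ R) (hv0 : 0 ≤ v) (hv1 : v ≤ 1) (k : ℕ) :
    ((k : ℝ) + 2) * |hermiteNorm x v (k + 2)|
      ≤ R * |hermiteNorm x v (k + 1)| + |hermiteNorm x v k| := by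
  have h : ((k : ℝ) + 2) * |hermiteNorm x v (k + 2)|
      = |x * hermiteNorm x v (k + 1) - v * hermiteNorm x v k| := by
    rw [← hermiteNorm_add_two, abs_mul, abs_of_pos (by positivity : (0 : ℝ) < k + 2)]
  rw [h]
  refine (abs_sub _ _).trans ?_
  rw [abs_mul, abs_mul, abs_of_nonneg hv0]
  gcongr
  exact mul_le_of_le_one_left (abs_nonneg _) hv1

theorem abs_hermiteNorm_le_pow {R x v : ℝ} (hx : |x| ≤ R) (hv0 : 0 ≤ v) (hv1 : v ≤ 1) (k : ℕ) :
    |hermiteNorm x v k| ≤ (R + 1) ^ k := by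
  have hR : 0 ≤ R := (abs_nonneg x).trans hx
  induction k using Nat.twoStepInduction with
  | zero => simp [hermiteNorm_zero]
  | one => rw [hermiteNorm_one]; linarith
  | more k h0 h1 =>
    have h := abs_hermiteNorm_add_two_le hx hv0 hv1 k
    have h2 : |hermiteNorm x v (k + 2)| ≤ ((k : ℝ) + 2) * |hermiteNorm x v (k + 2)| :=
      le_mul_of_one_le_left (abs_nonneg _) (by linarith [(Nat.cast_nonneg k : (0 : ℝ) ≤ k)])
    have h3 : (0 : ℝ) ≤ (R + 1) ^ k := by positivity
    calc _ ≤ R * (R + 1) ^ (k + 1) + (R + 1) ^ k := by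
          refine h2.trans (h.trans ?_)
          gcongr
      _ ≤ (R + 1) ^ (k + 2) := by
          rw [pow_succ, pow_succ, pow_succ]
          nlinarith [mul_nonneg h3 hR]

/-- The factor `k + 2` in the recursion eventually beats any geometric growth, so the decay holds at
every rate `ρ`, uniformly for bounded `x` and `v`. This absorbs coefficients of size `C^k`. -/
theorem exists_abs_hermiteNorm_le {R ρ : ℝ} (hR : 0 ≤ R) (hρ : 0 < ρ) (hρ1 : ρ ≤ 1) :
    ∃ A : ℝ, 0 ≤ A ∧ ∀ x v : ℝ, |x| ≤ R → 0 ≤ v → v ≤ 1 → ∀ k, |hermiteNorm x v k| ≤ A * ρ ^ k := by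
  -- Beyond `k₀` one has `Rρ + 1 ≤ (k + 2) ρ²`, exactly what the induction step needs; smaller
  -- indices are absorbed in the constant.
  obtain ⟨k₀, hk₀⟩ := exists_nat_ge (R / ρ + 1 / ρ ^ 2)
  have hq : 1 ≤ (R + 1) / ρ := by
    rw [one_le_div hρ]; linarith
  refine ⟨((R + 1) / ρ) ^ (k₀ + 1), by positivity, fun x v hx hv0 hv1 k => ?_⟩
  set A := ((R + 1) / ρ) ^ (k₀ + 1) with hA
  have hA0 : 0 ≤ A := by positivity
  induction k using Nat.strong_induction_on with
  | _ k ih =>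
    rcases le_or_gt k (k₀ + 1) with hk | hk
    · calc _ ≤ (R + 1) ^ k := abs_hermiteNorm_le_pow hx hv0 hv1 k
        _ = ((R + 1) / ρ) ^ k * ρ ^ k := by rw [← mul_pow, div_mul_cancel₀ _ hρ.ne']
        _ ≤ A * ρ ^ k := by
          gcongr
          exact pow_le_pow_right₀ hq hk
    · obtain ⟨m, rfl⟩ : ∃ m, k = m + 2 := ⟨k - 2, by omega⟩
      have h := abs_hermiteNorm_add_two_le hx hv0 hv1 m
      have h1 := ih (m + 1) (by omega)
      have h0 := ih m (by omega)
      have hm : R / ρ + 1 / ρ ^ 2 ≤ (m : ℝ) + 2 := by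
        have : (k₀ : ℝ) ≤ m := by exact_mod_cast (by omega : k₀ ≤ m)
        linarith
      have hm' : R * ρ + 1 ≤ ((m : ℝ) + 2) * ρ ^ 2 := by
        calc R * ρ + 1 = (R / ρ + 1 / ρ ^ 2) * ρ ^ 2 := by field_simp
          _ ≤ _ := by gcongr
      have hm0 : (0 : ℝ) < (m : ℝ) + 2 := by positivity
      have h2 : ((m : ℝ) + 2) * |hermiteNorm x v (m + 2)| ≤ ((m : ℝ) + 2) * (A * ρ ^ (m + 2)) := by
        calc _ ≤ R * (A * ρ ^ (m + 1)) + A * ρ ^ m := h.trans (by gcongr)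
          _ = (A * ρ ^ m) * (R * ρ + 1) := by ring
          _ ≤ (A * ρ ^ m) * (((m : ℝ) + 2) * ρ ^ 2) := by gcongr
          _ = _ := by ring
      exact le_of_mul_le_mul_left h2 hm0

/-! ### Hermite series along continuous paths -/

theorem exists_abs_mul_hermiteNorm_le {a : ℕ → ℝ} {C D R : ℝ} (hC : 0 ≤ C)
    (ha : ∀ k, |a k| ≤ D * C ^ k) (hR : 0 ≤ R) :
    ∃ A : ℝ, ∀ x v : ℝ, |x| ≤ R → 0 ≤ v → v ≤ 1 →
      ∀ k, ‖a k * hermiteNorm x v k‖ ≤ A * (1 / 2) ^ k := by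
  -- This rate makes `Cρ ≤ 1/2`, also when `C = 0`.
  have hρ : 0 < 1 / (2 * (C + 1)) := by positivity
  obtain ⟨A, hA0, hA⟩ := exists_abs_hermiteNorm_le hR hρ (by
    rw [div_le_one (by positivity)]; linarith)
  have hD : 0 ≤ D := by
    have := (abs_nonneg _).trans (ha 0)
    simpa using this
  refine ⟨D * A, fun x v hx hv0 hv1 k => ?_⟩
  rw [norm_mul, Real.norm_eq_abs, Real.norm_eq_abs]
  calc |a k| * |hermiteNorm x v k| ≤ (D * C ^ k) * (A * (1 / (2 * (C + 1))) ^ k) := by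
        gcongr
        · exact ha k
        · exact hA x v hx hv0 hv1 k
    _ = D * A * (C * (1 / (2 * (C + 1)))) ^ k := by rw [mul_pow]; ring
    _ ≤ D * A * (1 / 2) ^ k := by
        gcongr
        rw [mul_one_div, div_le_div_iff₀ (by positivity) two_pos]
        linarith

section HermiteSeries

variable {a : ℕ → ℝ} {C D : ℝ} {b v : unitInterval → ℝ}

theorem exists_abs_path_le (hC : 0 ≤ C) (ha : ∀ k, |a k| ≤ D * C ^ k) (hb : Continuous b)
    (hv0 : ∀ t, 0 ≤ v t) (hv1 : ∀ t, v t ≤ 1) :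
    ∃ A : ℝ, ∀ t k, ‖a k * hermiteNorm (b t) (v t) k‖ ≤ A * (1 / 2) ^ k := by
  obtain ⟨R, hR⟩ := (isCompact_range hb).isBounded.exists_norm_le
  have hR' : ∀ t, |b t| ≤ R := fun t => hR _ ⟨t, rfl⟩
  obtain ⟨A, hA⟩ := exists_abs_mul_hermiteNorm_le hC ha ((abs_nonneg _).trans (hR' 0))
  exact ⟨A, fun t k => hA _ _ (hR' t) (hv0 t) (hv1 t) k⟩

theorem summable_mul_half_pow (A : ℝ) : Summable fun k : ℕ => A * (1 / 2 : ℝ) ^ k :=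
  summable_geometric_two.mul_left A

theorem hasSum_hermite (hC : 0 ≤ C) (ha : ∀ k, |a k| ≤ D * C ^ k) (hb : Continuous b)
    (hv0 : ∀ t, 0 ≤ v t) (hv1 : ∀ t, v t ≤ 1) (t : unitInterval) :
    HasSum (fun k => a k * hermiteNorm (b t) (v t) k)
      (∑' k, a k * hermiteNorm (b t) (v t) k) := by
  obtain ⟨A, hA⟩ := exists_abs_path_le hC ha hb hv0 hv1
  exact (Summable.of_norm_bounded (summable_mul_half_pow A) (hA t)).hasSum

theorem continuous_hermite_path (hb : Continuous b) (hv : Continuous v) (k : ℕ) :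
    Continuous fun t => a k * hermiteNorm (b t) (v t) k :=
  continuous_const.mul ((continuous_hermiteNorm k).comp (hb.prodMk hv))

theorem continuous_tsum_hermite (hC : 0 ≤ C) (ha : ∀ k, |a k| ≤ D * C ^ k) (hb : Continuous b)
    (hv : Continuous v) (hv0 : ∀ t, 0 ≤ v t) (hv1 : ∀ t, v t ≤ 1) :
    Continuous fun t => ∑' k, a k * hermiteNorm (b t) (v t) k := by
  obtain ⟨A, hA⟩ := exists_abs_path_le hC ha hb hv0 hv1
  exact continuous_tsum (continuous_hermite_path hb hv) (summable_mul_half_pow A) fun k t => hA t k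

theorem tendstoUniformly_hermite (hC : 0 ≤ C) (ha : ∀ k, |a k| ≤ D * C ^ k) (hb : Continuous b)
    (hv0 : ∀ t, 0 ≤ v t) (hv1 : ∀ t, v t ≤ 1) :
    TendstoUniformly (fun m t => ∑ k ∈ Finset.range (m + 1), a k * hermiteNorm (b t) (v t) k)
      (fun t => ∑' k, a k * hermiteNorm (b t) (v t) k) atTop := by
  obtain ⟨A, hA⟩ := exists_abs_path_le hC ha hb hv0 hv1
  have h := tendstoUniformly_tsum_nat (summable_mul_half_pow A) fun k t => hA t k
  intro u hu
  exact (tendsto_add_atTop_nat 1).eventually (h u hu)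

end HermiteSeries

/-! ### Step functions sampled from converging paths -/

theorem abs_sub_gridPoint_floor_le {m : ℕ} (hm : 1 ≤ m) (t : unitInterval) :
    |(t : ℝ) - gridPoint m ⌊(m : ℝ) * (t : ℝ)⌋₊| ≤ 1 / m := by
  have hm0 : (0 : ℝ) < m := by exact_mod_cast hm
  rw [coe_gridPoint (floor_mul_le m t)]
  have h1 := Nat.floor_le (mul_nonneg hm0.le t.2.1)
  have h2 := (Nat.lt_floor_add_one ((m : ℝ) * (t : ℝ))).le
  have h3 : (⌊(m : ℝ) * (t : ℝ)⌋₊ : ℝ) / m ≤ t := by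
    rw [div_le_iff₀ hm0]; linarith
  have h4 : (t : ℝ) ≤ (⌊(m : ℝ) * (t : ℝ)⌋₊ + 1 : ℝ) / m := by
    rw [le_div_iff₀ hm0]; linarith
  rw [abs_of_nonneg (by linarith)]
  rw [add_div] at h4
  linarith

/-- Uniform convergence handles the error at the grid points, uniform continuity of the limit the
error between them. -/
theorem SkorokhodSpace.tendsto_step {F : ℕ → unitInterval → ℝ} {x : unitInterval → ℝ}
    (hF : TendstoUniformly F x atTop) (hx : Continuous x) :
    Tendsto (fun m => step m fun r => F m (gridPoint m r)) atTop
      (𝓝 ⟨x, isCadlag_of_continuous hx⟩) := by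
  rw [EMetric.tendsto_atTop]
  intro ε hε
  obtain ⟨δ, hδ0, hδ⟩ : ∃ δ : ℝ, 0 < δ ∧ ENNReal.ofReal δ < ε := by
    obtain ⟨q, hq0, hq⟩ := ENNReal.lt_iff_exists_nnreal_btwn.1 hε
    exact ⟨q, by exact_mod_cast hq0, by simpa using hq⟩
  have huc := CompactSpace.uniformContinuous_of_continuous hx
  rw [Metric.uniformContinuous_iff] at huc
  obtain ⟨η, hη, hxη⟩ := huc (δ / 2) (by positivity)
  rw [Metric.tendstoUniformly_iff] at hF
  rw [← eventually_atTop]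
  filter_upwards [hF (δ / 2) (by positivity),
    tendsto_one_div_atTop_nhds_zero_nat.eventually_lt_const hη, eventually_ge_atTop 1] with m h1 h2 h3
  refine lt_of_le_of_lt (edist_le_ofReal fun t => ?_) hδ
  rw [step_apply]
  have h4 := h1 (gridPoint m ⌊(m : ℝ) * (t : ℝ)⌋₊)
  have h5 := hxη (a := t) (b := gridPoint m ⌊(m : ℝ) * (t : ℝ)⌋₊)
    (lt_of_le_of_lt (abs_sub_gridPoint_floor_le h3 t) h2)
  rw [Real.dist_eq] at h4 h5
  have h6 : F m (gridPoint m ⌊(m : ℝ) * (t : ℝ)⌋₊) - x t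
      = -(x (gridPoint m ⌊(m : ℝ) * (t : ℝ)⌋₊) - F m (gridPoint m ⌊(m : ℝ) * (t : ℝ)⌋₊))
        + -(x t - x (gridPoint m ⌊(m : ℝ) * (t : ℝ)⌋₊)) := by ring
  change |F m (gridPoint m ⌊(m : ℝ) * (t : ℝ)⌋₊) - x t| ≤ δ
  rw [h6]
  refine (abs_add_le _ _).trans ?_
  rw [abs_neg, abs_neg]
  linarith

/-! ### Wick polynomials of the walk: second moments -/

theorem sum_range_mul_esymmWalsh {Ω : Type*} (ξ : ℕ → Ω → ℝ) (n N : ℕ) (c b : ℕ → ℝ) (ω : Ω) :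
    ∑ k ∈ Finset.range (N + 1), c k * esymmWalsh ξ n b k ω
      = ∑ A ∈ (Finset.Icc 1 n).powerset with A.card ≤ N,
        (c A.card * ∏ i ∈ A, b i) * walsh ξ A ω := by
  rw [← Finset.sum_fiberwise_of_maps_to (s := {A ∈ (Finset.Icc 1 n).powerset | A.card ≤ N})
    (t := Finset.range (N + 1)) (g := Finset.card) fun A hA => by
      rw [Finset.mem_filter] at hA
      rw [Finset.mem_range]
      omega]
  refine Finset.sum_congr rfl fun k hk => ?_
  rw [Finset.mem_range] at hk
  have hs : {A ∈ (Finset.Icc 1 n).powerset | A.card ≤ N ∧ A.card = k}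
      = (Finset.Icc 1 n).powersetCard k := by
    ext A
    simp only [Finset.mem_filter, Finset.mem_powerset, Finset.mem_powersetCard]
    constructor
    · exact fun h => ⟨h.1, h.2.2⟩
    · exact fun h => ⟨h.1, by omega, h.2⟩
  rw [Finset.filter_filter, hs, esymmWalsh, Finset.mul_sum]
  refine Finset.sum_congr rfl fun A hA => ?_
  rw [(Finset.mem_powersetCard.1 hA).2]
  ring

section WickPolynomial

set_option linter.unusedSectionVars false

variable {Ω : Type*} [MeasurableSpace Ω] {P : Measure Ω} [IsProbabilityMeasure P]
  {H : ℝ} (hH : 1 / 2 < H) (hH1 : H < 1) {ξ : ℕ → ℕ → Ω → ℝ} {α : ℕ → ℕ → ℝ} {C : ℝ}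

/-- The Wick polynomial of degree `N` of the walk at time `j / n`. -/
def wickPolynomial (ξ : ℕ → ℕ → Ω → ℝ) (α : ℕ → ℕ → ℝ) (n N j : ℕ) (ω : Ω) : ℝ :=
  ∑ k ∈ Finset.range (N + 1), α n k * esymmWalsh (ξ n) n (walkCoeff hH hH1 n j) k ω

/-- A subset of `{1, …, n}` has at most `n` elements, so degree `n` means no truncation. -/
theorem wickPolynomial_self_eq (ξ : ℕ → ℕ → Ω → ℝ) (α : ℕ → ℕ → ℝ) (n j : ℕ) (ω : Ω) :
    wickPolynomial hH hH1 ξ α n n j ω = ∑ A ∈ (Finset.Icc 1 n).powerset,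
      (α n A.card * ∏ i ∈ A, walkCoeff hH hH1 n j i) * walsh (ξ n) A ω := by
  rw [wickPolynomial, sum_range_mul_esymmWalsh, Finset.filter_true_of_mem]
  intro A hA
  simpa using Finset.card_le_card (Finset.mem_powerset.1 hA)

theorem wickPolynomial_self_sub_eq (ξ : ℕ → ℕ → Ω → ℝ) (α : ℕ → ℕ → ℝ) (n N j : ℕ) (ω : Ω) :
    wickPolynomial hH hH1 ξ α n n j ω - wickPolynomial hH hH1 ξ α n N j ω
      = ∑ A ∈ (Finset.Icc 1 n).powerset with N < A.card,
        (α n A.card * ∏ i ∈ A, walkCoeff hH hH1 n j i) * walsh (ξ n) A ω := by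
  rw [wickPolynomial_self_eq, wickPolynomial, sum_range_mul_esymmWalsh,
    ← Finset.sum_filter_add_sum_filter_not _ (fun A : Finset ℕ => A.card ≤ N), add_sub_cancel_left]
  simp only [not_le]

theorem measurable_esymmWalsh (hξ : IsBernoulliArray ξ P) (n : ℕ) (b : ℕ → ℝ) (k : ℕ) :
    Measurable (esymmWalsh (ξ n) n b k) :=
  Finset.measurable_sum _ fun _ hA =>
    (hξ.measurable_walsh n (Finset.mem_powersetCard.1 hA).1).const_mul _

theorem measurable_wickPolynomial (hξ : IsBernoulliArray ξ P) (n N j : ℕ) :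
    Measurable (wickPolynomial hH hH1 ξ α n N j) :=
  Finset.measurable_sum _ fun k _ => (measurable_esymmWalsh hξ n _ k).const_mul _

theorem sq_le_pow_card {n k : ℕ} (hbound : ∀ n k, 1 ≤ n → 1 ≤ k → |α n k| ≤ C ^ k) (hn : 1 ≤ n)
    (hk : 1 ≤ k) : α n k ^ 2 ≤ (C ^ 2) ^ k := by
  rw [← sq_abs, ← pow_mul, mul_comm, pow_mul]
  gcongr
  exact hbound n k hn hk

theorem integrable_wickPolynomial_sub_sq (hξ : IsBernoulliArray ξ P) (n i j : ℕ) :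
    Integrable (fun ω => (wickPolynomial hH hH1 ξ α n n j ω
      - wickPolynomial hH hH1 ξ α n n i ω) ^ 2) P := by
  simp only [wickPolynomial_self_eq, ← Finset.sum_sub_distrib, ← sub_mul]
  exact hξ.integrable_sum_sq n (Finset.Subset.refl _) _

theorem integral_wickPolynomial_sub_sq_le (hξ : IsBernoulliArray ξ P)
    (hbound : ∀ n k, 1 ≤ n → 1 ≤ k → |α n k| ≤ C ^ k) {n : ℕ} (hn : 1 ≤ n) {i j : ℕ}
    (hij : i ≤ j) :
    ∫ ω, (wickPolynomial hH hH1 ξ α n n j ω - wickPolynomial hH hH1 ξ α n n i ω) ^ 2 ∂P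
      ≤ Real.exp (3 * C ^ 2) * (2 * C ^ 2) * (1 / (n : ℝ)) ^ (2 * H) * ((j : ℝ) - i) ^ (2 * H) := by
  simp only [wickPolynomial_self_eq, ← Finset.sum_sub_distrib, ← sub_mul]
  rw [hξ.integral_sum_sq n (Finset.Subset.refl _) fun A =>
    α n A.card * ∏ l ∈ A, walkCoeff hH hH1 n j l - α n A.card * ∏ l ∈ A, walkCoeff hH hH1 n i l]
  have h1 : ∀ A ∈ (Finset.Icc 1 n).powerset, (α n A.card * ∏ l ∈ A, walkCoeff hH hH1 n j l
      - α n A.card * ∏ l ∈ A, walkCoeff hH hH1 n i l) ^ 2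
      ≤ (C ^ 2) ^ A.card * (∏ l ∈ A, walkCoeff hH hH1 n j l
        - ∏ l ∈ A, walkCoeff hH hH1 n i l) ^ 2 := by
    intro A _
    rw [← mul_sub, mul_pow]
    -- The constant term cancels in the increment, so no bound on `α n 0` is required.
    rcases A.eq_empty_or_nonempty with rfl | hA
    · simp
    · gcongr
      exact sq_le_pow_card hbound hn hA.card_pos
  refine (Finset.sum_le_sum h1).trans ?_
  refine (sum_powerset_sq_prod_sub_le_exp _ (sq_nonneg C) (sum_walkCoeff_sq_le_one hH hH1 n j)
    (sum_walkCoeff_sq_le_one hH hH1 n i)).trans ?_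
  have hji : (0 : ℝ) ≤ (j : ℝ) - i := sub_nonneg.2 (by exact_mod_cast hij)
  have h2 := sum_walkCoeff_sub_sq_le hH hH1 n hij
  rw [div_eq_mul_one_div, Real.mul_rpow hji (by positivity), mul_comm] at h2
  rw [mul_one, mul_assoc _ ((1 / (n : ℝ)) ^ (2 * H))]
  gcongr

theorem integrable_wickPolynomial_tail_sq (hξ : IsBernoulliArray ξ P) (n N j : ℕ) :
    Integrable (fun ω => (wickPolynomial hH hH1 ξ α n n j ω
      - wickPolynomial hH hH1 ξ α n N j ω) ^ 2) P := by
  simp only [wickPolynomial_self_sub_eq]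
  exact hξ.integrable_sum_sq n (Finset.filter_subset _ _) _

theorem integral_wickPolynomial_tail_sq_le (hξ : IsBernoulliArray ξ P)
    (hbound : ∀ n k, 1 ≤ n → 1 ≤ k → |α n k| ≤ C ^ k) {n : ℕ} (hn : 1 ≤ n) (N j : ℕ) :
    ∫ ω, (wickPolynomial hH hH1 ξ α n n j ω - wickPolynomial hH hH1 ξ α n N j ω) ^ 2 ∂P
      ≤ (1 / 4) ^ N * Real.exp (4 * C ^ 2) := by
  simp only [wickPolynomial_self_sub_eq]
  rw [hξ.integral_sum_sq n (Finset.filter_subset _ _) fun A =>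
    α n A.card * ∏ l ∈ A, walkCoeff hH hH1 n j l]
  have h := sum_powerset_card_gt_le _ (sq_nonneg C) (sum_walkCoeff_sq_le_one hH hH1 n j) N
  rw [mul_one] at h
  refine le_trans (Finset.sum_le_sum fun A hA => ?_) h
  rw [Finset.mem_filter] at hA
  rw [mul_pow]
  gcongr
  exact sq_le_pow_card hbound hn (by omega)

/-! ### Approximation by finitely many grid points -/

/-- The Wick polynomials of full degree as a random element of the Skorokhod space. -/
def wickProcess (ξ : ℕ → ℕ → Ω → ℝ) (α : ℕ → ℕ → ℝ) (n : ℕ) (ω : Ω) : SkorokhodSpace :=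
  SkorokhodSpace.step n fun j => wickPolynomial hH hH1 ξ α n n j ω

/-- The Wick polynomials of degree `m`, sampled at the times `r / m`. -/
def wickSample (ξ : ℕ → ℕ → Ω → ℝ) (α : ℕ → ℕ → ℝ) (m n : ℕ) (ω : Ω) : SkorokhodSpace :=
  SkorokhodSpace.step m fun r =>
    wickPolynomial hH hH1 ξ α n m ⌊(n : ℝ) * (gridPoint m r : ℝ)⌋₊ ω

theorem floor_mul_gridPoint_le {m : ℕ} (hm : 1 ≤ m) (n : ℕ) (t : unitInterval) :
    ⌊(n : ℝ) * (gridPoint m ⌊(m : ℝ) * (t : ℝ)⌋₊ : ℝ)⌋₊ ≤ ⌊(n : ℝ) * (t : ℝ)⌋₊ := by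
  have hm0 : (0 : ℝ) < m := by exact_mod_cast hm
  refine Nat.floor_le_floor (mul_le_mul_of_nonneg_left ?_ n.cast_nonneg)
  rw [coe_gridPoint (floor_mul_le m t), div_le_iff₀ hm0, mul_comm (t : ℝ)]
  exact Nat.floor_le (mul_nonneg hm0.le t.2.1)

theorem floor_mul_sub_le {m n : ℕ} (hm : 1 ≤ m) (hmn : m ≤ n) (t : unitInterval) {l : ℕ}
    (hl : 2 * (n : ℝ) / m ≤ 2 ^ l) :
    ⌊(n : ℝ) * (t : ℝ)⌋₊ - ⌊(n : ℝ) * (gridPoint m ⌊(m : ℝ) * (t : ℝ)⌋₊ : ℝ)⌋₊ ≤ 2 ^ l := by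
  have hm0 : (0 : ℝ) < m := by exact_mod_cast hm
  have h1 := abs_sub_gridPoint_floor_le hm t
  obtain ⟨s, hs⟩ : ∃ s : ℝ, s = (gridPoint m ⌊(m : ℝ) * (t : ℝ)⌋₊ : ℝ) := ⟨_, rfl⟩
  rw [← hs] at h1 ⊢
  have h2 : (t : ℝ) ≤ s + 1 / m := by linarith [(abs_le.1 h1).2]
  have h3 := Nat.floor_le (mul_nonneg (n.cast_nonneg : (0 : ℝ) ≤ n) t.2.1)
  have h4 := Nat.lt_floor_add_one ((n : ℝ) * s)
  have h5 : (n : ℝ) * t ≤ n * s + n / m := by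
    calc (n : ℝ) * t ≤ n * (s + 1 / m) := by gcongr
      _ = _ := by ring
  have h6 : (1 : ℝ) ≤ n / m := by
    rw [one_le_div hm0]; exact_mod_cast hmn
  have h7 : 2 * (n : ℝ) / m = n / m + n / m := by ring
  have h8 : (⌊(n : ℝ) * (t : ℝ)⌋₊ : ℝ) ≤ (2 ^ l + ⌊(n : ℝ) * s⌋₊ : ℕ) := by
    push_cast
    linarith
  have h9 : ⌊(n : ℝ) * (t : ℝ)⌋₊ ≤ 2 ^ l + ⌊(n : ℝ) * s⌋₊ := by exact_mod_cast h8
  exact Nat.sub_le_iff_le_add.2 h9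

/-- Each of the `m + 1` grid points contributes the maximal increment over its block, of order
`m^{-2H}`, and the squared error of cutting the degree at `m`. The resulting bound is independent of
`n` and tends to `0` in `m` since `2H > 1`. -/
theorem exists_sq_bound (hξ : IsBernoulliArray ξ P)
    (hbound : ∀ n k, 1 ≤ n → 1 ≤ k → |α n k| ≤ C ^ k) :
    ∃ K : ℝ, 0 ≤ K ∧ ∀ m n : ℕ, 1 ≤ m → m ≤ n → ∃ Γ : Ω → ℝ, Integrable Γ P ∧
      (∀ ω t, (wickProcess hH hH1 ξ α n ω t - wickSample hH hH1 ξ α m n ω t) ^ 2 ≤ 2 * Γ ω) ∧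
      ∫ ω, Γ ω ∂P ≤ ((m : ℝ) + 1) * (K * (4 / (m : ℝ)) ^ (2 * H)
        + (1 / 4) ^ m * Real.exp (4 * C ^ 2)) := by
  obtain ⟨K, hK0, hK⟩ := exists_maximal_bound (β := 2 * H) (by linarith)
  set E := Real.exp (3 * C ^ 2) * (2 * C ^ 2) with hE
  have hE0 : 0 ≤ E := by positivity
  refine ⟨K * E, by positivity, fun m n hm hmn => ?_⟩
  have hn : 1 ≤ n := hm.trans hmn
  have hm0 : (0 : ℝ) < m := by exact_mod_cast hm
  have hn0 : (0 : ℝ) < n := by exact_mod_cast hn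
  -- A block of length `1/m` has fewer than `n/m + 1 ≤ 2n/m` steps; `2^l` is a power of two covering
  -- it, at most twice too long.
  obtain ⟨l, hl1, hl2⟩ : ∃ l : ℕ, 2 * (n : ℝ) / m ≤ 2 ^ l ∧ (2 : ℝ) ^ l ≤ 4 * n / m := by
    have h1 : (1 : ℝ) ≤ 2 * n / m := by
      rw [one_le_div hm0]
      have : (m : ℝ) ≤ n := by exact_mod_cast hmn
      linarith
    obtain ⟨l, h2, h3⟩ := exists_nat_pow_near h1 (one_lt_two : (1 : ℝ) < 2)
    refine ⟨l + 1, h3.le, ?_⟩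
    rw [pow_succ]
    calc (2 : ℝ) ^ l * 2 ≤ 2 * n / m * 2 := by gcongr
      _ = 4 * n / m := by ring
  have hmax := hK P (wickPolynomial hH hH1 ξ α n n) (E * (1 / (n : ℝ)) ^ (2 * H)) (by positivity)
    (fun i j _ => integrable_wickPolynomial_sub_sq hH hH1 hξ n i j)
    (fun i j hij => integral_wickPolynomial_sub_sq_le hH hH1 hξ hbound hn hij) l
  choose G hGi hGb hGint using hmax
  set p : ℕ → ℕ := fun r => ⌊(n : ℝ) * (gridPoint m r : ℝ)⌋₊ with hp
  have hG0 : ∀ i ω, 0 ≤ G i ω := fun i ω => (sq_nonneg _).trans (hGb i ω 0 (Nat.zero_le _))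
  have hTi := fun j => integrable_wickPolynomial_tail_sq hH hH1 (α := α) hξ n m j
  -- The supremum over `t` is bounded by summing over all blocks; this costs the factor `m + 1`.
  refine ⟨fun ω => ∑ r ∈ Finset.range (m + 1), (G (p r) ω +
    (wickPolynomial hH hH1 ξ α n n (p r) ω - wickPolynomial hH hH1 ξ α n m (p r) ω) ^ 2),
    integrable_finsetSum _ fun r _ => (hGi _).add (hTi _), fun ω t => ?_, ?_⟩
  · set r := ⌊(m : ℝ) * (t : ℝ)⌋₊ with hr
    have hrm : r ∈ Finset.range (m + 1) := Finset.mem_range.2 (floor_mul_lt m t)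
    have h1 := Finset.single_le_sum (f := fun r => G (p r) ω +
      (wickPolynomial hH hH1 ξ α n n (p r) ω - wickPolynomial hH hH1 ξ α n m (p r) ω) ^ 2)
      (fun r _ => add_nonneg (hG0 _ ω) (sq_nonneg _)) hrm
    have h2 := hGb (p r) ω _ (floor_mul_sub_le hm hmn t hl1)
    have h3 : p r + (⌊(n : ℝ) * (t : ℝ)⌋₊ - ⌊(n : ℝ) * (gridPoint m r : ℝ)⌋₊)
        = ⌊(n : ℝ) * (t : ℝ)⌋₊ := Nat.add_sub_cancel' (floor_mul_gridPoint_le hm n t)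
    rw [h3] at h2
    change (wickPolynomial hH hH1 ξ α n n ⌊(n : ℝ) * (t : ℝ)⌋₊ ω
      - wickPolynomial hH hH1 ξ α n m (p r) ω) ^ 2 ≤ _
    dsimp only at h1 ⊢
    nlinarith [sq_nonneg ((wickPolynomial hH hH1 ξ α n n ⌊(n : ℝ) * (t : ℝ)⌋₊ ω
      - wickPolynomial hH hH1 ξ α n n (p r) ω) - (wickPolynomial hH hH1 ξ α n n (p r) ω
      - wickPolynomial hH hH1 ξ α n m (p r) ω))]
  · have h0 := integral_finsetSum (μ := P) (Finset.range (m + 1))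
      fun r _ => (hGi (p r)).add (hTi (p r))
    simp only [Pi.add_apply] at h0
    refine h0.le.trans ?_
    have h1 : ∀ r ∈ Finset.range (m + 1), ∫ ω, (G (p r) ω +
        (wickPolynomial hH hH1 ξ α n n (p r) ω - wickPolynomial hH hH1 ξ α n m (p r) ω) ^ 2) ∂P
        ≤ K * E * (4 / (m : ℝ)) ^ (2 * H) + (1 / 4) ^ m * Real.exp (4 * C ^ 2) := by
      intro r _
      rw [integral_add (hGi _) (hTi _)]
      refine add_le_add ((hGint (p r)).trans ?_)
        (integral_wickPolynomial_tail_sq_le hH hH1 hξ hbound hn m _)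
      have h2 : (1 / (n : ℝ)) ^ (2 * H) * ((2 : ℝ) ^ l) ^ (2 * H) ≤ (4 / (m : ℝ)) ^ (2 * H) := by
        rw [← Real.mul_rpow (by positivity) (by positivity)]
        refine Real.rpow_le_rpow (by positivity) ?_ (by linarith)
        calc 1 / (n : ℝ) * 2 ^ l ≤ 1 / (n : ℝ) * (4 * n / m) := by gcongr
          _ = 4 / m := by field_simp
      calc K * (E * (1 / (n : ℝ)) ^ (2 * H)) * ((2 : ℝ) ^ l) ^ (2 * H)
          = K * E * ((1 / (n : ℝ)) ^ (2 * H) * ((2 : ℝ) ^ l) ^ (2 * H)) := by ring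
        _ ≤ _ := by gcongr
    refine (Finset.sum_le_sum h1).trans ?_
    rw [Finset.sum_const, Finset.card_range, nsmul_eq_mul]
    push_cast
    exact le_rfl

theorem tendsto_sq_bound {H : ℝ} (hH : 1 / 2 < H) (K L : ℝ) :
    Tendsto (fun m : ℕ => ((m : ℝ) + 1) * (K * (4 / (m : ℝ)) ^ (2 * H) + (1 / 4) ^ m * L)) atTop
      (𝓝 0) := by
  have h1 : Tendsto (fun m : ℕ => (m : ℝ) ^ (-(2 * H - 1))) atTop (𝓝 0) :=
    (tendsto_rpow_neg_atTop (by linarith)).comp tendsto_natCast_atTop_atTop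
  have h2 : Tendsto (fun m : ℕ => (m : ℝ) ^ (-(2 * H))) atTop (𝓝 0) :=
    (tendsto_rpow_neg_atTop (by linarith)).comp tendsto_natCast_atTop_atTop
  have h3 : Tendsto (fun m : ℕ => (m : ℝ) * (1 / 4 : ℝ) ^ m) atTop (𝓝 0) :=
    tendsto_self_mul_const_pow_of_lt_one (by norm_num) (by norm_num)
  have h4 : Tendsto (fun m : ℕ => (1 / 4 : ℝ) ^ m) atTop (𝓝 0) :=
    tendsto_pow_atTop_nhds_zero_of_lt_one (by norm_num) (by norm_num)
  have h5 := ((h1.add h2).const_mul (K * 4 ^ (2 * H))).add ((h3.add h4).mul_const L)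
  simp only [add_zero, mul_zero, zero_mul] at h5
  refine h5.congr' ?_
  filter_upwards [eventually_ge_atTop 1] with m hm
  have hm0 : (0 : ℝ) < m := by exact_mod_cast hm
  have e1 : (m : ℝ) ^ (-(2 * H - 1)) = m * (m : ℝ) ^ (-(2 * H)) := by
    rw [← Real.rpow_one_add' hm0.le (by linarith)]
    ring_nf
  have e2 : (4 / (m : ℝ)) ^ (2 * H) = 4 ^ (2 * H) * (m : ℝ) ^ (-(2 * H)) := by
    rw [Real.div_rpow (by norm_num) hm0.le, Real.rpow_neg hm0.le, div_eq_mul_inv]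
  rw [e1, e2]
  ring

theorem wickSample_approx (hξ : IsBernoulliArray ξ P)
    (hbound : ∀ n k, 1 ≤ n → 1 ≤ k → |α n k| ≤ C ^ k) {δ : ℝ} (hδ : 0 < δ) :
    ∀ᶠ m in atTop, ∀ᶠ n in atTop, ∃ g : Ω → ℝ, Integrable g P ∧ (∀ ω, 0 ≤ g ω) ∧
      (∀ ω, edist (wickProcess hH hH1 ξ α n ω) (wickSample hH hH1 ξ α m n ω)
        ≤ ENNReal.ofReal (g ω)) ∧ ∫ ω, g ω ∂P ≤ δ := by
  obtain ⟨K, -, hK⟩ := exists_sq_bound hH hH1 (P := P) hξ hbound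
  have hlim := tendsto_sq_bound hH K (Real.exp (4 * C ^ 2))
  filter_upwards [hlim.eventually_lt_const (show 0 < δ ^ 2 / 2 by positivity),
    eventually_ge_atTop 1] with m hm hm1
  filter_upwards [eventually_ge_atTop m] with n hn
  obtain ⟨Γ, hΓi, hΓ, hΓint⟩ := hK m n hm1 hn
  -- From `x² ≤ 2Γ` and `2δ|x| ≤ δ² + x²` follows `|x| ≤ δ/2 + Γ/δ`, so the bound on `E Γ` controls
  -- the mean distance without a square root.
  refine ⟨fun ω => δ / 2 + Γ ω / δ, (integrable_const _).add (hΓi.div_const _), fun ω => ?_,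
    fun ω => SkorokhodSpace.edist_le_ofReal fun t => ?_, ?_⟩
  · have : 0 ≤ Γ ω := by linarith [(sq_nonneg _).trans (hΓ ω 0)]
    positivity
  · have h1 := hΓ ω t
    set x := wickProcess hH hH1 ξ α n ω t - wickSample hH hH1 ξ α m n ω t
    rw [← sq_abs] at h1
    have h2 : δ / 2 + Γ ω / δ = (δ ^ 2 + 2 * Γ ω) / (2 * δ) := by field_simp
    change |x| ≤ δ / 2 + Γ ω / δ
    rw [h2, le_div_iff₀ (by positivity)]
    nlinarith [sq_nonneg (|x| - δ)]
  · have h4 : ∫ ω, (δ / 2 + Γ ω / δ) ∂P = δ / 2 + (∫ ω, Γ ω ∂P) / δ := by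
      rw [integral_add (integrable_const _) (hΓi.div_const _), integral_div δ Γ, integral_const,
        probReal_univ, one_smul]
    refine h4.le.trans ?_
    have h3 : (∫ ω, Γ ω ∂P) / δ ≤ δ / 2 := by
      rw [div_le_iff₀ hδ]
      nlinarith
    linarith

end WickPolynomial

/-! ### Convergence of the sampled processes -/

section Sample

variable {Ω Ω' : Type*} [MeasurableSpace Ω] [MeasurableSpace Ω']
  {P : Measure Ω} [IsProbabilityMeasure P] {P' : Measure Ω'} [IsProbabilityMeasure P']
  {H : ℝ} (hH : 1 / 2 < H) (hH1 : H < 1) {ξ : ℕ → ℕ → Ω → ℝ} {BH : unitInterval → Ω' → ℝ}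
  {α : ℕ → ℕ → ℝ} {a : ℕ → ℝ}

theorem tendsto_gridPoint_floor (t : unitInterval) :
    Tendsto (fun n : ℕ => gridPoint n ⌊(n : ℝ) * (t : ℝ)⌋₊) atTop (𝓝 t) := by
  rw [tendsto_iff_dist_tendsto_zero]
  refine squeeze_zero' (Eventually.of_forall fun n => dist_nonneg) ?_
    tendsto_one_div_atTop_nhds_zero_nat
  filter_upwards [eventually_ge_atTop 1] with n hn
  rw [dist_comm]
  exact abs_sub_gridPoint_floor_le hn t

/-- The second power sum is deterministic because `ξ² = 1`; for `j ≥ 3` it is at most `max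
|b_i|^{j-2} · ∑ b_i²`. The convergence holds for every `ω`. The number `x` is a dummy, as `j ≥ 2`.
-/
theorem tendsto_powerSum_walk (hξ : IsBernoulliArray ξ P) {k : ℕ → ℕ} {t : unitInterval}
    (hk : Tendsto (fun n => gridPoint n (k n)) atTop (𝓝 t)) {j : ℕ} (hj : 2 ≤ j) (x : ℝ) (ω : Ω) :
    Tendsto (fun n => ∑ i ∈ Finset.Icc 1 n, (walkCoeff hH hH1 n (k n) i * ξ n i ω) ^ j) atTop
      (𝓝 (hermiteSums x ((t : ℝ) ^ (2 * H)) j)) := by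
  have hF := ((continuous_kernelVec hH hH1).tendsto _).comp hk
  rcases hj.eq_or_lt with rfl | hj3
  · have h1 := tendsto_sum_inner_cellVec_sq hF
    rw [norm_kernelVec_sq] at h1
    simp only [hermiteSums, OfNat.ofNat_ne_one, if_false, if_true]
    refine h1.congr fun n => Finset.sum_congr rfl fun i hi => ?_
    rw [mul_pow, hξ.sq_eq_one n hi, mul_one]
    rfl
  · rw [hermiteSums, if_neg (by omega), if_neg (by omega), Metric.tendsto_nhds]
    intro ε hε
    filter_upwards [eventually_abs_inner_cellVec_le hF (show 0 < min 1 (ε / 2) by positivity)]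
      with n hn
    rw [Real.dist_eq, sub_zero]
    calc _ ≤ ∑ i ∈ Finset.Icc 1 n, |(walkCoeff hH hH1 n (k n) i * ξ n i ω) ^ j| :=
          Finset.abs_sum_le_sum_abs _ _
      _ ≤ ∑ i ∈ Finset.Icc 1 n, ε / 2 * walkCoeff hH hH1 n (k n) i ^ 2 := by
          refine Finset.sum_le_sum fun i hi => ?_
          have h1 : |walkCoeff hH hH1 n (k n) i| ≤ min 1 (ε / 2) := hn i hi
          have h2 : |ξ n i ω| = 1 := by
            rcases hξ.values n i hi ω with h | h <;> simp [h]
          obtain ⟨q, rfl⟩ : ∃ q, j = q + 1 + 2 := ⟨j - 3, by omega⟩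
          rw [abs_pow, abs_mul, h2, mul_one, pow_add, sq_abs]
          gcongr
          calc |walkCoeff hH hH1 n (k n) i| ^ (q + 1)
              ≤ |walkCoeff hH hH1 n (k n) i| := pow_le_of_le_one (abs_nonneg _)
                (h1.trans (min_le_left _ _)) (by omega)
            _ ≤ ε / 2 := h1.trans (min_le_right _ _)
      _ = ε / 2 * ∑ i ∈ Finset.Icc 1 n, walkCoeff hH hH1 n (k n) i ^ 2 := by
          rw [Finset.mul_sum]
      _ ≤ ε / 2 * 1 := by
          gcongr
          exact sum_walkCoeff_sq_le_one hH hH1 n (k n)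
      _ < ε := by linarith

/-- The power sums up to order `m` of which the first is `x`, and the others are given by `q`. -/
def joinSums {m : ℕ} (x : ℝ) (q : Fin (m + 1) → ℝ) (j : ℕ) : ℝ :=
  if j = 1 then x else if h : j < m + 1 then q ⟨j, h⟩ else 0

/-- The step function of the Wick polynomials, as a function of the power sums and of the
coefficients. -/
def stepOfSums (m : ℕ)
    (z : (Fin (m + 1) → ℝ) × (Fin (m + 1) → ℝ) × (Fin (m + 1) → Fin (m + 1) → ℝ)) :
    SkorokhodSpace :=
  SkorokhodSpace.step m fun r =>
    ∑ k : Fin (m + 1), z.2.1 k * newtonEsymm (joinSums (z.1 r) (z.2.2 r)) k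

theorem continuous_stepOfSums (m : ℕ) : Continuous (stepOfSums m) := by
  refine (SkorokhodSpace.continuous_step m).comp (continuous_pi fun r =>
    continuous_finsetSum _ fun k _ => Continuous.mul (by fun_prop) ?_)
  refine (continuous_newtonEsymm k).comp (continuous_pi fun j => ?_)
  unfold joinSums
  split_ifs <;> fun_prop

/-- Slutsky's theorem and continuous mapping: the first power sums converge jointly in law, the
higher ones and the coefficients to constants, and the sampled process is a continuous function of
all of them. -/
theorem tendstoInDistribution_wickSample (hξ : IsBernoulliArray ξ P)
    (hBH : IsFractionalBrownianMotion H BH P')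
    (hlim : ∀ k, Tendsto (fun n => α n k) atTop (𝓝 (a k))) (m : ℕ) :
    TendstoInDistribution (wickSample hH hH1 ξ α m) atTop
      (fun ω => SkorokhodSpace.step m fun r => ∑ k ∈ Finset.range (m + 1),
        a k * hermiteNorm (BH (gridPoint m r) ω) ((gridPoint m r : ℝ) ^ (2 * H)) k)
      (fun _ => P) P' := by
  set p : ℕ → Fin (m + 1) → ℕ := fun n r => ⌊(n : ℝ) * (gridPoint m r : ℝ)⌋₊ with hp
  have hwalk := tendstoInDistribution_walk hH hH1 hξ hBH (fun r : Fin (m + 1) => gridPoint m r)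
    p fun r => tendsto_gridPoint_floor _
  set W : ℕ → Ω → (Fin (m + 1) → ℝ) × (Fin (m + 1) → Fin (m + 1) → ℝ) := fun n ω =>
    -- The power sum of order `0` equals `n` and would diverge, but Newton's recursion never reads
    -- it; order `1` is supplied by the walk. Both slots are set to `0`.
    (fun k => α n k, fun r j => if (j : ℕ) ≤ 1 then 0 else
      ∑ i ∈ Finset.Icc 1 n, (walkCoeff hH hH1 n (p n r) i * ξ n i ω) ^ (j : ℕ)) with hW
  set w : (Fin (m + 1) → ℝ) × (Fin (m + 1) → Fin (m + 1) → ℝ) :=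
    (fun k => a k, fun r j => if (j : ℕ) ≤ 1 then 0 else
      hermiteSums 0 ((gridPoint m r : ℝ) ^ (2 * H)) j) with hw
  have hWm : ∀ n, Measurable (W n) := fun n => by
    refine measurable_const.prodMk
      (measurable_pi_lambda _ fun r => measurable_pi_lambda _ fun j => ?_)
    split_ifs
    · exact measurable_const
    · exact Finset.measurable_sum _ fun i hi => ((hξ.measurable n i hi).const_mul _).pow_const _
  have hWlim : TendstoInMeasure P W atTop fun _ => w := by
    refine tendstoInMeasure_of_tendsto_ae (fun n => (hWm n).aestronglyMeasurable)
      (ae_of_all _ fun ω => Tendsto.prodMk_nhds (tendsto_pi_nhds.2 fun k => hlim k)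
        (tendsto_pi_nhds.2 fun r => tendsto_pi_nhds.2 fun j => ?_))
    split_ifs with hj
    · exact tendsto_const_nhds
    · exact tendsto_powerSum_walk hH hH1 hξ (tendsto_gridPoint_floor _) (by omega) 0 ω
  have key := hwalk.continuous_comp_prodMk_of_tendstoInMeasure_const (continuous_stepOfSums m)
    hWlim fun n => (hWm n).aemeasurable
  refine key.congr (fun n => ae_of_all _ fun ω => ?_) (ae_of_all _ fun ω => ?_)
  · refine congrArg (SkorokhodSpace.step m) (funext fun r => ?_)
    rw [wickPolynomial, Finset.sum_range]
    refine Finset.sum_congr rfl fun k _ => ?_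
    rw [esymmWalsh_eq_newtonEsymm]
    refine congrArg (α n k * ·) (newtonEsymm_congr _ fun j hj hjk => ?_)
    have hjm : j < m + 1 := by omega
    rw [joinSums]
    split_ifs with h1
    · subst h1
      simp [hp]
    · simp only [hW]
      rw [if_neg (show ¬ j ≤ 1 by omega)]
  · refine congrArg (SkorokhodSpace.step m) (funext fun r => ?_)
    rw [Finset.sum_range]
    refine Finset.sum_congr rfl fun k _ => ?_
    rw [hermiteNorm]
    refine congrArg (a k * ·) (newtonEsymm_congr _ fun j hj hjk => ?_)
    have hjm : j < m + 1 := by omega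
    rw [joinSums, hermiteSums]
    split_ifs with h1 h2
    · rfl
    · simp only [hw, hermiteSums]
      rw [if_neg (show ¬ j ≤ 1 by omega), if_neg h1, if_pos h2]
    · simp only [hw, hermiteSums]
      rw [if_neg (show ¬ j ≤ 1 by omega), if_neg h1, if_neg h2]

end Sample

/-! ### The limit process -/

theorem IsFractionalBrownianMotion.integral_sq {Ω : Type*} [MeasurableSpace Ω] {P : Measure Ω}
    {H : ℝ} (hH : 1 / 2 < H) {B : unitInterval → Ω → ℝ} (hB : IsFractionalBrownianMotion H B P)
    (t : unitInterval) : ∫ ω, B t ω ^ 2 ∂P = (t : ℝ) ^ (2 * H) := by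
  simp only [sq]
  rw [hB.covariance t t, sub_self, abs_zero, Real.zero_rpow (by linarith), abs_of_nonneg t.2.1]
  ring

/-- The constant `max 1 |a 0|` covers `k = 0`, about which the hypothesis says nothing. -/
theorem abs_le_max_one_mul_pow {α : ℕ → ℕ → ℝ} {a : ℕ → ℝ} {C : ℝ} (hC : 0 ≤ C)
    (hlim : ∀ k, Tendsto (fun n => α n k) atTop (𝓝 (a k)))
    (hbound : ∀ n k, 1 ≤ n → 1 ≤ k → |α n k| ≤ C ^ k) (k : ℕ) :
    |a k| ≤ max 1 |a 0| * C ^ k := by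
  rcases Nat.eq_zero_or_pos k with rfl | hk
  · simp
  · have h : |a k| ≤ C ^ k := by
      refine le_of_tendsto (hlim k).abs ?_
      filter_upwards [eventually_ge_atTop 1] with n hn
      exact hbound n k hn hk
    exact h.trans (le_mul_of_one_le_left (pow_nonneg hC k) (le_max_left _ _))

theorem wickProcess_apply {Ω : Type*} [MeasurableSpace Ω] {P : Measure Ω} [IsProbabilityMeasure P]
    {H : ℝ} (hH : 1 / 2 < H) (hH1 : H < 1) {ξ : ℕ → ℕ → Ω → ℝ} (hξ : IsBernoulliArray ξ P)
    (α : ℕ → ℕ → ℝ) (n : ℕ) (ω : Ω) (t : unitInterval) :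
    wickProcess hH hH1 ξ α n ω t = ∑ k ∈ Finset.range (n + 1),
      α n k / (k ! : ℝ) * discreteWickPower P n (ξ n) (disturbedWalk H ξ n t) k ω := by
  rw [wickProcess, SkorokhodSpace.step_apply, wickPolynomial]
  refine Finset.sum_congr rfl fun k _ => ?_
  rw [funext (disturbedWalk_eq_sum hH hH1 ξ n t), hξ.discreteWickPower_linear n _ k]
  have : (k ! : ℝ) ≠ 0 := by positivity
  field_simp

open scoped Classical in
/-- The Wick power series with coefficients `a` along the continuous paths of `B`, as a random
element of the Skorokhod space. -/
def wickSeries {Ω : Type*} (H : ℝ) (B : unitInterval → Ω → ℝ) (a : ℕ → ℝ) (ω : Ω) :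
    SkorokhodSpace :=
  if h : Continuous fun t : unitInterval => ∑' k, a k * hermiteNorm (B t ω) ((t : ℝ) ^ (2 * H)) k
  then ⟨_, isCadlag_of_continuous h⟩ else ⟨fun _ => 0, isCadlag_of_continuous continuous_const⟩

end WickApprox

end

/-! ### Proof of the main theorem -/

theorem theorem3p1
    {Ω Ω' : Type*} [MeasurableSpace Ω] [MeasurableSpace Ω']
    (P : Measure Ω) [IsProbabilityMeasure P] (P' : Measure Ω') [IsProbabilityMeasure P']
    (H : ℝ) (hH : 1 / 2 < H) (hH1 : H < 1)
    (ξ : ℕ → ℕ → Ω → ℝ) (hξ : IsBernoulliArray ξ P)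
    (BH : unitInterval → Ω' → ℝ) (hBH : IsFractionalBrownianMotion H BH P')
    (α : ℕ → ℕ → ℝ) (a : ℕ → ℝ)
    (hlim : ∀ k, Tendsto (fun n => α n k) atTop (𝓝 (a k)))
    (C : ℝ) (hC : 0 ≤ C) (hbound : ∀ n k, 1 ≤ n → 1 ≤ k → |α n k| ≤ C ^ k) :
    ∃ (Y : ℕ → Ω → SkorokhodSpace) (X : Ω' → SkorokhodSpace),
      (∀ n ω t, Y n ω t = ∑ k ∈ Finset.range (n + 1),
        α n k / (k ! : ℝ) * discreteWickPower P n (ξ n) (disturbedWalk H ξ n t) k ω) ∧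
      (∀ᵐ ω ∂P', ∀ t, HasSum (fun k => a k / (k ! : ℝ) * wickPower P' (BH t) k ω) (X ω t)) ∧
      TendstoInDistribution Y atTop X (fun _ => P) P' := by
  have ha := abs_le_max_one_mul_pow hC hlim hbound
  have hv : Continuous fun t : unitInterval => (t : ℝ) ^ (2 * H) :=
    Continuous.rpow_const continuous_subtype_val fun _ => Or.inr (by linarith)
  have hv0 : ∀ t : unitInterval, 0 ≤ (t : ℝ) ^ (2 * H) := fun t => Real.rpow_nonneg t.2.1 _
  have hv1 : ∀ t : unitInterval, (t : ℝ) ^ (2 * H) ≤ 1 := fun t =>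
    Real.rpow_le_one t.2.1 t.2.2 (by linarith)
  -- Almost every path of `B^H` is continuous, so the default value in `wickSeries` affects only a
  -- null set.
  have hX : ∀ ω, ∀ hω : Continuous fun t => BH t ω, wickSeries H BH a ω
      = ⟨_, isCadlag_of_continuous (continuous_tsum_hermite hC ha hω hv hv0 hv1)⟩ :=
    fun ω hω => dif_pos (continuous_tsum_hermite hC ha hω hv hv0 hv1)
  refine ⟨wickProcess hH hH1 ξ α, wickSeries H BH a, wickProcess_apply hH hH1 hξ α, ?_, ?_⟩
  · filter_upwards [hBH.continuous_paths] with ω hω t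
    rw [hX ω hω]
    refine (hasSum_hermite hC ha hω hv0 hv1 t).congr_fun fun k => ?_
    rw [wickPower_eq, hBH.integral_sq hH]
    have : (k ! : ℝ) ≠ 0 := by positivity
    field_simp
  · refine tendstoInDistribution_of_approx P P'
      (fun n => ((SkorokhodSpace.continuous_step n).measurable.comp (measurable_pi_lambda _
        fun j => measurable_wickPolynomial hH hH1 hξ n n j)).aemeasurable)
      (tendstoInDistribution_wickSample hH hH1 hξ hBH hlim) ?_
      fun δ hδ => wickSample_approx hH hH1 hξ hbound hδ
    filter_upwards [hBH.continuous_paths] with ω hω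
    rw [hX ω hω]
    exact SkorokhodSpace.tendsto_step (tendstoUniformly_hermite hC ha hω hv0 hv1)
      (continuous_tsum_hermite hC ha hω hv hv0 hv1)
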